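/- A cycle shape $\rho=1^{a_1}2^{a_2}\cdots N^{a_N}$ is a multiset of positive integers, in which $j$ occurs $a_j$ times. It is called balanced if for some positive integer $M$ the shape $(M/1)^{a_1}(M/2)^{a_2}\cdots(M/N)^{a_N}$ equals $\rho$. To $\rho$ one assigns the eta-product $g_\rho(\tau)=\prod_j\eta(j\tau)^{a_j}$, where $\eta$ is the Dedekind eta function, and we put $q=e^{2\pi i\tau}$. If $\rho$ is a partition of $12$, i.e. $\sum_j j a_j=12$, then $g_\rho(\tau)=\sum_{n\ge1}a_n q^{n/2}$ on the upper half-plane with uniquely determined coefficients $a_n$, and $g_\rho$ is called multiplicative if $a_{mn}=a_ma_n$ whenever $\gcd(m,n)=1$. Let $2\rho$ denote the partition of $24$ obtained from $\rho$ by doubling every cycle length. Let $\mathcal D$ be the Dummit–Kisilevsky–McKay list of $30$ cycle shapes of multiplicative eta-products: $1^{24}$, $2^{12}$, $3^8$, $4^6$, $6^4$, $8^3$, $12^2$, $24$, $1^82^8$, $1^63^6$, $1^45^4$, $1^37^3$, $1^2 11^2$, $1\cdot23$, $2^44^4$, $2^36^3$, $2^2 10^2$, $2\cdot22$, $3^29^2$,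 $3\cdot21$, $4^28^2$, $4\cdot20$, $6\cdot18$, $8\cdot16$, $1^42^24^4$, $1^2\,2\cdot4\cdot8^2$, $1^22^23^26^2$, $1\cdot2\cdot7\cdot14$, $1\cdot3\cdot5\cdot15$, $2\cdot4\cdot6\cdot12$. Exactly $15$ of these have only even cycles. Let the Mathieu group $M_{12}$ act on $12$ points in the standard way; the cycle shape of a conjugacy class of $M_{12}$ is that of any of its elements. Then the following hold. (1) For every partition $\rho$ of $12$, the coefficients of $g_\rho$ in powers of $q^{1/2}$ are, after $q\to q^2$, the coefficients of $g_{2\rho}$ in powers of $q$; and $g_\rho$ is multiplicative if and only if $2\rho\in\mathcal D$. (2) $M_{12}$ has exactly fifteen conjugacy classes, and they can be labelled so that their cycle shapes are 1A: $1^{12}$; 2A: $2^6$; 2B: $1^42^4$; 3A: $1^33^3$; 3B: $3^4$; 4A: $2^24^2$; 4B: $1^44^2$; 5A: $1^25^2$; 6A: $6^2$; 6B: $1\cdot2\cdot3\cdot6$; 8A: $4\cdot8$; 8B: $1^2\,2\cdot8$; 10A: $2\cdot10$; 11A and 11B: $1\cdot11$. (3) The cycle shape of a conjugacy class of $M_{12}$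 is balanced if and only if the class is neither 4B nor 8B. Every class with a balanced cycle shape $\rho$ gives a multiplicative eta-product $g_\rho$, and $2\rho\in\mathcal D$. The eta-products of 4B and 8B are not multiplicative. (4) The partitions of $12$ that give a multiplicative eta-product but are not the cycle shape of any conjugacy class of $M_{12}$ are exactly $4^3$, $3\cdot9$ and $12$. -/

import Mathlib

/-- The Mathieu group `M₁₂` in its natural action on twelve points, given by the standard
generators: the first two generate `M₁₁` (fixing the point `11`). -/
def Mathieu12 : Subgroup (Equiv.Perm (Fin 12)) :=
  Subgroup.closure
    {c[0, 1, 2, 3, 4, 5, 6, 7, 8, 9, 10],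
     c[2, 6, 10, 7] * c[3, 9, 4, 5],
     c[0, 11] * c[1, 10] * c[2, 5] * c[3, 7] * c[4, 8] * c[6, 9]}

/-- The cycle shape of a conjugacy class of `M₁₂`: the multiset of the lengths of the cycles of
any of its elements on the twelve points, where every fixed point counts as a cycle of length 1. -/
def classCycleShape : ConjClasses Mathieu12 → Multiset ℕ :=
  Quotient.lift (fun g : Mathieu12 => (g : Equiv.Perm (Fin 12)).partition.parts) (by
    intro g h hgh
    have hc : IsConj (g : Equiv.Perm (Fin 12)) (h : Equiv.Perm (Fin 12)) :=
      (Mathieu12.subtype).map_isConj hgh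
    exact congrArg Nat.Partition.parts (Equiv.Perm.partition_eq_of_isConj.mp hc))

/-- The cycle shape `j₁^{a₁} j₂^{a₂} ⋯`, written as the list of the pairs `(j, a)`. -/
def shape (l : List (ℕ × ℕ)) : Multiset ℕ :=
  (l.map fun p => Multiset.replicate p.2 p.1).sum

/-- A cycle shape is balanced if for some positive integer `M` replacing every cycle length `j`
by `M / j` gives back the same shape. The quotients are rational numbers. -/
def IsBalanced (s : Multiset ℕ) : Prop :=
  ∃ M : ℕ, 0 < M ∧ s.map (fun j => (M : ℚ) / (j : ℚ)) = s.map (fun j => (j : ℚ))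

/-- The eta-product `τ ↦ ∏ⱼ η(jτ)^{aⱼ}` of the cycle shape `∏ⱼ j^{aⱼ}`. -/
noncomputable def etaProduct (s : Multiset ℕ) (τ : ℂ) : ℂ :=
  (s.map fun j => ModularForm.eta ((j : ℂ) * τ)).prod

/-- `f(τ) = ∑_{n ≥ 1} a_n q^{n/h}` on the upper half-plane, where `q = exp (2πiτ)`;
an `ArithmeticFunction` is a sequence `a` with `a 0 = 0`. -/
def HasFourierExpansion (h : ℕ) (f : ℂ → ℂ) (a : ArithmeticFunction ℂ) : Prop :=
  ∀ τ : ℂ, 0 < τ.im →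
    HasSum (fun n : ℕ => a n * Complex.exp (2 * Real.pi * Complex.I * τ * ((n : ℂ) / (h : ℂ))))
      (f τ)

/-- The eta-product of the cycle shape `s` is multiplicative: it has an expansion
`∑_{n ≥ 1} a_n q^{n/h}` with `a_{mn} = a_m a_n` for all coprime `m` and `n`. For partitions of
`12` one takes `h = 2`, for partitions of `24` one takes `h = 1`. -/
def IsMultiplicativeEtaProduct (h : ℕ) (s : Multiset ℕ) : Prop :=
  ∃ a : ArithmeticFunction ℂ, HasFourierExpansion h (etaProduct s) a ∧
    ∀ m n : ℕ, m.Coprime n → a (m * n) = a m * a n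

/-- The labels of the fifteen conjugacy classes of `M₁₂`. -/
inductive M12Label
  | c1A | c2A | c2B | c3A | c3B | c4A | c4B | c5A | c6A | c6B | c8A | c8B | c10A | c11A | c11B

/-- The cycle shape belonging to a label. -/
def M12Label.cycleShape : M12Label → Multiset ℕ
  | c1A => shape [(1, 12)]
  | c2A => shape [(2, 6)]
  | c2B => shape [(1, 4), (2, 4)]
  | c3A => shape [(1, 3), (3, 3)]
  | c3B => shape [(3, 4)]
  | c4A => shape [(2, 2), (4, 2)]
  | c4B => shape [(1, 4), (4, 2)]
  | c5A => shape [(1, 2), (5, 2)]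
  | c6A => shape [(6, 2)]
  | c6B => shape [(1, 1), (2, 1), (3, 1), (6, 1)]
  | c8A => shape [(4, 1), (8, 1)]
  | c8B => shape [(1, 2), (2, 1), (8, 1)]
  | c10A => shape [(2, 1), (10, 1)]
  | c11A => shape [(1, 1), (11, 1)]
  | c11B => shape [(1, 1), (11, 1)]

/-- The list of Dummit, Kisilevsky and McKay: the cycle shapes (partitions of `24`) of the thirty
multiplicative eta-products. -/
def dkmShapes : Finset (Multiset ℕ) :=
  {shape [(1, 24)], shape [(2, 12)], shape [(3, 8)], shape [(4, 6)], shape [(6, 4)],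
   shape [(8, 3)], shape [(12, 2)], shape [(24, 1)],
   shape [(1, 8), (2, 8)], shape [(1, 6), (3, 6)], shape [(1, 4), (5, 4)],
   shape [(1, 3), (7, 3)], shape [(1, 2), (11, 2)], shape [(1, 1), (23, 1)],
   shape [(2, 4), (4, 4)], shape [(2, 3), (6, 3)], shape [(2, 2), (10, 2)],
   shape [(2, 1), (22, 1)], shape [(3, 2), (9, 2)], shape [(3, 1), (21, 1)],
   shape [(4, 2), (8, 2)], shape [(4, 1), (20, 1)], shape [(6, 1), (18, 1)],
   shape [(8, 1), (16, 1)],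
   shape [(1, 4), (2, 2), (4, 4)], shape [(1, 2), (2, 1), (4, 1), (8, 2)],
   shape [(1, 2), (2, 2), (3, 2), (6, 2)], shape [(1, 1), (2, 1), (7, 1), (14, 1)],
   shape [(1, 1), (3, 1), (5, 1), (15, 1)], shape [(2, 1), (4, 1), (6, 1), (12, 1)]}

/-! Fifteen partitions of 12 are proved multiplicative, the other 62 are refuted by coefficients,
and the class equation shows that fifteen explicit elements represent all classes of `M₁₂`.

Thirteen of the fifteen shapes are `r` copies of `d` times the divisors of a squarefree `N`, with
`r` times the number of divisors even. With `D = 2 * d` one has `D * r * σ(N) = 24`, and the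
coefficients are those of `G = etaDivisors N r` in powers of `q^(1/D)`. Here Hecke theory needs no
dimension formula. For a prime `p` prime to `N * D`, a combination of `G(pτ)` and `∑ G((τ + D b) /
p)`, divided by `G`, is a sum over `p`-division points of products of Siegel functions
(`exists_siegelSum_mul_etaDivisors`). The modular group and the Atkin–Lehner operators permute the
division points and multiply all terms by a common twelfth root of unity, so the twelfth power of
the sum is invariant. For squarefree `N` the extended group has a single cusp
(`exists_siegelSum_eq`), where the sum has a finite limit, so by the maximum principle it is
constant. This is the recursion of `hecke_eigenform`. Primes dividing `D` are harmless because only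
exponents congruent to 1 modulo `D` occur, and one further prime may be ignored
(`apply_mul_of_primes`).

The shapes `12` and `4³` are treated by the theta series of Euler and Jacobi for eta and its cube.
Both follow from the triple product and are supported on squares, with completely multiplicative
values. Every other partition violates one of six instances of multiplicativity
(`partitionLists_multiplicative`).

In `M₁₂` the hexads of a Steiner system are preserved, so an element fixing five suitable points is
trivial, and a search over images of base points bounds the centralizers of fifteen pairwise
non-conjugate elements. The reciprocals of these bounds add up to 1, which leaves no room for
another class (`surjective_conjClasses_mk`). Upper bounds suffice: the order of `M₁₂` need not be
known beforehand. -/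

section Preliminaries

open Complex Filter Topology

/-! ### Gaussian binomials and the Jacobi triple product -/

/-- The finite product `(1 - q)(1 - q²)⋯(1 - qⁿ)`. -/
noncomputable def qFactorial (q : ℂ) (n : ℕ) : ℂ := ∏ i ∈ Finset.range n, (1 - q ^ (i + 1))

/-- The Gaussian binomial coefficient. -/
noncomputable def gaussBinom (q : ℂ) (n k : ℕ) : ℂ :=
  if k ≤ n then qFactorial q n / (qFactorial q k * qFactorial q (n - k)) else 0

lemma one_sub_pow_ne_zero {q : ℂ} (hq : ‖q‖ < 1) (i : ℕ) : 1 - q ^ (i + 1) ≠ 0 := by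
  intro h
  have h1 : ‖q ^ (i + 1)‖ = 1 := by rw [← sub_eq_zero.mp h]; simp
  rw [norm_pow] at h1
  exact absurd h1 (pow_lt_one₀ (norm_nonneg q) hq (Nat.succ_ne_zero i)).ne

lemma qFactorial_ne_zero {q : ℂ} (hq : ‖q‖ < 1) (n : ℕ) : qFactorial q n ≠ 0 :=
  Finset.prod_ne_zero_iff.mpr fun i _ => one_sub_pow_ne_zero hq i

lemma qFactorial_succ (q : ℂ) (n : ℕ) :
    qFactorial q (n + 1) = qFactorial q n * (1 - q ^ (n + 1)) := Finset.prod_range_succ _ _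

lemma gaussBinom_zero {q : ℂ} (hq : ‖q‖ < 1) (n : ℕ) : gaussBinom q n 0 = 1 := by
  have h0 : qFactorial q 0 = 1 := by simp [qFactorial]
  simp [gaussBinom, h0, div_self (qFactorial_ne_zero hq n)]

lemma gaussBinom_succ {q : ℂ} (hq : ‖q‖ < 1) (n k : ℕ) (hk : k ≤ n) :
    gaussBinom q (n + 1) (k + 1) = gaussBinom q n (k + 1) + q ^ (n - k) * gaussBinom q n k := by
  obtain ⟨d, rfl⟩ := Nat.exists_eq_add_of_le hk
  unfold gaussBinom
  have h0 := qFactorial_ne_zero hq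
  rcases d with _ | d
  · have h00 : qFactorial q 0 = 1 := by simp [qFactorial]
    simp [h00, div_self (h0 _)]
  · rw [if_pos (by omega), if_pos (by omega), if_pos (by omega)]
    rw [show k + (d + 1) + 1 - (k + 1) = d + 1 by omega, show k + (d + 1) - (k + 1) = d by omega,
      show k + (d + 1) - k = d + 1 by omega]
    rw [qFactorial_succ q (k + (d + 1)), qFactorial_succ q k, qFactorial_succ q d]
    have h1 := h0 k
    have h2 := h0 d
    have h3 := one_sub_pow_ne_zero hq k
    have h4 := one_sub_pow_ne_zero hq d
    field_simp
    ring

/-- The `q`-binomial theorem, by induction with the Pascal rule `gaussBinom_succ`. -/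
lemma prod_one_add_mul_pow {q : ℂ} (hq : ‖q‖ < 1) (t : ℂ) (n : ℕ) :
    ∏ i ∈ Finset.range n, (1 + t * q ^ i) =
      ∑ k ∈ Finset.range (n + 1), q ^ (k.choose 2) * t ^ k * gaussBinom q n k := by
  induction n with
  | zero => simp [gaussBinom_zero hq]
  | succ n ih =>
    rw [Finset.prod_range_succ, ih, Finset.sum_range_succ' _ (n + 1), mul_add, mul_one,
      Finset.sum_range_succ' _ n]
    have key : ∀ k ∈ Finset.range (n + 1),
        q ^ ((k + 1).choose 2) * t ^ (k + 1) * gaussBinom q (n + 1) (k + 1) =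
        q ^ ((k + 1).choose 2) * t ^ (k + 1) * gaussBinom q n (k + 1) +
        q ^ (k.choose 2) * t ^ k * gaussBinom q n k * (t * q ^ n) := by
      intro k hk
      have hk' : k ≤ n := by simpa [Nat.lt_succ_iff] using hk
      rw [gaussBinom_succ hq n k hk', Nat.choose_succ_succ' k 1, Nat.choose_one_right]
      have : q ^ n = q ^ (n - k) * q ^ k := by rw [← pow_add, Nat.sub_add_cancel hk']
      rw [this, pow_add]
      ring
    rw [Finset.sum_congr rfl key, Finset.sum_add_distrib, ← Finset.sum_mul,
      Finset.sum_range_succ (fun k => q ^ ((k + 1).choose 2) * t ^ (k + 1) * gaussBinom q n (k + 1)) n]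
    rw [Finset.sum_range_succ' (fun k => q ^ (k.choose 2) * t ^ k * gaussBinom q n k) n]
    have hz : gaussBinom q n (n + 1) = 0 := by simp [gaussBinom]
    rw [gaussBinom_zero hq, gaussBinom_zero hq, hz]
    ring

lemma tendsto_qFactorial {q : ℂ} (hq : ‖q‖ < 1) :
    Tendsto (qFactorial q) atTop (𝓝 (∏' n : ℕ, (1 - q ^ (n + 1)))) :=
  (ModularForm.multipliable_one_sub_pow hq).hasProd.tendsto_prod_nat

lemma tprod_one_sub_pow_ne_zero {q : ℂ} (hq : ‖q‖ < 1) : ∏' n : ℕ, (1 - q ^ (n + 1)) ≠ 0 := by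
  simp_rw [sub_eq_add_neg]
  refine tprod_one_add_ne_zero_of_summable (fun i => ?_) ?_
  · simpa [sub_eq_add_neg] using one_sub_pow_ne_zero hq i
  · simpa using (summable_nat_add_iff 1).mpr (summable_geometric_of_lt_one (norm_nonneg _) hq)

/-- The `q`-factorials converge to a nonzero limit, so they and their inverses are bounded. The
uniform bound dominates the series in the passage to the triple product. -/
lemma exists_bound_gaussBinom {q : ℂ} (hq : ‖q‖ < 1) :
    ∃ C, ∀ n k, ‖gaussBinom q n k‖ ≤ C := by
  have h1 := tendsto_qFactorial hq
  have h2 := h1.inv₀ (tprod_one_sub_pow_ne_zero hq)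
  obtain ⟨A, hA⟩ := (Metric.isBounded_range_of_tendsto _ h1).exists_norm_le
  obtain ⟨B, hB⟩ := (Metric.isBounded_range_of_tendsto _ h2).exists_norm_le
  have hA' : ∀ n, ‖qFactorial q n‖ ≤ A := fun n => hA _ ⟨n, rfl⟩
  have hB' : ∀ n, ‖(qFactorial q n)⁻¹‖ ≤ B := fun n => hB _ ⟨n, rfl⟩
  have hA0 : 0 ≤ A := (norm_nonneg _).trans (hA' 0)
  have hB0 : 0 ≤ B := (norm_nonneg _).trans (hB' 0)
  refine ⟨A * (B * B), fun n k => ?_⟩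
  unfold gaussBinom
  split_ifs
  · rw [div_eq_mul_inv, mul_inv, norm_mul, norm_mul]
    exact mul_le_mul (hA' n) (mul_le_mul (hB' _) (hB' _) (norm_nonneg _) hB0) (by positivity) hA0
  · simp; positivity

lemma summable_mul_pow_succ {q : ℂ} (hq : ‖q‖ < 1) (w : ℂ) :
    Summable fun n : ℕ => ‖-(w * q ^ (n + 1))‖ := by
  simpa using ((summable_nat_add_iff 1).mpr
    (summable_geometric_of_lt_one (norm_nonneg _) hq)).mul_left ‖w‖

lemma multipliable_one_sub_mul_pow {q : ℂ} (hq : ‖q‖ < 1) (w : ℂ) :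
    Multipliable fun n : ℕ => 1 - w * q ^ (n + 1) := by
  simpa [sub_eq_add_neg] using multipliable_one_add_of_summable (summable_mul_pow_succ hq w)

lemma tendsto_prod_one_sub_mul_pow {q : ℂ} (hq : ‖q‖ < 1) (w : ℂ) :
    Tendsto (fun n => ∏ i ∈ Finset.range n, (1 - w * q ^ (i + 1))) atTop
      (𝓝 (∏' n : ℕ, (1 - w * q ^ (n + 1)))) :=
  (multipliable_one_sub_mul_pow hq w).hasProd.tendsto_prod_nat

lemma norm_cexp_two_pi_lt_one {τ : ℂ} (hτ : 0 < τ.im) : ‖cexp (2 * Real.pi * I * τ)‖ < 1 := by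
  rw [Complex.norm_exp, Real.exp_lt_one_iff]
  simp
  positivity

/-- This is the `q`-binomial theorem with `2n + 1` factors at `t = -u q^(-n)`, `u = exp(-2πiz)`. The
first `n` factors contain negative powers of `q`; pulling out `-u q^(-i)` turns them into the
product in `u⁻¹`. The index `k` of the theorem becomes the frequency `n - k`. -/
lemma finite_triple_product (z : ℂ) {τ : ℂ} (hτ : 0 < τ.im) (n : ℕ) :
    (∏ i ∈ Finset.range (n + 1), (1 - cexp (-(2 * Real.pi * I * z)) *
        cexp (2 * Real.pi * I * τ) ^ i)) *
      ∏ i ∈ Finset.range n, (1 - cexp (2 * Real.pi * I * z) *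
        cexp (2 * Real.pi * I * τ) ^ (i + 1)) =
    ∑ k ∈ Finset.range (2 * n + 2),
      jacobiTheta₂_term (n - k) (z + 1 / 2 + τ / 2) τ *
        gaussBinom (cexp (2 * Real.pi * I * τ)) (2 * n + 1) k := by
  have hq := norm_cexp_two_pi_lt_one hτ
  set q := cexp (2 * Real.pi * I * τ) with hqd
  set u := cexp (-(2 * Real.pi * I * z)) with hu
  have hq0 : q ≠ 0 := exp_ne_zero _
  have hu0 : u ≠ 0 := exp_ne_zero _
  have hw : cexp (2 * Real.pi * I * z) = u⁻¹ := by rw [hu, ← Complex.exp_neg, neg_neg]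
  rw [hw]
  have h1 := prod_one_add_mul_pow hq (-u * (q ^ n)⁻¹) (2 * n + 1)
  rw [show 2 * n + 1 = n + (n + 1) by ring, Finset.prod_range_add,
    ← Finset.prod_range_reflect _ n] at h1
  have h2 : ∏ i ∈ Finset.range n, (1 + -u * (q ^ n)⁻¹ * q ^ (n - 1 - i)) =
      ((-u) ^ n * (q ^ ((n + 1).choose 2))⁻¹) *
        ∏ i ∈ Finset.range n, (1 - u⁻¹ * q ^ (i + 1)) := by
    have h3 : ∀ i ∈ Finset.range n, 1 + -u * (q ^ n)⁻¹ * q ^ (n - 1 - i) =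
        (-u * (q ^ (i + 1))⁻¹) * (1 - u⁻¹ * q ^ (i + 1)) := by
      intro i hi
      have hi' := Finset.mem_range.mp hi
      have : q ^ n = q ^ (n - 1 - i) * q ^ (i + 1) := by rw [← pow_add]; congr 1; omega
      rw [this]
      field_simp
      ring
    rw [Finset.prod_congr rfl h3, Finset.prod_mul_distrib, Finset.prod_mul_distrib,
      Finset.prod_inv_distrib, Finset.prod_pow_eq_pow_sum, Finset.prod_const, Finset.card_range]
    congr 4
    clear h3
    clear h1
    induction n with
    | zero => rfl
    | succ n ih =>
      rw [Finset.sum_range_succ, ih, Nat.choose_succ_succ' (n + 1) 1]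
      simp [add_comm]
  have h4 : ∀ i ∈ Finset.range (n + 1), 1 + -u * (q ^ n)⁻¹ * q ^ (n + i) = 1 - u * q ^ i := by
    intro i _
    rw [pow_add]
    field_simp
    ring
  rw [h2, Finset.prod_congr rfl h4] at h1
  have hc : ((-u) ^ n * (q ^ ((n + 1).choose 2))⁻¹) ≠ 0 := by
    have : -u ≠ 0 := neg_ne_zero.mpr hu0
    positivity
  rw [mul_comm (∏ i ∈ Finset.range (n + 1), _)]
  apply mul_left_cancel₀ hc
  rw [← mul_assoc, h1, Finset.mul_sum, show n + (n + 1) + 1 = 2 * n + 2 by ring,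
    show n + (n + 1) = 2 * n + 1 by ring]
  refine Finset.sum_congr rfl fun k _ => ?_
  rw [← mul_assoc]
  congr 1
  have hmu : -u = cexp (-(2 * Real.pi * I * z) - Real.pi * I) := by
    rw [Complex.exp_sub, Complex.exp_pi_mul_I, ← hu]; ring
  rw [hmu, hqd, mul_pow, inv_pow, ← pow_mul]
  simp only [← Complex.exp_nat_mul, ← Complex.exp_neg, ← Complex.exp_add, jacobiTheta₂_term]
  congr 1
  push_cast [Nat.cast_choose_two]
  ring

/-- Padding with zeros to a sum over `ℤ` makes the index set independent of `n`, as dominated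
convergence requires. -/
lemma finite_triple_product_tsum (z : ℂ) {τ : ℂ} (hτ : 0 < τ.im) (n : ℕ) :
    (∏ i ∈ Finset.range (n + 1), (1 - cexp (-(2 * Real.pi * I * z)) *
        cexp (2 * Real.pi * I * τ) ^ i)) *
      ∏ i ∈ Finset.range n, (1 - cexp (2 * Real.pi * I * z) *
        cexp (2 * Real.pi * I * τ) ^ (i + 1)) =
    ∑' m : ℤ, jacobiTheta₂_term m (z + 1 / 2 + τ / 2) τ *
      if m ≤ n then gaussBinom (cexp (2 * Real.pi * I * τ)) (2 * n + 1) (n - m).toNat else 0 := by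
  rw [finite_triple_product z hτ n, tsum_eq_sum (s := Finset.Icc (-(n + 1 : ℤ)) n)]
  · refine Finset.sum_nbij' (fun k => (n : ℤ) - k) (fun m => (n - m).toNat) ?_ ?_ ?_ ?_ ?_
    · intro k hk
      simp only [Finset.mem_range, Finset.mem_Icc] at *
      omega
    · intro k hk
      simp only [Finset.mem_range, Finset.mem_Icc] at *
      omega
    · intro k hk
      simp
    · intro k hk
      simp only [Finset.mem_Icc] at hk
      omega
    · intro k hk
      simp
  · intro m hm
    rw [Finset.mem_Icc] at hm
    by_cases h : m ≤ n
    · rw [if_pos h, gaussBinom, if_neg (by omega), mul_zero]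
    · rw [if_neg h, mul_zero]

/-- All three `q`-factorials tend to the same infinite product, and one of the two in the
denominator cancels against the numerator. -/
lemma tendsto_gaussBinom {q : ℂ} (hq : ‖q‖ < 1) (m : ℤ) :
    Tendsto (fun n : ℕ => if m ≤ n then gaussBinom q (2 * n + 1) (n - m).toNat else 0) atTop
      (𝓝 (∏' n : ℕ, (1 - q ^ (n + 1)))⁻¹) := by
  have hQ := tendsto_qFactorial hq
  have h0 := tprod_one_sub_pow_ne_zero hq
  have t1 : Tendsto (fun n : ℕ => 2 * n + 1) atTop atTop :=
    tendsto_atTop_mono (fun n => by omega : ∀ n : ℕ, n ≤ 2 * n + 1) tendsto_id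
  have t2 : Tendsto (fun n : ℕ => ((n : ℤ) - m).toNat) atTop atTop :=
    tendsto_atTop_atTop.mpr fun b => ⟨(b + m).toNat, fun a ha => by omega⟩
  have t3 : Tendsto (fun n : ℕ => 2 * n + 1 - ((n : ℤ) - m).toNat) atTop atTop :=
    tendsto_atTop_atTop.mpr fun b => ⟨(b - m).toNat + m.toNat, fun a ha => by omega⟩
  have := (hQ.comp t1).div ((hQ.comp t2).mul (hQ.comp t3)) (mul_ne_zero h0 h0)
  rw [div_mul_cancel_left₀ h0] at this
  refine this.congr' ?_
  filter_upwards [eventually_ge_atTop (m.natAbs + 1)] with n hn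
  simp only [Function.comp_def, Pi.div_apply]
  rw [if_pos (by omega), gaussBinom, if_pos (by omega)]

/-- The Jacobi triple product. -/
theorem jacobi_triple_product (z : ℂ) {τ : ℂ} (hτ : 0 < τ.im) :
    jacobiTheta₂ (z + 1 / 2 + τ / 2) τ =
      (∏' n : ℕ, (1 - cexp (2 * Real.pi * I * τ) ^ (n + 1))) *
      ((1 - cexp (-(2 * Real.pi * I * z))) *
      (∏' n : ℕ, (1 - cexp (-(2 * Real.pi * I * z)) * cexp (2 * Real.pi * I * τ) ^ (n + 1))) *
      ∏' n : ℕ, (1 - cexp (2 * Real.pi * I * z) * cexp (2 * Real.pi * I * τ) ^ (n + 1))) := by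
  have hq := norm_cexp_two_pi_lt_one hτ
  have hs := (summable_jacobiTheta₂_term_iff (z + 1 / 2 + τ / 2) τ).mpr hτ
  obtain ⟨C, hC⟩ := exists_bound_gaussBinom hq
  have hC0 : 0 ≤ C := (norm_nonneg _).trans (hC 0 0)
  have h1 := tendsto_tsum_of_dominated_convergence (𝓕 := atTop)
    (f := fun (n : ℕ) (m : ℤ) => jacobiTheta₂_term m (z + 1 / 2 + τ / 2) τ *
      if m ≤ n then gaussBinom (cexp (2 * Real.pi * I * τ)) (2 * n + 1) (n - m).toNat else 0)
    (hs.norm.mul_right C) (fun m => (tendsto_gaussBinom hq m).const_mul _)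
    (Eventually.of_forall fun n m => by
      rw [norm_mul]
      refine mul_le_mul_of_nonneg_left ?_ (norm_nonneg _)
      split_ifs
      · exact hC _ _
      · simpa using hC0)
  simp_rw [← finite_triple_product_tsum z hτ] at h1
  rw [tsum_mul_right] at h1
  have h2 := ((tendsto_prod_one_sub_mul_pow hq (cexp (-(2 * Real.pi * I * z)))).const_mul
    (1 - cexp (-(2 * Real.pi * I * z)))).mul
    (tendsto_prod_one_sub_mul_pow hq (cexp (2 * Real.pi * I * z)))
  have h3 := tendsto_nhds_unique h1 (h2.congr fun n => by
    rw [Finset.prod_range_succ' _ n]; simp; left; ring)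
  rw [← h3, jacobiTheta₂]
  have := tprod_one_sub_pow_ne_zero hq
  rw [mul_comm, mul_assoc, inv_mul_cancel₀ this, mul_one]

/-! ### Theta series of the eta function and of its cube -/

lemma jacobiTheta₂_term_half (m : ℤ) (τ : ℂ) :
    jacobiTheta₂_term m (1 / 2 + τ / 2) τ * cexp (2 * Real.pi * I * (τ / 8)) =
      (-1) ^ m * cexp (2 * Real.pi * I * (((2 * m + 1) ^ 2 : ℤ) * τ / 8)) := by
  rw [← Complex.exp_pi_mul_I, ← Complex.exp_int_mul, jacobiTheta₂_term, ← Complex.exp_add,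
    ← Complex.exp_add]
  congr 1
  push_cast
  ring

lemma eta_eq_cexp_mul (τ : ℂ) : ModularForm.eta τ = cexp (2 * Real.pi * I * (τ / 24)) *
    ∏' n : ℕ, (1 - cexp (2 * Real.pi * I * τ) ^ (n + 1)) := by
  rw [ModularForm.eta]
  congr 1
  · simp [Function.Periodic.qParam]
    ring_nf
  · simp [ModularForm.eta_q_eq_pow]

/-- Continuity is all that is needed of the infinite factors of the triple product at `z = 0`: they
are never differentiated. -/
lemma tendsto_tprod_one_sub_mul_pow {q : ℂ} (hq : ‖q‖ < 1) {α : Type*} {F : Filter α}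
    {w : α → ℂ} {w₀ : ℂ} (hw : Tendsto w F (𝓝 w₀)) :
    Tendsto (fun x => ∏' n : ℕ, (1 - w x * q ^ (n + 1))) F
      (𝓝 (∏' n : ℕ, (1 - w₀ * q ^ (n + 1)))) := by
  have hb : ∀ᶠ x in F, ‖w x‖ ≤ ‖w₀‖ + 1 :=
    (hw.norm.eventually_le_const (by linarith : ‖w₀‖ < ‖w₀‖ + 1))
  have := tendsto_tprod_one_add_of_dominated_convergence (𝓕 := F)
    (f := fun x (n : ℕ) => -(w x * q ^ (n + 1))) (g := fun n => -(w₀ * q ^ (n + 1)))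
    (bound := fun n => (‖w₀‖ + 1) * ‖q‖ ^ (n + 1))
    (((summable_nat_add_iff 1).mpr (summable_geometric_of_lt_one (norm_nonneg _) hq)).mul_left _)
    (fun n => (hw.mul_const _).neg)
    (hb.mono fun x hx n => by
      rw [norm_neg, norm_mul, norm_pow]
      gcongr)
  simpa [sub_eq_add_neg] using this

/-- Jacobi's identity for the cube of the eta function. -/
theorem hasSum_eta_cube {τ : ℂ} (hτ : 0 < τ.im) :
    HasSum (fun m : ℤ => (m : ℂ) * (-1) ^ m *
      cexp (2 * Real.pi * I * (((2 * m + 1) ^ 2 : ℤ) * τ / 8))) (ModularForm.eta τ ^ 3) := by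
  have hq := norm_cexp_two_pi_lt_one hτ
  set Q := ∏' n : ℕ, (1 - cexp (2 * Real.pi * I * τ) ^ (n + 1)) with hQ
  -- The triple product vanishes at `z = 0` only through the factor `1 - exp(-2πiz)`, whose slope is
  -- `2πi`. The other three products have the value `Q` there.
  have hd : jacobiTheta₂' (1 / 2 + τ / 2) τ = 2 * Real.pi * I * Q ^ 3 := by
    have h1 := (hasDerivAt_jacobiTheta₂_fst (1 / 2 + τ / 2) hτ)
    have h2 : HasDerivAt (fun z : ℂ => jacobiTheta₂ (z + 1 / 2 + τ / 2) τ)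
        (jacobiTheta₂' (1 / 2 + τ / 2) τ) 0 := by
      have : HasDerivAt (fun z : ℂ => z + (1 / 2 + τ / 2)) 1 0 := (hasDerivAt_id _).add_const _
      rw [show (1 / 2 + τ / 2 : ℂ) = 0 + (1 / 2 + τ / 2) by ring] at h1
      have h3 := HasDerivAt.comp (0 : ℂ) h1 this
      simpa [Function.comp_def, add_assoc] using h3
    have h4 : HasDerivAt (fun z : ℂ => 1 - cexp (-(2 * Real.pi * I * z)))
        (2 * Real.pi * I) 0 := by
      have : HasDerivAt (fun z : ℂ => -(2 * Real.pi * I * z)) (-(2 * Real.pi * I)) 0 := by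
        simpa using (hasDerivAt_id (0 : ℂ)).const_mul (-(2 * Real.pi * I) : ℂ)
      simpa using (this.cexp).const_sub 1
    have hp : Tendsto (fun z : ℂ =>
        (∏' n : ℕ, (1 - cexp (-(2 * Real.pi * I * z)) * cexp (2 * Real.pi * I * τ) ^ (n + 1))) *
        ∏' n : ℕ, (1 - cexp (2 * Real.pi * I * z) * cexp (2 * Real.pi * I * τ) ^ (n + 1)))
        (𝓝[≠] 0) (𝓝 (Q * Q)) := by
      have e1 : Tendsto (fun z : ℂ => cexp (-(2 * Real.pi * I * z))) (𝓝[≠] 0) (𝓝 1) := by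
        have : Continuous (fun z : ℂ => cexp (-(2 * Real.pi * I * z))) := by fun_prop
        simpa using (this.tendsto 0).mono_left nhdsWithin_le_nhds
      have e2 : Tendsto (fun z : ℂ => cexp (2 * Real.pi * I * z)) (𝓝[≠] 0) (𝓝 1) := by
        have : Continuous (fun z : ℂ => cexp (2 * Real.pi * I * z)) := by fun_prop
        simpa using (this.tendsto 0).mono_left nhdsWithin_le_nhds
      have := (tendsto_tprod_one_sub_mul_pow hq e1).mul (tendsto_tprod_one_sub_mul_pow hq e2)
      simpa [hQ] using this
    have s1 := h2.tendsto_slope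
    have s2 := (h4.tendsto_slope).mul (hp.const_mul Q)
    have h0 : jacobiTheta₂ (0 + 1 / 2 + τ / 2) τ = 0 := by
      rw [jacobi_triple_product 0 hτ]; simp
    have := tendsto_nhds_unique s1 (s2.congr fun z => by
      rw [slope_def_field, slope_def_field, h0, jacobi_triple_product z hτ]
      simp
      ring)
    rw [this]; ring
  have h5 := (hasSum_jacobiTheta₂'_term (1 / 2 + τ / 2) hτ).mul_right
    (cexp (2 * Real.pi * I * (τ / 8)) / (2 * Real.pi * I))
  have h2pi : (2 * Real.pi * I : ℂ) ≠ 0 := by simp [Real.pi_ne_zero]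
  rw [hd] at h5
  have h6 : ModularForm.eta τ ^ 3 =
      2 * Real.pi * I * Q ^ 3 * (cexp (2 * Real.pi * I * (τ / 8)) / (2 * Real.pi * I)) := by
    have h8 : cexp (2 * Real.pi * I * (τ / 24)) ^ 3 = cexp (2 * Real.pi * I * (τ / 8)) := by
      rw [← Complex.exp_nat_mul]
      congr 1
      push_cast
      ring
    rw [eta_eq_cexp_mul, mul_pow, h8, ← hQ]
    field_simp
  rw [h6]
  refine Eq.mpr (congrArg (fun f => HasSum f _) (funext fun m => ?_)) h5
  rw [mul_assoc, ← jacobiTheta₂_term_half, jacobiTheta₂'_term]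
  field_simp

/-- Sorting exponents by their residue modulo 3 shows that Euler's product is the triple product for
`3τ` at `z = -τ`. -/
lemma finite_prod_mod_three (q : ℂ) (n : ℕ) :
    ∏ i ∈ Finset.range (3 * n + 1), (1 - q ^ (i + 1)) =
      (∏ i ∈ Finset.range n, (1 - (q ^ 3) ^ (i + 1))) * ((1 - q) *
      (∏ i ∈ Finset.range n, (1 - q * (q ^ 3) ^ (i + 1))) *
      ∏ i ∈ Finset.range n, (1 - q⁻¹ * (q ^ 3) ^ (i + 1))) := by
  induction n with
  | zero => simp
  | succ n ih =>
    rw [show 3 * (n + 1) + 1 = 3 * n + 1 + 1 + 1 + 1 by ring, Finset.prod_range_succ,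
      Finset.prod_range_succ, Finset.prod_range_succ, ih, Finset.prod_range_succ,
      Finset.prod_range_succ, Finset.prod_range_succ]
    have : q⁻¹ * (q ^ 3) ^ (n + 1) = q ^ (3 * n + 1 + 1) := by
      rcases eq_or_ne q 0 with rfl | h
      · simp
      · field_simp
        ring
    rw [this]
    ring

/-- Euler's pentagonal number theorem, as the theta series of the eta function. -/
theorem hasSum_eta {τ : ℂ} (hτ : 0 < τ.im) :
    HasSum (fun m : ℤ => (-1) ^ m *
      cexp (2 * Real.pi * I * (((6 * m + 1) ^ 2 : ℤ) * τ / 24))) (ModularForm.eta τ) := by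
  have hq := norm_cexp_two_pi_lt_one hτ
  have hτ3 : 0 < (3 * τ).im := by simpa using hτ
  have hq3 := norm_cexp_two_pi_lt_one hτ3
  have h1 := jacobi_triple_product (-τ) hτ3
  have e1 : cexp (2 * Real.pi * I * (3 * τ)) = cexp (2 * Real.pi * I * τ) ^ 3 := by
    rw [← Complex.exp_nat_mul]; congr 1; push_cast; ring
  have e2 : cexp (-(2 * Real.pi * I * -τ)) = cexp (2 * Real.pi * I * τ) := by congr 1; ring
  have e3 : cexp (2 * Real.pi * I * -τ) = (cexp (2 * Real.pi * I * τ))⁻¹ := by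
    rw [← Complex.exp_neg]; congr 1; ring
  rw [e1] at hq3
  rw [e1, e2, e3] at h1
  set q := cexp (2 * Real.pi * I * τ)
  have t1 := ((ModularForm.multipliable_one_sub_pow hq).hasProd.tendsto_prod_nat).comp
    (tendsto_atTop_mono (fun n => by omega : ∀ n : ℕ, n ≤ 3 * n + 1) tendsto_id)
  have t2 := (ModularForm.multipliable_one_sub_pow hq3).hasProd.tendsto_prod_nat.mul
    (((tendsto_prod_one_sub_mul_pow hq3 q).const_mul (1 - q)).mul
      (tendsto_prod_one_sub_mul_pow hq3 q⁻¹))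
  have t3 := tendsto_nhds_unique t1 (t2.congr fun n => (finite_prod_mod_three q n).symm)
  rw [eta_eq_cexp_mul, t3, ← h1]
  refine Eq.mpr (congrArg (fun f => HasSum f _) (funext fun m => ?_))
    ((hasSum_jacobiTheta₂_term _ hτ3).mul_left (cexp (2 * Real.pi * I * (τ / 24))))
  rw [← Complex.exp_pi_mul_I, ← Complex.exp_int_mul, jacobiTheta₂_term, ← Complex.exp_add,
    ← Complex.exp_add]
  congr 1
  push_cast
  ring

/-! ### Siegel functions under the modular group and under translations -/

/-- The Siegel function attached to the vector `(x, y)`, normalised up to a constant. -/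
noncomputable def siegel (x y τ : ℂ) : ℂ :=
  cexp (Real.pi * I * (x * (x * τ + y) + (x * τ + y) + τ / 4)) *
    jacobiTheta₂ (x * τ + y + 1 / 2 + τ / 2) τ / ModularForm.eta τ

lemma eta_add_one (τ : ℂ) :
    ModularForm.eta (τ + 1) = cexp (Real.pi * I / 12) * ModularForm.eta τ := by
  have : cexp (2 * Real.pi * I * (τ + 1)) = cexp (2 * Real.pi * I * τ) := by
    rw [mul_add, Complex.exp_add]; simp
  rw [eta_eq_cexp_mul, eta_eq_cexp_mul, this, ← mul_assoc, ← Complex.exp_add]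
  congr 2
  ring

/-- Since `n² + n` is even, every term of the series is unchanged. -/
lemma jacobiTheta₂_add_half_add_one (z τ : ℂ) :
    jacobiTheta₂ (z + 1 / 2) (τ + 1) = jacobiTheta₂ z τ := by
  refine tsum_congr fun n => ?_
  obtain ⟨k, hk⟩ := Int.even_mul_succ_self n
  have hk' : (n : ℂ) * (n + 1) = k + k := by exact_mod_cast hk
  rw [jacobiTheta₂_term, jacobiTheta₂_term, Complex.exp_eq_exp_iff_exists_int]
  exact ⟨k, by linear_combination (Real.pi * I) * hk'⟩

lemma siegel_add_one (x y τ : ℂ) :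
    siegel x y (τ + 1) = cexp (Real.pi * I / 6) * siegel x (x + y) τ := by
  rw [siegel, siegel, eta_add_one]
  rw [show x * (τ + 1) + y + 1 / 2 + (τ + 1) / 2 = (x * τ + (x + y) + 1 / 2 + τ / 2) + 1 / 2 by ring,
    jacobiTheta₂_add_half_add_one]
  have : cexp (Real.pi * I * (x * (x * (τ + 1) + y) + (x * (τ + 1) + y) + (τ + 1) / 4)) =
      cexp (Real.pi * I / 6) * cexp (Real.pi * I / 12) *
      cexp (Real.pi * I * (x * (x * τ + (x + y)) + (x * τ + (x + y)) + τ / 4)) := by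
    rw [← Complex.exp_add, ← Complex.exp_add]; congr 1; ring
  rw [this]
  have h0 := Complex.exp_ne_zero (Real.pi * I / 12)
  field_simp

lemma eta_neg_inv {τ : ℂ} (hτ : 0 < τ.im) :
    ModularForm.eta (-1 / τ) = (sqrt I)⁻¹ * (sqrt τ * ModularForm.eta τ) := by
  simpa using ModularForm.eta_comp_eq_csqrt_I_inv hτ

lemma complex_sqrt_sq (z : ℂ) : sqrt z ^ 2 = z := by
  rw [Complex.sqrt, ← Complex.cpow_nat_mul]; simp

/-- Theta transforms with `(-iτ)^(1/2)` and eta with `sqrt τ / sqrt I`. The arguments of `-iτ` and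
`i` add up to less than `π`, so the principal logarithms add and the two branches agree. -/
lemma sqrt_mul_sqrt_I {τ : ℂ} (hτ : 0 < τ.im) : (-I * τ) ^ (1 / 2 : ℂ) * sqrt I = sqrt τ := by
  have hτ0 : τ ≠ 0 := by rintro rfl; simp at hτ
  have h : -I * τ ≠ 0 := by simp [hτ0]
  have harg : |arg (-I * τ)| < Real.pi / 2 := by
    rw [Complex.abs_arg_lt_pi_div_two_iff]; left; simpa using hτ
  have := Complex.log_mul_eq_add_log_iff h I_ne_zero |>.mpr (by
    rw [Complex.arg_I, abs_lt] at *
    constructor <;> linarith [Real.pi_pos])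
  have e : -I * τ * I = τ := by linear_combination -τ * I_mul_I
  rw [e] at this
  rw [sqrt, sqrt, one_div, Complex.cpow_def_of_ne_zero h, Complex.cpow_def_of_ne_zero I_ne_zero,
    Complex.cpow_def_of_ne_zero hτ0, ← Complex.exp_add, this]
  ring_nf

/-- Theta and eta have the same weight, so the square roots of `τ` cancel in the quotient; the
exponential factor in the functional equation of theta is absorbed by the prefactor of the Siegel
function. -/
lemma siegel_neg_inv (x y : ℂ) {τ : ℂ} (hτ : 0 < τ.im) :
    siegel x y (-1 / τ) = -I * siegel y (-x) τ := by
  have hτ0 : τ ≠ 0 := by rintro rfl; simp at hτ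
  have hs : sqrt τ ≠ 0 := by
    intro h; have := complex_sqrt_sq τ; rw [h] at this; exact hτ0 (by simpa using this.symm)
  have hsI : sqrt I ≠ 0 := by
    intro h; have := complex_sqrt_sq I; rw [h] at this; exact I_ne_zero (by simpa using this.symm)
  have hsq := sqrt_mul_sqrt_I hτ
  have h1 := jacobiTheta₂_functional_equation (y * τ + -x + τ / 2 - 1 / 2) τ
  have h2 : jacobiTheta₂ (y * τ + -x + 1 / 2 + τ / 2) τ =
      jacobiTheta₂ (y * τ + -x + τ / 2 - 1 / 2) τ := by
    rw [← jacobiTheta₂_add_left (y * τ + -x + τ / 2 - 1 / 2)]; ring_nf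
  have hc : (-I * τ) ^ (1 / 2 : ℂ) ≠ 0 := by
    rw [Complex.cpow_ne_zero_iff]; left; simp [hτ0]
  have h3 : x * (-1 / τ) + y + 1 / 2 + -1 / τ / 2 = (y * τ + -x + τ / 2 - 1 / 2) / τ := by
    field_simp
    ring
  rw [siegel, siegel, h2, h1, h3, eta_neg_inv hτ]
  have h4 : cexp (Real.pi * I * (x * (x * (-1 / τ) + y) + (x * (-1 / τ) + y) + -1 / τ / 4)) =
      -I * (cexp (Real.pi * I * (y * (y * τ + -x) + (y * τ + -x) + τ / 4)) *
      cexp (-Real.pi * I * (y * τ + -x + τ / 2 - 1 / 2) ^ 2 / τ)) := by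
    rw [show -I = cexp (-(Real.pi / 2) * I) by
      rw [neg_mul, Complex.exp_neg, Complex.exp_pi_div_two_mul_I, Complex.inv_I],
      ← Complex.exp_add, ← Complex.exp_add]
    congr 1
    field_simp
    ring
  rw [h4, ← hsq]
  field_simp

open UpperHalfPlane in
/-- The Siegel functions are permuted by the modular group, up to roots of unity. -/
theorem siegel_smul (γ : Matrix.SpecialLinearGroup (Fin 2) ℤ) (τ : ℍ) :
    ∃ ε : ℂ, ε ^ 12 = 1 ∧ ∀ x y : ℂ, siegel x y ((γ • τ : ℍ) : ℂ) =
      ε * siegel (x * γ 0 0 + y * γ 1 0) (x * γ 0 1 + y * γ 1 1) τ := by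
  have hγ : γ ∈ Subgroup.closure {ModularGroup.S, ModularGroup.T} := by
    rw [SpecialLinearGroup.SL2Z_generators]; trivial
  induction hγ using Subgroup.closure_induction generalizing τ with
  | mem g hg =>
    rcases hg with rfl | rfl
    · refine ⟨-Complex.I, ?_, fun x y => ?_⟩
      · rw [Even.neg_pow (by decide), show 12 = 4 * 3 by norm_num, pow_mul, Complex.I_pow_four,
          one_pow]
      rw [UpperHalfPlane.modular_S_smul]
      have := siegel_neg_inv x y τ.2
      simp only [ModularGroup.S, neg_div, one_div] at *
      simpa [inv_neg] using this
    · refine ⟨cexp (Real.pi * Complex.I / 6), ?_, fun x y => ?_⟩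
      · rw [← Complex.exp_nat_mul]
        convert Complex.exp_two_pi_mul_I using 2
        push_cast; ring
      · rw [UpperHalfPlane.modular_T_smul]
        have := siegel_add_one x y τ
        simp only [ModularGroup.T] at *
        simpa [add_comm] using this
  | one => exact ⟨1, by simp, fun x y => by simp⟩
  | mul a b _ _ ha hb =>
    obtain ⟨ε₁, h1, h2⟩ := ha (b • τ)
    obtain ⟨ε₂, h3, h4⟩ := hb τ
    refine ⟨ε₁ * ε₂, by rw [mul_pow, h1, h3, one_mul], fun x y => ?_⟩
    rw [mul_smul, h2, h4, mul_assoc]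
    congr 2
    all_goals
      simp [Matrix.mul_apply, Fin.sum_univ_two]
      ring_nf
  | inv a _ ha =>
    obtain ⟨ε, h1, h2⟩ := ha (a⁻¹ • τ)
    have hε : ε ≠ 0 := by rintro rfl; simp at h1
    refine ⟨ε⁻¹, by rw [inv_pow, h1, inv_one], fun x y => ?_⟩
    have h3 := h2 (x * a⁻¹ 0 0 + y * a⁻¹ 1 0) (x * a⁻¹ 0 1 + y * a⁻¹ 1 1)
    rw [smul_inv_smul] at h3
    rw [h3, ← mul_assoc, inv_mul_cancel₀ hε, one_mul]
    have hd : (a 0 0 : ℂ) * a 1 1 - a 0 1 * a 1 0 = 1 := by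
      have := a.det_coe
      rw [Matrix.det_fin_two] at this
      exact_mod_cast this
    congr 1 <;> simp [Matrix.SpecialLinearGroup.SL2_inv_expl] 
    · linear_combination (-x) * hd
    · linear_combination (-y) * hd

lemma siegel_neg (x y τ : ℂ) : siegel (-x) (-y) τ = -siegel x y τ := by
  have h1 := jacobiTheta₂_add_left' (-(x * τ + y) - 1 / 2 - τ / 2) τ
  have h2 : jacobiTheta₂ (-x * τ + -y + 1 / 2 + τ / 2) τ =
      jacobiTheta₂ (-(x * τ + y) - 1 / 2 - τ / 2 + τ) τ := by
    rw [← jacobiTheta₂_add_left (-(x * τ + y) - 1 / 2 - τ / 2 + τ)]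
    ring_nf
  have h3 : jacobiTheta₂ (-(x * τ + y) - 1 / 2 - τ / 2) τ =
      jacobiTheta₂ (x * τ + y + 1 / 2 + τ / 2) τ := by
    rw [← jacobiTheta₂_neg_left]
    ring_nf
  have h4 : cexp (Real.pi * I * (-x * (-x * τ + -y) + (-x * τ + -y) + τ / 4)) *
      cexp (-Real.pi * I * (τ + 2 * (-(x * τ + y) - 1 / 2 - τ / 2))) =
      -cexp (Real.pi * I * (x * (x * τ + y) + (x * τ + y) + τ / 4)) := by
    rw [← Complex.exp_add, ← mul_neg_one (cexp _), ← Complex.exp_pi_mul_I, ← Complex.exp_add]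
    congr 1
    ring
  rw [siegel, siegel, h2, h1, h3, ← mul_assoc, h4]
  ring

lemma siegel_add_one_right (x y τ : ℂ) :
    siegel x (y + 1) τ = -cexp (Real.pi * I * x) * siegel x y τ := by
  have h2 : jacobiTheta₂ (x * τ + (y + 1) + 1 / 2 + τ / 2) τ =
      jacobiTheta₂ (x * τ + y + 1 / 2 + τ / 2) τ := by
    rw [← jacobiTheta₂_add_left (x * τ + y + 1 / 2 + τ / 2)]
    ring_nf
  have h4 : cexp (Real.pi * I * (x * (x * τ + (y + 1)) + (x * τ + (y + 1)) + τ / 4)) =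
      -cexp (Real.pi * I * x) *
      cexp (Real.pi * I * (x * (x * τ + y) + (x * τ + y) + τ / 4)) := by
    rw [← mul_neg_one, ← Complex.exp_pi_mul_I, ← Complex.exp_add, ← Complex.exp_add]
    congr 1
    ring
  rw [siegel, siegel, h2, h4]
  ring

lemma siegel_add_one_left (x y τ : ℂ) :
    siegel (x + 1) y τ = -cexp (-(Real.pi * I * y)) * siegel x y τ := by
  have h2 : jacobiTheta₂ ((x + 1) * τ + y + 1 / 2 + τ / 2) τ =
      cexp (-Real.pi * I * (τ + 2 * (x * τ + y + 1 / 2 + τ / 2))) *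
      jacobiTheta₂ (x * τ + y + 1 / 2 + τ / 2) τ := by
    rw [← jacobiTheta₂_add_left' (x * τ + y + 1 / 2 + τ / 2)]
    ring_nf
  have h4 : cexp (Real.pi * I * ((x + 1) * ((x + 1) * τ + y) + ((x + 1) * τ + y) + τ / 4)) *
      cexp (-Real.pi * I * (τ + 2 * (x * τ + y + 1 / 2 + τ / 2))) =
      -cexp (-(Real.pi * I * y)) *
      cexp (Real.pi * I * (x * (x * τ + y) + (x * τ + y) + τ / 4)) := by
    rw [← mul_neg_one (cexp _), ← Complex.exp_neg_pi_mul_I, ← Complex.exp_add, ← Complex.exp_add,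
      ← Complex.exp_add]
    congr 1
    ring
  rw [siegel, siegel, h2, ← mul_assoc, h4]
  ring

/-- Even translations avoid the sign in `siegel_add_one_right`. For this reason the division points
are written `2k(x, y)/p` below. -/
lemma siegel_add_two_right (x y τ : ℂ) (n : ℤ) :
    siegel x (y + 2 * n) τ = cexp (2 * Real.pi * I * (n * x)) * siegel x y τ := by
  have step : ∀ y, siegel x (y + 2) τ = cexp (2 * Real.pi * I * x) * siegel x y τ := by
    intro y
    rw [show y + 2 = y + 1 + 1 by ring, siegel_add_one_right, siegel_add_one_right, ← mul_assoc,
      neg_mul_neg, ← Complex.exp_add]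
    ring_nf
  have step' : ∀ y, siegel x (y - 2) τ = cexp (-(2 * Real.pi * I * x)) * siegel x y τ := by
    intro y
    have := step (y - 2)
    rw [sub_add_cancel] at this
    rw [this, ← mul_assoc, ← Complex.exp_add]
    simp
  induction n using Int.induction_on with
  | zero => simp
  | succ n ih =>
    rw [show y + 2 * ((n + 1 : ℤ) : ℂ) = y + 2 * (n : ℤ) + 2 by push_cast; ring, step, ih,
      ← mul_assoc, ← Complex.exp_add]
    push_cast
    ring_nf
  | pred n ih =>
    rw [show y + 2 * ((-(n : ℤ) - 1 : ℤ) : ℂ) = y + 2 * (-(n : ℤ) : ℤ) - 2 by push_cast; ring,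
      step', ih, ← mul_assoc, ← Complex.exp_add]
    push_cast
    ring_nf

lemma siegel_add_two_left (x y τ : ℂ) (m : ℤ) :
    siegel (x + 2 * m) y τ = cexp (-(2 * Real.pi * I * (m * y))) * siegel x y τ := by
  have step : ∀ x, siegel (x + 2) y τ = cexp (-(2 * Real.pi * I * y)) * siegel x y τ := by
    intro x
    rw [show x + 2 = x + 1 + 1 by ring, siegel_add_one_left, siegel_add_one_left, ← mul_assoc,
      neg_mul_neg, ← Complex.exp_add]
    ring_nf
  have step' : ∀ x, siegel (x - 2) y τ = cexp (2 * Real.pi * I * y) * siegel x y τ := by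
    intro x
    have := step (x - 2)
    rw [sub_add_cancel] at this
    rw [this, ← mul_assoc, ← Complex.exp_add]
    simp
  induction m using Int.induction_on with
  | zero => simp
  | succ n ih =>
    rw [show x + 2 * ((n + 1 : ℤ) : ℂ) = x + 2 * (n : ℤ) + 2 by push_cast; ring, step, ih,
      ← mul_assoc, ← Complex.exp_add]
    push_cast
    ring_nf
  | pred n ih =>
    rw [show x + 2 * ((-(n : ℤ) - 1 : ℤ) : ℂ) = x + 2 * (-(n : ℤ) : ℤ) - 2 by push_cast; ring,
      step', ih, ← mul_assoc, ← Complex.exp_add]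
    push_cast
    ring_nf

/-- Translation of the characteristic of a Siegel function by an even vector. -/
lemma siegel_add_two (x y τ : ℂ) (m n : ℤ) : siegel (x + 2 * m) (y + 2 * n) τ =
    cexp (2 * Real.pi * I * (n * x - m * y)) * siegel x y τ := by
  rw [siegel_add_two_left, siegel_add_two_right, ← mul_assoc, ← Complex.exp_add]
  congr 1
  rw [Complex.exp_eq_exp_iff_exists_int]
  exact ⟨-(2 * m * n), by push_cast; ring⟩

/-! ### Products of Siegel functions over division points -/

/-- Each nontrivial root of unity is paired with its inverse. One Siegel function supplies the
factors of one such pair, so half of the division points on a line suffice. -/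
lemma prod_one_sub_rootOfUnity (h : ℕ) {ζ : ℂ} (hζ : IsPrimitiveRoot ζ (2 * h + 1)) (x : ℂ) :
    (1 - x) * ∏ k ∈ Finset.range h, ((1 - (ζ ^ (k + 1))⁻¹ * x) * (1 - ζ ^ (k + 1) * x)) =
      1 - x ^ (2 * h + 1) := by
  have h1 := hζ.pow_sub_pow_eq_prod_sub_mul 1 x (by positivity)
  rw [one_pow] at h1
  have h2 : ∏ ξ ∈ Polynomial.nthRootsFinset (2 * h + 1) (1 : ℂ), (1 - ξ * x) =
      ∏ i ∈ Finset.range (2 * h + 1), (1 - ζ ^ i * x) := by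
    symm
    refine Finset.prod_bij (fun i _ => ζ ^ i) ?_ ?_ ?_ ?_
    · intro i _
      rw [Polynomial.mem_nthRootsFinset (by positivity), ← pow_mul, mul_comm, pow_mul,
        hζ.pow_eq_one, one_pow]
    · intro i hi j hj hij
      exact hζ.pow_inj (Finset.mem_range.mp hi) (Finset.mem_range.mp hj) hij
    · intro ξ hξ
      rw [Polynomial.mem_nthRootsFinset (by positivity)] at hξ
      obtain ⟨i, hi, rfl⟩ := hζ.eq_pow_of_pow_eq_one hξ
      exact ⟨i, Finset.mem_range.mpr hi, rfl⟩
    · intros; rfl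
  rw [h1, h2, Finset.prod_range_succ', Finset.prod_mul_distrib, two_mul, Finset.prod_range_add,
    ← Finset.prod_range_reflect (fun i => 1 - ζ ^ (h + i + 1) * x)]
  have h3 : ∀ k ∈ Finset.range h, 1 - (ζ ^ (k + 1))⁻¹ * x = 1 - ζ ^ (h + (h - 1 - k) + 1) * x := by
    intro k hk
    have hk' := Finset.mem_range.mp hk
    congr 2
    refine inv_eq_of_mul_eq_one_left ?_
    rw [← pow_add, ← hζ.pow_eq_one]
    congr 1
    omega
  rw [Finset.prod_congr rfl h3]
  ring

lemma siegel_zero_left (y : ℂ) {τ : ℂ} (hτ : 0 < τ.im) : siegel 0 y τ =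
    cexp (Real.pi * I * y) * (1 - (cexp (2 * Real.pi * I * y))⁻¹) * cexp (Real.pi * I * τ / 6) *
    ∏' n : ℕ, ((1 - (cexp (2 * Real.pi * I * y))⁻¹ * cexp (2 * Real.pi * I * τ) ^ (n + 1)) *
      (1 - cexp (2 * Real.pi * I * y) * cexp (2 * Real.pi * I * τ) ^ (n + 1))) := by
  have hq := norm_cexp_two_pi_lt_one hτ
  rw [siegel, zero_mul, zero_add, zero_mul, zero_add, jacobi_triple_product y hτ, eta_eq_cexp_mul, Complex.exp_neg,
    (multipliable_one_sub_mul_pow hq _).tprod_mul (multipliable_one_sub_mul_pow hq _)]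
  have h0 := tprod_one_sub_pow_ne_zero hq
  have h1 : cexp (Real.pi * I * (y + τ / 4)) = cexp (Real.pi * I * y) *
      cexp (Real.pi * I * τ / 6) * cexp (2 * Real.pi * I * (τ / 24)) := by
    rw [← Complex.exp_add, ← Complex.exp_add]; congr 1; ring
  rw [h1]
  have h2 := Complex.exp_ne_zero (2 * Real.pi * I * (τ / 24))
  rw [div_eq_iff (mul_ne_zero h2 h0)]
  ring

/-- The product of the Siegel functions over the `p`-division points of one line. -/
theorem prod_siegel_zero_left (h : ℕ) : ∃ c : ℂ, c ≠ 0 ∧ ∀ τ : ℂ, 0 < τ.im →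
    ∏ k ∈ Finset.range h, siegel 0 (2 * (k + 1) / (2 * h + 1 : ℕ)) τ =
      c * (ModularForm.eta ((2 * h + 1 : ℕ) * τ) / ModularForm.eta τ) := by
  set p := 2 * h + 1 with hp
  have hp0 : (p : ℂ) ≠ 0 := by rw [hp]; exact_mod_cast Nat.succ_ne_zero (2 * h)
  -- Still primitive after squaring, because `p` is odd.
  have hζ : IsPrimitiveRoot (cexp (2 * Real.pi * I * (2 / p))) p := by
    have h1 := (Complex.isPrimitiveRoot_exp p (by omega)).pow_of_coprime 2
      (by rw [hp]; simp)
    convert h1 using 1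
    rw [← Complex.exp_nat_mul]
    congr 1
    push_cast
    ring
  set ζ := cexp (2 * Real.pi * I * (2 / p)) with hζd
  have hw : ∀ k : ℕ, cexp (2 * Real.pi * I * (2 * (k + 1) / p)) = ζ ^ (k + 1) := by
    intro k
    rw [hζd, ← Complex.exp_nat_mul]
    congr 1
    push_cast
    ring
  refine ⟨∏ k ∈ Finset.range h, (cexp (Real.pi * I * (2 * (k + 1) / p)) *
    (1 - (ζ ^ (k + 1))⁻¹)), ?_, fun τ hτ => ?_⟩
  · refine Finset.prod_ne_zero_iff.mpr fun k hk => mul_ne_zero (Complex.exp_ne_zero _) ?_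
    rw [sub_ne_zero]
    intro he
    have := hζ.pow_eq_one_iff_dvd (k + 1) |>.mp (inv_eq_one.mp he.symm)
    have := Nat.le_of_dvd (by omega) this
    have := Finset.mem_range.mp hk
    omega
  · have hq := norm_cexp_two_pi_lt_one hτ
    have hτp : 0 < ((p : ℂ) * τ).im := by
      have : (0 : ℝ) < p := by rw [hp]; positivity
      simpa using mul_pos this hτ
    have hqp : cexp (2 * Real.pi * I * (p * τ)) = cexp (2 * Real.pi * I * τ) ^ p := by
      rw [← Complex.exp_nat_mul]; congr 1; ring
    have hm : ∀ k : ℕ, Multipliable fun n : ℕ =>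
        ((1 - (ζ ^ (k + 1))⁻¹ * cexp (2 * Real.pi * I * τ) ^ (n + 1)) *
        (1 - ζ ^ (k + 1) * cexp (2 * Real.pi * I * τ) ^ (n + 1))) := fun k =>
      (multipliable_one_sub_mul_pow hq _).mul (multipliable_one_sub_mul_pow hq _)
    have h1 : ∀ k ∈ Finset.range h, siegel 0 (2 * (k + 1) / p) τ =
        (cexp (Real.pi * I * (2 * (k + 1) / p)) * (1 - (ζ ^ (k + 1))⁻¹)) *
        (cexp (Real.pi * I * τ / 6) *
        ∏' n : ℕ, ((1 - (ζ ^ (k + 1))⁻¹ * cexp (2 * Real.pi * I * τ) ^ (n + 1)) *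
        (1 - ζ ^ (k + 1) * cexp (2 * Real.pi * I * τ) ^ (n + 1)))) := by
      intro k _
      rw [siegel_zero_left _ hτ, hw, mul_assoc]
    rw [Finset.prod_congr rfl h1, Finset.prod_mul_distrib]
    congr 1
    rw [Finset.prod_mul_distrib, Finset.prod_const, Finset.card_range,
      ← Multipliable.tprod_finsetProd fun k _ => hm k]
    rw [eq_div_iff (ModularForm.eta_ne_zero hτ), eta_eq_cexp_mul, eta_eq_cexp_mul, hqp]
    have h2 := (ModularForm.multipliable_one_sub_pow hq).tprod_mul
      (multipliable_prod fun k (_ : k ∈ Finset.range h) => hm k)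
    simp_rw [prod_one_sub_rootOfUnity h hζ] at h2
    have h3 : ∏' n : ℕ, (1 - (cexp (2 * Real.pi * I * τ) ^ p) ^ (n + 1)) =
        ∏' n : ℕ, (1 - (cexp (2 * Real.pi * I * τ) ^ (n + 1)) ^ p) :=
      tprod_congr fun n => by rw [← pow_mul, ← pow_mul, mul_comm p]
    -- The leading powers of `q` match because `p / 24 = h / 12 + 1 / 24`.
    have h4 : cexp (2 * Real.pi * I * (p * τ / 24)) =
        cexp (Real.pi * I * τ / 6) ^ h * cexp (2 * Real.pi * I * (τ / 24)) := by
      rw [← Complex.exp_nat_mul, ← Complex.exp_add]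
      congr 1
      rw [hp]; push_cast; ring
    rw [h3, h2, h4]
    ring

lemma siegel_mobius {a b c d : ℤ} (hdet : a * d - b * c = 1) {τ : ℂ} (hτ : 0 < τ.im) :
    ∃ ε : ℂ, ε ^ 12 = 1 ∧ ∀ x y : ℂ, siegel x y ((a * τ + b) / (c * τ + d)) =
      ε * siegel (x * a + y * c) (x * b + y * d) τ := by
  have hdet' : Matrix.det !![a, b; c, d] = 1 := by rw [Matrix.det_fin_two_of]; exact hdet
  obtain ⟨g, hg⟩ : ∃ g : Matrix.SpecialLinearGroup (Fin 2) ℤ, (g : Matrix _ _ ℤ) = !![a, b; c, d] :=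
    ⟨⟨_, hdet'⟩, rfl⟩
  obtain ⟨ε, h1, h2⟩ := siegel_smul g ⟨τ, hτ⟩
  refine ⟨ε, h1, fun x y => ?_⟩
  have := h2 x y
  rw [UpperHalfPlane.coe_specialLinearGroup_apply, hg] at this
  simpa using this

/-- The product of the Siegel functions over half of the line of `p`-division points spanned by
the integral vector `(x, y)`. -/
noncomputable def siegelProd (p : ℕ) (x y : ℤ) (τ : ℂ) : ℂ :=
  ∏ k ∈ Finset.Ico 1 (p / 2).succ, siegel (2 * k * x / p) (2 * k * y / p) τ

lemma siegelProd_mobius (p : ℕ) {a b c d : ℤ} (hdet : a * d - b * c = 1) {τ : ℂ} (hτ : 0 < τ.im) :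
    ∃ ε : ℂ, ε ^ 12 = 1 ∧ ∀ x y : ℤ, siegelProd p x y ((a * τ + b) / (c * τ + d)) =
      ε * siegelProd p (x * a + y * c) (x * b + y * d) τ := by
  obtain ⟨ε, h1, h2⟩ := siegel_mobius hdet hτ
  refine ⟨∏ k ∈ Finset.Ico 1 (p / 2).succ, ε, ?_, fun x y => ?_⟩
  · rw [← Finset.prod_pow, h1, Finset.prod_const_one]
  · rw [siegelProd, siegelProd, ← Finset.prod_mul_distrib]
    refine Finset.prod_congr rfl fun k _ => ?_
    rw [h2]
    push_cast
    ring_nf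

lemma siegel_natAbs (k : ℤ) (x y : ℂ) (p τ : ℂ) :
    siegel (2 * k * x / p) (2 * k * y / p) τ =
      (if 0 ≤ k then 1 else -1) * siegel (2 * k.natAbs * x / p) (2 * k.natAbs * y / p) τ := by
  split_ifs with h
  · obtain ⟨n, rfl⟩ := Int.eq_ofNat_of_zero_le h
    simp
  · obtain ⟨n, hn⟩ := Int.eq_ofNat_of_zero_le (by omega : 0 ≤ -k)
    obtain rfl : k = -n := by omega
    rw [neg_one_mul, ← siegel_neg]
    simp [neg_div]

/-- This is Gauss's lemma: multiplication by `t` permutes `1, …, p / 2` modulo `p` up to signs, and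
the Siegel functions are odd. The resulting sign depends on `t` alone. -/
lemma siegelProd_mul (p : ℕ) [hp : Fact p.Prime] {t : ℤ} (ht : (t : ZMod p) ≠ 0) :
    ∃ s : ℂ, s ^ 2 = 1 ∧ ∀ (x y : ℤ) (τ : ℂ),
      siegelProd p (t * x) (t * y) τ = s * siegelProd p x y τ := by
  refine ⟨∏ k ∈ Finset.Ico 1 (p / 2).succ,
    if 0 ≤ ((t : ZMod p) * (k : ℕ)).valMinAbs then 1 else -1, ?_, fun x y τ => ?_⟩
  · rw [← Finset.prod_pow]
    exact Finset.prod_eq_one fun k _ => by split_ifs <;> simp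
  · have hG := ZMod.Ico_map_valMinAbs_natAbs_eq_Ico_map_id p (t : ZMod p) ht
    have h1 : siegelProd p x y τ = ∏ k ∈ Finset.Ico 1 (p / 2).succ,
        siegel (2 * ((t : ZMod p) * (k : ℕ)).valMinAbs.natAbs * x / p)
          (2 * ((t : ZMod p) * (k : ℕ)).valMinAbs.natAbs * y / p) τ := by
      have := congrArg (fun m : Multiset ℕ =>
        (m.map fun k : ℕ => siegel (2 * k * x / p) (2 * k * y / p) τ).prod) hG
      simp only [Multiset.map_map, Function.comp_def] at this
      exact this.symm
    rw [h1, siegelProd, ← Finset.prod_mul_distrib]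
    refine Finset.prod_congr rfl fun k _ => ?_
    rw [← siegel_natAbs]
    set v := ((t : ZMod p) * (k : ℕ)).valMinAbs with hv
    have h2 : ((v : ℤ) : ZMod p) = ((t * k : ℤ) : ZMod p) := by
      rw [hv, ZMod.coe_valMinAbs]; push_cast; rfl
    obtain ⟨m, hm⟩ := (ZMod.intCast_eq_intCast_iff_dvd_sub _ _ _).mp h2
    have hm' : (t : ℂ) * k = v + p * m := by
      have : t * k = v + p * m := by linarith
      exact_mod_cast congrArg (Int.cast : ℤ → ℂ) this
    have hp0 : (p : ℂ) ≠ 0 := by exact_mod_cast hp.out.ne_zero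
    have e1 : ∀ x : ℤ, 2 * (k : ℂ) * ((t * x : ℤ) : ℂ) / p = 2 * v * x / p + 2 * ((m * x : ℤ) : ℂ) := by
      intro x
      push_cast
      field_simp
      linear_combination (x : ℂ) * hm'
    rw [e1, e1, siegel_add_two]
    -- The translation is parallel to the vector `(x, y)`, so the alternating form in the phase of
    -- `siegel_add_two` vanishes.
    have e2 : 2 * Real.pi * I * (((m * y : ℤ) : ℂ) * (2 * v * x / p) -
        ((m * x : ℤ) : ℂ) * (2 * v * y / p)) = 0 := by push_cast; ring
    rw [e2, Complex.exp_zero, one_mul]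

lemma sum_Ico_sq (h : ℕ) : 6 * ∑ k ∈ Finset.Ico 1 h.succ, k ^ 2 = h * (h + 1) * (2 * h + 1) := by
  induction h with
  | zero => simp
  | succ h ih => rw [Finset.sum_Ico_succ_top (by omega), mul_add, ih]; ring

/-- The phases `2k²(nx - my)/p` are added up with the formula for a sum of squares. Their total is a
multiple of `h(h + 1)/3`, which leaves a cube root of unity, trivial unless `3 ∣ p`. -/
lemma siegelProd_add_mul {p h : ℕ} (hp : p = 2 * h + 1) (x y m n : ℤ) (τ : ℂ) :
    siegelProd p (x + p * m) (y + p * n) τ =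
      cexp (2 * Real.pi * I * ((n * x - m * y) * (h * (h + 1) / 3))) * siegelProd p x y τ := by
  have hp0 : (p : ℂ) ≠ 0 := by rw [hp]; exact_mod_cast Nat.succ_ne_zero (2 * h)
  have hh : p / 2 = h := by omega
  have h1 : ∀ k ∈ Finset.Ico 1 (p / 2).succ,
      siegel (2 * k * ((x + p * m : ℤ) : ℂ) / p) (2 * k * ((y + p * n : ℤ) : ℂ) / p) τ =
      cexp (2 * Real.pi * I * ((n * x - m * y) * 2 / p) * (k ^ 2 : ℕ)) *
        siegel (2 * k * x / p) (2 * k * y / p) τ := by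
    intro k _
    have e : ∀ x m : ℤ, 2 * (k : ℂ) * ((x + p * m : ℤ) : ℂ) / p =
        2 * k * x / p + 2 * ((k * m : ℤ) : ℂ) := by
      intro x m; push_cast; field_simp
    rw [e, e, siegel_add_two]
    congr 2
    push_cast
    ring
  rw [siegelProd, Finset.prod_congr rfl h1, Finset.prod_mul_distrib, ← Complex.exp_sum,
    ← Finset.mul_sum, siegelProd, hh]
  congr 2
  have h2 := sum_Ico_sq h
  have h3 : (6 : ℂ) * ∑ k ∈ Finset.Ico 1 h.succ, ((k ^ 2 : ℕ) : ℂ) = h * (h + 1) * p := by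
    rw [hp]; exact_mod_cast h2
  have h4 : ∑ k ∈ Finset.Ico 1 h.succ, ((k ^ 2 : ℕ) : ℂ) = h * (h + 1) * p / 6 := by
    rw [← h3]; ring
  rw [h4]
  field_simp
  ring

lemma siegelProd_zero (p : ℕ) [hp : Fact p.Prime] (τ : ℂ) (hτ : 0 < τ.im) : siegelProd p 0 0 τ = 0 := by
  refine Finset.prod_eq_zero (i := 1) ?_ ?_
  · have := hp.out.two_le
    rw [Finset.mem_Ico]
    omega
  · simp only [Int.cast_zero, mul_zero, zero_div]
    rw [siegel_zero_left 0 hτ]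
    simp

/-! ### Level `N`: products over divisors and Atkin–Lehner operators -/

/-- The product over `j ∣ N` of the functions `siegelProd` at `jτ`. -/
noncomputable def siegelTerm (N r p : ℕ) (x y : ℤ) (τ : ℂ) : ℂ :=
  ∏ j ∈ N.divisors, siegelProd p x (j * y) (j * τ) ^ r

/-- The vector `(x, j y)` at `jτ` stands for `j` times the point `xτ + y`, so the phase of
`siegelProd_add_mul` acquires a factor `j`. The exponents over all divisors add up to `r σ(N) h(h +
1)/3` times an integer, which `h3` makes integral. -/
lemma siegelTerm_add_mul (N r : ℕ) {p h : ℕ} (hp : p = 2 * h + 1)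
    (h3 : 3 ∣ (∑ j ∈ N.divisors, j) * r * (h * (h + 1))) (x y m n : ℤ) (τ : ℂ) :
    siegelTerm N r p (x + p * m) (y + p * n) τ = siegelTerm N r p x y τ := by
  have h1 : ∀ j ∈ N.divisors, siegelProd p (x + p * m) (j * (y + p * n)) (j * τ) ^ r =
      cexp (2 * Real.pi * I * ((n * x - m * y) * (h * (h + 1) / 3) * r) * j) *
      siegelProd p x (j * y) (j * τ) ^ r := by
    intro j _
    rw [show (j : ℤ) * (y + p * n) = j * y + p * (j * n) by ring, siegelProd_add_mul hp, mul_pow,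
      ← Complex.exp_nat_mul]
    congr 2
    push_cast
    ring
  rw [siegelTerm, Finset.prod_congr rfl h1, Finset.prod_mul_distrib, ← Complex.exp_sum,
    ← Finset.mul_sum, siegelTerm]
  obtain ⟨t, ht⟩ := h3
  have ht' : (∑ j ∈ N.divisors, (j : ℂ)) * r * (h * (h + 1)) = 3 * t := by
    have := congrArg (Nat.cast : ℕ → ℂ) ht
    push_cast at this
    linear_combination this
  have : 2 * Real.pi * I * ((n * x - m * y) * (h * (h + 1) / 3) * r) * ∑ j ∈ N.divisors, (j : ℂ) =
      ((n * x - m * y) * t : ℤ) * (2 * Real.pi * I) := by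
    push_cast
    linear_combination (2 * Real.pi * I * (n * x - m * y) / 3) * ht'
  rw [this, Complex.exp_int_mul_two_pi_mul_I, one_mul]

/-- The sign of `siegelProd_mul` occurs `r` times for every divisor, hence an even number of times.
-/
lemma siegelTerm_mul (N r p : ℕ) [Fact p.Prime] (hr : Even (r * N.divisors.card)) {t : ℤ}
    (ht : (t : ZMod p) ≠ 0) (x y : ℤ) (τ : ℂ) :
    siegelTerm N r p (t * x) (t * y) τ = siegelTerm N r p x y τ := by
  obtain ⟨s, h1, h2⟩ := siegelProd_mul p ht
  have h3 : ∀ j ∈ N.divisors, siegelProd p (t * x) (j * (t * y)) (j * τ) ^ r =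
      s ^ r * siegelProd p x (j * y) (j * τ) ^ r := by
    intro j _
    rw [show (j : ℤ) * (t * y) = t * (j * y) by ring, h2, mul_pow]
  rw [siegelTerm, Finset.prod_congr rfl h3, Finset.prod_mul_distrib, Finset.prod_const, ← pow_mul]
  obtain ⟨k, hk⟩ := hr
  rw [hk, ← two_mul, pow_mul, h1, one_pow, one_mul, siegelTerm]

lemma siegelTerm_zero (N r p : ℕ) [Fact p.Prime] (hr : r ≠ 0) (hN : N ≠ 0) {τ : ℂ}
    (hτ : 0 < τ.im) : siegelTerm N r p 0 0 τ = 0 := by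
  refine Finset.prod_eq_zero (Nat.one_mem_divisors.mpr hN) ?_
  rw [mul_zero, siegelProd_zero p _ (by simpa using hτ), zero_pow hr]

section AtkinLehner

/-- The permutation of the divisors of `N` induced by the Atkin–Lehner involution of `e`. -/
def atkinLehnerDivisor (e j : ℕ) : ℕ := (j / j.gcd e) * (e / j.gcd e)

variable {N e j : ℕ}

lemma atkinLehnerDivisor_mul_gcd : atkinLehnerDivisor e j * j.gcd e = j.lcm e := by
  rw [atkinLehnerDivisor, mul_assoc, Nat.div_mul_cancel (Nat.gcd_dvd_right j e), Nat.lcm,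
    Nat.div_mul_right_comm (Nat.gcd_dvd_left j e)]

lemma atkinLehnerDivisor_mem (he : e ∈ N.divisors) (hj : j ∈ N.divisors) :
    atkinLehnerDivisor e j ∈ N.divisors := by
  rw [Nat.mem_divisors] at *
  exact ⟨(Dvd.intro _ atkinLehnerDivisor_mul_gcd).trans (Nat.lcm_dvd hj.1 he.1), hj.2⟩

/-- For `j = g j'` and `e = g e'` with `g = gcd(j, e)` the image is `j' e'`. Its gcd with `e` is
`e'`, because squarefreeness makes `j'` prime to `g`, and the same rule leads back to `j' g`. -/
lemma atkinLehnerDivisor_involutive (hN : Squarefree N) (he : e ∈ N.divisors)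
    (hj : j ∈ N.divisors) : atkinLehnerDivisor e (atkinLehnerDivisor e j) = j := by
  rw [Nat.mem_divisors] at *
  have hg0 : 0 < j.gcd e := Nat.gcd_pos_of_pos_right _ (Nat.pos_of_dvd_of_pos he.1
    (Nat.pos_of_ne_zero he.2))
  obtain ⟨j', hj'⟩ := Nat.gcd_dvd_left j e
  obtain ⟨e', he'⟩ := Nat.gcd_dvd_right j e
  set g := j.gcd e with hg
  have e1 : atkinLehnerDivisor e j = j' * e' := by
    rw [atkinLehnerDivisor, ← hg]
    nth_rw 1 [hj']
    nth_rw 1 [he']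
    rw [Nat.mul_div_cancel_left _ hg0, Nat.mul_div_cancel_left _ hg0]
  have hc : j'.Coprime g := by
    have := hN.squarefree_of_dvd hj.1
    rw [hj', Nat.squarefree_mul_iff] at this
    exact this.1.symm
  have he0 : 0 < e' := by
    rcases Nat.eq_zero_or_pos e' with h | h
    · rw [h, mul_zero] at he'; rw [he'] at he; simp at he
    · exact h
  have e2 : (j' * e').gcd e = e' := by
    rw [he', mul_comm j', mul_comm g, Nat.gcd_mul_left, hc, mul_one]
  rw [e1, atkinLehnerDivisor, e2, Nat.mul_div_cancel _ he0]
  nth_rw 1 [he']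
  rw [Nat.mul_div_cancel _ he0, hj', mul_comm]

/-- Write `j = g j'`, `e = g e'` with `g = gcd(j, e)`, and `c = j' c'`. Then `j` times the image of
`τ` is the image of `j' e' τ` under the matrix with rows `(g a, j' b)` and `(c', e' d)`, of
determinant 1, so `siegelProd_mobius` applies. The vector it produces, multiplied by `e`, is `g`
times the vector on the right; both `e` and `g` are units modulo `p` and cost only signs. -/
lemma siegelProd_atkinLehner (p : ℕ) [hp : Fact p.Prime] (he : e ∈ N.divisors)
    (hj : j ∈ N.divisors) (hpN : ¬ p ∣ N) {a b c d : ℤ} (hc : ((N / e : ℕ) : ℤ) ∣ c)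
    (hdet : e * a * d - b * c = 1) {τ : ℂ} (hτ : 0 < τ.im) :
    ∃ ε : ℂ, ε ^ 12 = 1 ∧ ∀ x y : ℤ,
      siegelProd p x (j * y) (j * ((e * a * τ + b) / (e * c * τ + e * d))) =
      ε * siegelProd p (e * (x * a + y * c)) (atkinLehnerDivisor e j * (x * b + e * y * d))
        (atkinLehnerDivisor e j * τ) := by
  rw [Nat.mem_divisors] at he hj
  have hN0 := Nat.pos_of_ne_zero he.2
  have he0 : 0 < e := Nat.pos_of_dvd_of_pos he.1 hN0
  have hg0 : 0 < j.gcd e := Nat.gcd_pos_of_pos_right _ he0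
  obtain ⟨j', hj'⟩ := Nat.gcd_dvd_left j e
  obtain ⟨e', he'⟩ := Nat.gcd_dvd_right j e
  have hcop : j'.Coprime e' := by
    have := Nat.coprime_div_gcd_div_gcd hg0
    rwa [Nat.div_eq_of_eq_mul_right hg0 hj', Nat.div_eq_of_eq_mul_right hg0 he'] at this
  have hge : j.gcd e ∣ e := Nat.gcd_dvd_right j e
  set g := j.gcd e with hg
  have hAL : atkinLehnerDivisor e j = j' * e' := by
    rw [atkinLehnerDivisor, ← hg, Nat.div_eq_of_eq_mul_right hg0 hj',
      Nat.div_eq_of_eq_mul_right hg0 he']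
  have hj'0 : 0 < j' := by
    rcases Nat.eq_zero_or_pos j' with h | h
    · rw [h, mul_zero] at hj'; rw [hj'] at hj; simp at hj
    · exact h
  have he'0 : 0 < e' := by
    rcases Nat.eq_zero_or_pos e' with h | h
    · rw [h, mul_zero] at he'; omega
    · exact h
  have hj'N : j' ∣ N / e := by
    rw [Nat.dvd_div_iff_mul_dvd he.1]
    have : j.lcm e = e * j' := by
      rw [Nat.lcm, ← hg]
      nth_rw 1 [hj']
      rw [mul_assoc, Nat.mul_div_cancel_left _ hg0, mul_comm]
    exact this ▸ Nat.lcm_dvd hj.1 he.1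
  obtain ⟨c', rfl⟩ := (Int.natCast_dvd_natCast.mpr hj'N).trans hc
  have hdet' : (g * a) * (e' * d) - (j' * b) * c' = 1 := by
    rw [← hdet, he']; push_cast; ring
  have hτ' : 0 < (((j' * e' : ℕ) : ℂ) * τ).im := by
    have : (0 : ℝ) < (j' * e' : ℕ) := by exact_mod_cast Nat.mul_pos hj'0 he'0
    simpa using mul_pos this hτ
  obtain ⟨ε, h1, h2⟩ := siegelProd_mobius p hdet' hτ'
  have hdvd : ∀ t : ℕ, t ∣ N → ((t : ℤ) : ZMod p) ≠ 0 := by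
    intro t ht h
    rw [Int.cast_natCast, ZMod.natCast_eq_zero_iff] at h
    exact hpN (h.trans ht)
  obtain ⟨s, hs1, hs2⟩ := siegelProd_mul p (hdvd e he.1)
  obtain ⟨s', hs1', hs2'⟩ := siegelProd_mul p (hdvd g (hge.trans he.1))
  refine ⟨ε * s * s', ?_, fun x y => ?_⟩
  · rw [mul_pow, mul_pow, h1, show 12 = 2 * 6 by norm_num, pow_mul, hs1, pow_mul, hs1']
    simp
  · have harg : (j : ℂ) * ((e * a * τ + b) / (e * ((j' * c' : ℤ) : ℂ) * τ + e * d)) =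
        (((g * a : ℤ) : ℂ) * (((j' * e' : ℕ) : ℂ) * τ) + ((j' * b : ℤ) : ℂ)) /
        ((c' : ℂ) * (((j' * e' : ℕ) : ℂ) * τ) + ((e' * d : ℤ) : ℂ)) := by
      rw [hj', he']
      have hgC : (g : ℂ) ≠ 0 := by exact_mod_cast hg0.ne'
      push_cast
      rw [mul_div_assoc', show (g : ℂ) * j' * (g * e' * a * τ + b) =
        g * (g * a * (j' * e' * τ) + j' * b) by ring,
        show (g : ℂ) * e' * (j' * c') * τ + g * e' * d = g * (c' * (j' * e' * τ) + e' * d) by ring,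
        mul_div_mul_left _ _ hgC]
    rw [harg, h2, hAL]
    have h5 := hs2 (x * (g * a) + j * y * c') (x * (j' * b) + j * y * (e' * d))
      (((j' * e' : ℕ) : ℂ) * τ)
    have h6 := hs2' (e * (x * a + y * (j' * c'))) ((j' * e' : ℕ) * (x * b + e * y * d))
      (((j' * e' : ℕ) : ℂ) * τ)
    have h7 : (e : ℤ) * (x * (g * a) + j * y * c') = g * (e * (x * a + y * (j' * c'))) := by
      rw [hj']; push_cast; ring
    have h8 : (e : ℤ) * (x * (j' * b) + j * y * (e' * d)) =
        g * ((j' * e' : ℕ) * (x * b + e * y * d)) := by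
      rw [hj']; nth_rw 1 [he']; rw [he']; push_cast; ring
    rw [h7, h8, h6] at h5
    linear_combination (-ε * s) * h5 - ε * siegelProd p (x * (g * a) + j * y * c')
      (x * (j' * b) + j * y * (e' * d)) (((j' * e' : ℕ) : ℂ) * τ) * hs1

lemma siegelTerm_atkinLehner (r p : ℕ) [hp : Fact p.Prime] (hN : Squarefree N)
    (he : e ∈ N.divisors) (hpN : ¬ p ∣ N) {a b c d : ℤ} (hc : ((N / e : ℕ) : ℤ) ∣ c)
    (hdet : e * a * d - b * c = 1) {τ : ℂ} (hτ : 0 < τ.im) :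
    ∃ ε : ℂ, ε ^ 12 = 1 ∧ ∀ x y : ℤ,
      siegelTerm N r p x y ((e * a * τ + b) / (e * c * τ + e * d)) =
      ε * siegelTerm N r p (e * (x * a + y * c)) (x * b + e * y * d) τ := by
  have H := fun j (hj : j ∈ N.divisors) => siegelProd_atkinLehner p he hj hpN hc hdet hτ
  choose! ε h1 h2 using H
  refine ⟨∏ j ∈ N.divisors, ε j ^ r, ?_, fun x y => ?_⟩
  · rw [← Finset.prod_pow]
    refine Finset.prod_eq_one fun j hj => ?_
    rw [← pow_mul, mul_comm, pow_mul, h1 j hj, one_pow]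
  · rw [siegelTerm, siegelTerm]
    rw [Finset.prod_congr rfl fun j hj => by rw [h2 j hj x y, mul_pow], Finset.prod_mul_distrib]
    congr 1
    refine Finset.prod_nbij' (atkinLehnerDivisor e) (atkinLehnerDivisor e)
      (fun j hj => atkinLehnerDivisor_mem he hj) (fun j hj => atkinLehnerDivisor_mem he hj)
      (fun j hj => atkinLehnerDivisor_involutive hN he hj)
      (fun j hj => atkinLehnerDivisor_involutive hN he hj) (fun j _ => rfl)

end AtkinLehner

/-! ### The sum over division points as a Hecke translate -/

/-- The eta-product `∏_{j ∣ N} η(jτ)^r`. -/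
noncomputable def etaDivisors (N r : ℕ) (τ : ℂ) : ℂ :=
  ∏ j ∈ N.divisors, ModularForm.eta (j * τ) ^ r

lemma im_natCast_mul_pos {j : ℕ} (hj : 0 < j) {τ : ℂ} (hτ : 0 < τ.im) : 0 < ((j : ℂ) * τ).im := by
  have : (0 : ℝ) < j := by exact_mod_cast hj
  simpa using mul_pos this hτ

lemma etaDivisors_ne_zero (N r : ℕ) {τ : ℂ} (hτ : 0 < τ.im) : etaDivisors N r τ ≠ 0 :=
  Finset.prod_ne_zero_iff.mpr fun _ hj => pow_ne_zero _
    (ModularForm.eta_ne_zero (im_natCast_mul_pos (Nat.pos_of_mem_divisors hj) hτ))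

/-- The sum of `siegelTerm` over all `p`-division points. -/
noncomputable def siegelSum (N r p : ℕ) [NeZero p] (τ : ℂ) : ℂ :=
  ∑ v : ZMod p × ZMod p, siegelTerm N r p v.1.val v.2.val τ

section

variable {N r p h : ℕ}

lemma siegelTerm_congr (hp : p = 2 * h + 1)
    (h3 : 3 ∣ (∑ j ∈ N.divisors, j) * r * (h * (h + 1))) {x y x' y' : ℤ}
    (hx : (x : ZMod p) = x') (hy : (y : ZMod p) = y') (τ : ℂ) :
    siegelTerm N r p x y τ = siegelTerm N r p x' y' τ := by
  obtain ⟨m, hm⟩ := (ZMod.intCast_eq_intCast_iff_dvd_sub _ _ _).mp hx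
  obtain ⟨n, hn⟩ := (ZMod.intCast_eq_intCast_iff_dvd_sub _ _ _).mp hy
  rw [show x' = x + p * m by linarith, show y' = y + p * n by linarith,
    siegelTerm_add_mul N r hp h3]

lemma siegelSum_atkinLehner [hpp : Fact p.Prime] (hp : p = 2 * h + 1)
    (h3 : 3 ∣ (∑ j ∈ N.divisors, j) * r * (h * (h + 1))) (hN : Squarefree N) {e : ℕ}
    (he : e ∈ N.divisors) (hpN : ¬ p ∣ N) {a b c d : ℤ} (hc : ((N / e : ℕ) : ℤ) ∣ c)
    (hdet : e * a * d - b * c = 1) {τ : ℂ} (hτ : 0 < τ.im) :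
    siegelSum N r p ((e * a * τ + b) / (e * c * τ + e * d)) ^ 12 = siegelSum N r p τ ^ 12 := by
  obtain ⟨ε, h1, h2⟩ := siegelTerm_atkinLehner r p hN he hpN hc hdet hτ
  have key : siegelSum N r p ((e * a * τ + b) / (e * c * τ + e * d)) = ε * siegelSum N r p τ := by
    rw [siegelSum, siegelSum, Finset.mul_sum]
    -- This linear map has determinant `e`, a unit because `p` does not divide `N`.
    let φ : ZMod p × ZMod p → ZMod p × ZMod p := fun v =>
      (e * (v.1 * a + v.2 * c), v.1 * b + e * v.2 * d)
    have he0 : (e : ZMod p) ≠ 0 := by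
      rw [Ne, ZMod.natCast_eq_zero_iff]
      exact fun hd => hpN (hd.trans (Nat.mem_divisors.mp he).1)
    have hdet' : (e : ZMod p) * a * d - b * c = 1 := by
      have := congrArg (Int.cast : ℤ → ZMod p) hdet
      push_cast at this
      exact this
    have hφ : Function.Bijective φ := by
      refine Finite.injective_iff_bijective.mp fun v w hvw => ?_
      have e1 : (e : ZMod p) * (v.1 * a + v.2 * c) = e * (w.1 * a + w.2 * c) :=
        congrArg Prod.fst hvw
      have e2 : v.1 * b + e * v.2 * d = w.1 * b + e * w.2 * d := congrArg Prod.snd hvw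
      have e3 := mul_left_cancel₀ he0 e1
      refine Prod.ext ?_ (mul_left_cancel₀ he0 ?_)
      · linear_combination (v.1 - w.1) * (-hdet') + (e : ZMod p) * d * e3 - c * e2
      · linear_combination (e : ZMod p) * (v.2 - w.2) * (-hdet') + (e : ZMod p) * a * e2 - b * e1
    refine Fintype.sum_bijective φ hφ _ _ fun v => ?_
    rw [h2]
    congr 1
    exact siegelTerm_congr hp h3 (by simp [φ]) (by simp [φ]) τ
  rw [key, mul_pow, h1, one_mul]

/-- The term is zero at the origin and constant on each punctured line through it. The `p + 1` lines
are spanned by `(0, 1)` and the `(1, D b)`, and each has `p - 1` nonzero vectors. -/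
lemma siegelSum_eq [hpp : Fact p.Prime] (hp : p = 2 * h + 1)
    (h3 : 3 ∣ (∑ j ∈ N.divisors, j) * r * (h * (h + 1))) (hN : N ≠ 0) (hr : r ≠ 0)
    (hrN : Even (r * N.divisors.card)) {D : ℕ} (hD : ¬ p ∣ D) {τ : ℂ} (hτ : 0 < τ.im) :
    siegelSum N r p τ = (p - 1) * (siegelTerm N r p 0 1 τ +
      ∑ b ∈ Finset.range p, siegelTerm N r p 1 (D * b : ℕ) τ) := by
  let f : ZMod p → ZMod p → ℂ := fun x y => siegelTerm N r p x.val y.val τ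
  have hf : ∀ x y : ℤ, f x y = siegelTerm N r p x y τ := fun x y =>
    siegelTerm_congr hp h3 (by simp) (by simp) τ
  have hmul : ∀ t x y : ZMod p, t ≠ 0 → f (t * x) (t * y) = f x y := by
    intro t x y ht
    have h1 := hf (t.val * x.val) (t.val * y.val)
    rw [siegelTerm_mul N r p hrN (by simpa using ht)] at h1
    simpa [f] using h1
  have h00 : f 0 0 = 0 := by
    have := hf 0 0
    rw [siegelTerm_zero N r p hr hN hτ] at this
    simpa using this
  have hcard : ((({0} : Finset (ZMod p))ᶜ).card : ℂ) = p - 1 := by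
    rw [Finset.card_compl, ZMod.card, Finset.card_singleton, Nat.cast_sub hpp.out.one_le]
    simp
  have hrow : ∀ x : ZMod p, x ≠ 0 → ∑ y, f x y = ∑ y, f 1 y := by
    intro x hx
    rw [← Equiv.sum_comp (Equiv.mulLeft₀ x hx)]
    refine Finset.sum_congr rfl fun y _ => ?_
    have := hmul x 1 y hx
    rwa [mul_one] at this
  have hDp : (D : ZMod p) ≠ 0 := by rwa [Ne, ZMod.natCast_eq_zero_iff]
  have hlast : ∑ y, f 1 y = ∑ b ∈ Finset.range p, siegelTerm N r p 1 (D * b : ℕ) τ := by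
    rw [← Equiv.sum_comp (Equiv.mulLeft₀ (D : ZMod p) hDp)]
    refine Finset.sum_nbij' ZMod.val (fun b : ℕ => (b : ZMod p)) ?_ ?_ ?_ ?_ ?_
    · intro b _; exact Finset.mem_range.mpr (ZMod.val_lt b)
    · intro b _; exact Finset.mem_univ _
    · intro b _; simp
    · intro b hb; exact ZMod.val_cast_of_lt (Finset.mem_range.mp hb)
    · intro b _
      have := hf 1 (D * b.val : ℕ)
      simpa using this
  rw [siegelSum, Fintype.sum_prod_type]
  change ∑ x, ∑ y, f x y = _
  rw [Fintype.sum_eq_add_sum_compl 0, Fintype.sum_eq_add_sum_compl 0, h00, zero_add,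
    Finset.sum_congr rfl fun x hx => hrow x (by simpa using hx), Finset.sum_const,
    Finset.sum_congr rfl fun y hy => (by
      have := hmul y 0 1 (by simpa using hy)
      rwa [mul_zero, mul_one] at this : f 0 y = f 0 1), Finset.sum_const, nsmul_eq_mul,
    nsmul_eq_mul, hcard, hlast, mul_add]
  congr 2
  have := hf 0 1
  simpa using this

lemma sqrt_div_natCast {p : ℕ} (hp : 0 < p) :
    ∃ c : ℂ, c ≠ 0 ∧ ∀ τ : ℂ, 0 < τ.im → sqrt (τ / p) = c * sqrt τ := by
  refine ⟨cexp (-Real.log p / 2), Complex.exp_ne_zero _, fun τ hτ => ?_⟩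
  have hτ0 : τ ≠ 0 := by rintro rfl; simp at hτ
  have hp' : (0 : ℝ) < (p : ℝ)⁻¹ := by positivity
  have h1 := Complex.log_mul_ofReal (p : ℝ)⁻¹ hp' τ hτ0
  have e : τ / p = τ * ((p : ℝ)⁻¹ : ℝ) := by push_cast; rw [div_eq_mul_inv]
  have hne : τ / p ≠ 0 := div_ne_zero hτ0 (by exact_mod_cast hp.ne')
  rw [sqrt, sqrt, Complex.cpow_def_of_ne_zero hτ0, Complex.cpow_def_of_ne_zero hne,
    ← Complex.exp_add, e, h1, Real.log_inv]
  congr 1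
  push_cast
  ring

lemma siegelProd_zero_one (hp : p = 2 * h + 1) : ∃ c : ℂ, c ≠ 0 ∧ ∀ τ : ℂ, 0 < τ.im →
    siegelProd p 0 1 τ = c * (ModularForm.eta (p * τ) / ModularForm.eta τ) := by
  obtain ⟨c, h1, h2⟩ := prod_siegel_zero_left h
  refine ⟨c, h1, fun τ hτ => ?_⟩
  rw [hp, ← h2 τ hτ, siegelProd, Finset.prod_Ico_eq_prod_range,
    show ((2 * h + 1) / 2).succ - 1 = h by omega]
  refine Finset.prod_congr rfl fun k _ => ?_
  push_cast
  congr 1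
  · ring
  · ring

/-- This is `siegelProd_zero_one` seen through `τ ↦ -1/τ`; the square roots from the two eta
transformations cancel up to a constant. -/
lemma siegelProd_one_zero [hpp : Fact p.Prime] (hp : p = 2 * h + 1) :
    ∃ c : ℂ, c ≠ 0 ∧ ∀ τ : ℂ, 0 < τ.im →
    siegelProd p 1 0 τ = c * (ModularForm.eta (τ / p) / ModularForm.eta τ) := by
  obtain ⟨c, h1, h2⟩ := siegelProd_zero_one hp
  obtain ⟨c', h3, h4⟩ := sqrt_div_natCast hpp.out.pos
  have hI : (∏ k ∈ Finset.Ico 1 (p / 2).succ, -I) ≠ 0 :=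
    Finset.prod_ne_zero_iff.mpr fun _ _ => by simp
  refine ⟨(∏ k ∈ Finset.Ico 1 (p / 2).succ, -I)⁻¹ * (c * c'), by positivity, fun τ hτ => ?_⟩
  have hp0 : (p : ℂ) ≠ 0 := by exact_mod_cast hpp.out.ne_zero
  have hτ' : 0 < (-1 / τ).im := by
    rw [neg_div, one_div, ← inv_neg]; exact UpperHalfPlane.im_inv_neg_coe_pos ⟨τ, hτ⟩
  have hτp : 0 < (τ / p).im := by
    rw [Complex.div_natCast_im]
    have : (0 : ℝ) < p := by exact_mod_cast hpp.out.pos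
    positivity
  have h5 := h2 (-1 / τ) hτ'
  have h6 : siegelProd p 0 1 (-1 / τ) =
      (∏ k ∈ Finset.Ico 1 (p / 2).succ, -I) * siegelProd p 1 0 τ := by
    rw [siegelProd, siegelProd, ← Finset.prod_mul_distrib]
    refine Finset.prod_congr rfl fun k _ => ?_
    rw [siegel_neg_inv _ _ hτ]
    simp
  have h7 : (p : ℂ) * (-1 / τ) = -1 / (τ / p) := by field_simp
  have hτ0 : τ ≠ 0 := by rintro rfl; simp at hτ
  have hs : sqrt τ ≠ 0 := by
    intro h; have := complex_sqrt_sq τ; rw [h] at this; exact hτ0 (by simpa using this.symm)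
  have hsI : sqrt I ≠ 0 := by
    intro h; have := complex_sqrt_sq I; rw [h] at this; exact I_ne_zero (by simpa using this.symm)
  have he := ModularForm.eta_ne_zero hτ
  rw [h6, h7, eta_neg_inv hτ, eta_neg_inv hτp, h4 τ hτ] at h5
  rw [mul_assoc, eq_inv_mul_iff_mul_eq₀ hI, h5]
  field_simp

lemma siegelTerm_zero_one [hpp : Fact p.Prime] (hp : p = 2 * h + 1) (hpN : ¬ p ∣ N) :
    ∃ c : ℂ, c ≠ 0 ∧ ∀ τ : ℂ, 0 < τ.im →
    siegelTerm N r p 0 1 τ = c * (etaDivisors N r (p * τ) / etaDivisors N r τ) := by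
  obtain ⟨c, h1, h2⟩ := siegelProd_zero_one hp
  have h3 : ∀ j ∈ N.divisors, ∃ s : ℂ, s ^ 2 = 1 ∧ ∀ (x y : ℤ) (τ : ℂ),
      siegelProd p ((j : ℤ) * x) ((j : ℤ) * y) τ = s * siegelProd p x y τ := by
    intro j hj
    refine siegelProd_mul p ?_
    rw [Int.cast_natCast, Ne, ZMod.natCast_eq_zero_iff]
    exact fun hd => hpN (hd.trans (Nat.mem_divisors.mp hj).1)
  choose! s hs1 hs2 using h3
  refine ⟨∏ j ∈ N.divisors, (s j * c) ^ r, ?_, fun τ hτ => ?_⟩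
  · refine Finset.prod_ne_zero_iff.mpr fun j hj => pow_ne_zero _ (mul_ne_zero ?_ h1)
    intro h0
    have := hs1 j hj
    rw [h0] at this
    simp at this
  · rw [siegelTerm, etaDivisors, etaDivisors, ← Finset.prod_div_distrib,
      ← Finset.prod_mul_distrib]
    refine Finset.prod_congr rfl fun j hj => ?_
    have h4 := hs2 j hj 0 1 (j * τ)
    rw [mul_zero] at h4
    rw [h4, h2 _ (im_natCast_mul_pos (Nat.pos_of_mem_divisors hj) hτ), ← div_pow, ← mul_pow]
    ring_nf

lemma siegelTerm_one_zero [hpp : Fact p.Prime] (hp : p = 2 * h + 1) :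
    ∃ c : ℂ, c ≠ 0 ∧ ∀ τ : ℂ, 0 < τ.im →
    siegelTerm N r p 1 0 τ = c * (etaDivisors N r (τ / p) / etaDivisors N r τ) := by
  obtain ⟨c, h1, h2⟩ := siegelProd_one_zero hp
  refine ⟨∏ j ∈ N.divisors, c ^ r, ?_, fun τ hτ => ?_⟩
  · exact Finset.prod_ne_zero_iff.mpr fun j hj => pow_ne_zero _ h1
  · rw [siegelTerm, etaDivisors, etaDivisors, ← Finset.prod_div_distrib,
      ← Finset.prod_mul_distrib]
    refine Finset.prod_congr rfl fun j hj => ?_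
    rw [mul_zero, h2 _ (im_natCast_mul_pos (Nat.pos_of_mem_divisors hj) hτ), ← div_pow, ← mul_pow,
      mul_div_assoc]

lemma siegel_add_natCast (x y τ : ℂ) (n : ℕ) :
    siegel x y (τ + n) = cexp (Real.pi * I / 6 * n) * siegel x (n * x + y) τ := by
  induction n generalizing y with
  | zero => simp
  | succ n ih =>
    rw [Nat.cast_succ, ← add_assoc, siegel_add_one, ih, ← mul_assoc, ← Complex.exp_add]
    ring_nf

lemma siegelProd_add_natCast (hp : p = 2 * h + 1) (x y : ℤ) (τ : ℂ) (n : ℕ) :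
    siegelProd p x y (τ + n) =
      cexp (Real.pi * I / 6 * h * n) * siegelProd p x (n * x + y) τ := by
  have h1 : ∀ k ∈ Finset.Ico 1 (p / 2).succ, siegel (2 * k * x / p) (2 * k * y / p) (τ + n) =
      cexp (Real.pi * I / 6 * n) * siegel (2 * k * x / p) (2 * k * (n * x + y : ℤ) / p) τ := by
    intro k _
    rw [siegel_add_natCast]
    push_cast
    ring_nf
  rw [siegelProd, Finset.prod_congr rfl h1, Finset.prod_mul_distrib, Finset.prod_const,
    Nat.card_Ico, ← Complex.exp_nat_mul, siegelProd, show (p / 2).succ - 1 = h by omega]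
  congr 2
  ring

/-- The roots of unity for the single divisors combine to `exp(πi h b D r σ(N) / 6)`, which is 1
because `D r σ(N) = 24`. -/
lemma siegelTerm_add_natCast (hp : p = 2 * h + 1) {D : ℕ}
    (hD : D * r * ∑ j ∈ N.divisors, j = 24) (x y : ℤ) (τ : ℂ) (b : ℕ) :
    siegelTerm N r p x y (τ + (D * b : ℕ)) = siegelTerm N r p x ((D * b : ℕ) * x + y) τ := by
  have h1 : ∀ j ∈ N.divisors, siegelProd p x (j * y) (j * (τ + (D * b : ℕ))) ^ r =
      cexp (Real.pi * I / 6 * h * b * D * r * j) *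
        siegelProd p x (j * ((D * b : ℕ) * x + y)) (j * τ) ^ r := by
    intro j _
    rw [show (j : ℂ) * (τ + (D * b : ℕ)) = j * τ + (j * (D * b) : ℕ) by push_cast; ring,
      siegelProd_add_natCast hp, mul_pow, ← Complex.exp_nat_mul]
    push_cast
    ring_nf
  have hD' : (D : ℂ) * r * ∑ j ∈ N.divisors, (j : ℂ) = 24 := by
    have := congrArg (Nat.cast : ℕ → ℂ) hD
    push_cast at this
    exact this
  rw [siegelTerm, Finset.prod_congr rfl h1, Finset.prod_mul_distrib, ← Complex.exp_sum,
    ← Finset.mul_sum, siegelTerm]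
  have : Real.pi * I / 6 * h * b * D * r * ∑ j ∈ N.divisors, (j : ℂ) =
      (2 * h * b : ℕ) * (2 * Real.pi * I) := by
    push_cast
    linear_combination (Real.pi * I / 6 * h * b) * hD'
  rw [this, Complex.exp_nat_mul_two_pi_mul_I, one_mul]

lemma eta_add_natCast (τ : ℂ) (n : ℕ) :
    ModularForm.eta (τ + n) = cexp (Real.pi * I / 12 * n) * ModularForm.eta τ := by
  induction n with
  | zero => simp
  | succ n ih =>
    rw [Nat.cast_succ, ← add_assoc, eta_add_one, ih, ← mul_assoc, ← Complex.exp_add]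
    ring_nf

lemma etaDivisors_add_natCast {D : ℕ} (hD : D * r * ∑ j ∈ N.divisors, j = 24) (τ : ℂ) (b : ℕ) :
    etaDivisors N r (τ + (D * b : ℕ)) = etaDivisors N r τ := by
  have h1 : ∀ j ∈ N.divisors, ModularForm.eta (j * (τ + (D * b : ℕ))) ^ r =
      cexp (Real.pi * I / 12 * b * D * r * j) * ModularForm.eta (j * τ) ^ r := by
    intro j _
    rw [show (j : ℂ) * (τ + (D * b : ℕ)) = j * τ + (j * (D * b) : ℕ) by push_cast; ring,
      eta_add_natCast, mul_pow, ← Complex.exp_nat_mul]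
    push_cast
    ring_nf
  have hD' : (D : ℂ) * r * ∑ j ∈ N.divisors, (j : ℂ) = 24 := by
    have := congrArg (Nat.cast : ℕ → ℂ) hD
    push_cast at this
    exact this
  rw [etaDivisors, Finset.prod_congr rfl h1, Finset.prod_mul_distrib, ← Complex.exp_sum,
    ← Finset.mul_sum, etaDivisors]
  have : Real.pi * I / 12 * b * D * r * ∑ j ∈ N.divisors, (j : ℂ) =
      (b : ℕ) * (2 * Real.pi * I) := by
    linear_combination (Real.pi * I / 12 * b) * hD'
  rw [this, Complex.exp_nat_mul_two_pi_mul_I, one_mul]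

/-- Either 3 divides `h(h + 1)`, or `p = 3`; in the second case 3 does not divide `D` and so divides
`r m`. -/
lemma three_dvd_of_coprime {D : ℕ} (hp : p = 2 * h + 1) (hpp : p.Prime) (hpD : ¬ p ∣ D) {m : ℕ}
    (hD : D * r * m = 24) : 3 ∣ m * r * (h * (h + 1)) := by
  rcases (by omega : h % 3 = 0 ∨ h % 3 = 2 ∨ h % 3 = 1) with h0 | h0 | h0
  · exact Dvd.dvd.mul_left (Dvd.dvd.mul_right (by omega) _) _
  · exact Dvd.dvd.mul_left (Dvd.dvd.mul_left (by omega) _) _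
  · have h3 : p = 3 := ((Nat.prime_dvd_prime_iff_eq Nat.prime_three hpp).mp (by omega)).symm
    have h4 : 3 ∣ D * (r * m) := by rw [← mul_assoc, hD]; norm_num
    rcases (Nat.Prime.dvd_mul Nat.prime_three).mp h4 with h5 | h5
    · exact absurd (h3 ▸ h5) hpD
    · rw [mul_comm m r]
      exact Dvd.dvd.mul_right h5 _

/-- The sum over the division points is the quotient of a Hecke translate of the eta-product by
the eta-product. -/
theorem exists_siegelSum_mul_etaDivisors [hpp : Fact p.Prime] (hp2 : p ≠ 2) (hN : N ≠ 0)
    (hrN : Even (r * N.divisors.card)) (hpN : ¬ p ∣ N) {D : ℕ} (hpD : ¬ p ∣ D)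
    (hD : D * r * ∑ j ∈ N.divisors, j = 24) :
    ∃ c₁ c₂ : ℂ, c₂ ≠ 0 ∧ ∀ τ : ℂ, 0 < τ.im → siegelSum N r p τ * etaDivisors N r τ =
      c₁ * etaDivisors N r (p * τ) +
        c₂ * ∑ b ∈ Finset.range p, etaDivisors N r ((τ + (D * b : ℕ)) / p) := by
  obtain ⟨h, hp⟩ := hpp.out.odd_of_ne_two hp2
  have h3 := three_dvd_of_coprime hp hpp.out hpD hD
  have hr : r ≠ 0 := by rintro rfl; simp at hD
  obtain ⟨c₁, _, h1⟩ := siegelTerm_zero_one (r := r) hp hpN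
  obtain ⟨c₂, hc₂, h2⟩ := siegelTerm_one_zero (N := N) (r := r) hp
  have hp1 : (p : ℂ) - 1 ≠ 0 := by
    rw [sub_ne_zero]; exact_mod_cast hpp.out.ne_one
  refine ⟨(p - 1) * c₁, (p - 1) * c₂, mul_ne_zero hp1 hc₂, fun τ hτ => ?_⟩
  -- The vector `(1, D b)` arises from `(1, 0)` by the translation `τ ↦ τ + D b`, which leaves the
  -- eta-product unchanged.
  have h4 : ∀ b ∈ Finset.range p, siegelTerm N r p 1 (D * b : ℕ) τ =
      c₂ * (etaDivisors N r ((τ + (D * b : ℕ)) / p) / etaDivisors N r τ) := by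
    intro b _
    have h5 := siegelTerm_add_natCast hp hD 1 0 τ b
    rw [mul_one, add_zero] at h5
    rw [← h5, h2 _ (by rw [add_im, natCast_im, add_zero]; exact hτ), etaDivisors_add_natCast hD]
  rw [siegelSum_eq hp h3 hN hr hrN hpD hτ, h1 τ hτ, Finset.sum_congr rfl h4, ← Finset.mul_sum,
    ← Finset.sum_div]
  have := etaDivisors_ne_zero N r hτ
  field_simp

/-- Every point is equivalent to one of bounded height under the Atkin–Lehner operators. -/
theorem exists_siegelSum_eq [hpp : Fact p.Prime] (hp2 : p ≠ 2) (hN : Squarefree N)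
    (hpN : ¬ p ∣ N) {D : ℕ} (hpD : ¬ p ∣ D) (hD : D * r * ∑ j ∈ N.divisors, j = 24)
    {τ : ℂ} (hτ : 0 < τ.im) :
    ∃ τ' : ℂ, 1 / (2 * N : ℝ) ≤ τ'.im ∧ siegelSum N r p τ' ^ 12 = siegelSum N r p τ ^ 12 := by
  obtain ⟨h, hp⟩ := hpp.out.odd_of_ne_two hp2
  have h3 := three_dvd_of_coprime hp hpp.out hpD hD
  obtain ⟨g, hg⟩ := ModularGroup.exists_one_half_le_im_smul ⟨τ, hτ⟩
  set t : UpperHalfPlane := g • ⟨τ, hτ⟩ with ht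
  have hτt : (⟨τ, hτ⟩ : UpperHalfPlane) = g⁻¹ • t := by rw [ht, inv_smul_smul]
  obtain ⟨a, b, c, d, hdet, hmob⟩ : ∃ a b c d : ℤ, a * d - b * c = 1 ∧
      τ = (a * t + b) / (c * t + d) := by
    refine ⟨g⁻¹ 0 0, g⁻¹ 0 1, g⁻¹ 1 0, g⁻¹ 1 1, ?_, ?_⟩
    · have := (g⁻¹).det_coe
      rwa [Matrix.det_fin_two] at this
    · have := congrArg UpperHalfPlane.coe hτt
      rw [UpperHalfPlane.coe_specialLinearGroup_apply] at this
      simpa using this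
  have hN0 := Nat.pos_of_ne_zero hN.ne_zero
  -- The reducing matrix is an Atkin–Lehner matrix for this `e` times the matrix with rows `(1, -β)`
  -- and `(0, e)`. Squarefreeness of `N` makes `e` prime to `c`, so that such a factorization exists
  -- at every cusp.
  set e := N / Int.gcd c N with he
  have hgN : Int.gcd c N ∣ N := Int.natCast_dvd_natCast.mp (Int.gcd_dvd_right c N)
  have heg : N = e * Int.gcd c N := (Nat.div_mul_cancel hgN).symm
  have heN : e ∣ N := Dvd.intro _ heg.symm
  have he0 : 0 < e := Nat.pos_of_dvd_of_pos heN hN0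
  have hNe : N / e = Int.gcd c N := Nat.div_eq_of_eq_mul_right he0 heg
  have hcop : IsCoprime (e * a : ℤ) c := by
    refine IsCoprime.mul_left ?_ ⟨d, -b, by linarith⟩
    rw [Int.isCoprime_iff_gcd_eq_one]
    have hsq : e.Coprime (Int.gcd c N) := by
      rw [heg, Nat.squarefree_mul_iff] at hN
      exact hN.1
    have : Int.gcd e c ∣ Int.gcd c N := by
      rw [Int.gcd_comm]
      exact Int.gcd_dvd_gcd_of_dvd_right _ (Int.natCast_dvd_natCast.mpr heN)
    exact Nat.eq_one_of_dvd_coprimes hsq (Int.gcd_dvd_natAbs_left e c) this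
  obtain ⟨w, y, hwy⟩ := hcop
  have hdet' : (e : ℤ) * a * w - (-y) * c = 1 := by linarith
  -- Solves `-aβ - y = b` and `-cβ + ew = d`, the equations of the factorization.
  set β : ℤ := -d * y - b * e * w with hβ
  have heC : (e : ℂ) ≠ 0 := by exact_mod_cast he0.ne'
  have htpos : 0 < ((t - β) / e : ℂ).im := by
    rw [Complex.div_natCast_im, sub_im, intCast_im, sub_zero]
    exact div_pos t.2 (by exact_mod_cast he0)
  have key := siegelSum_atkinLehner (r := r) hp h3 hN (Nat.mem_divisors.mpr ⟨heN, hN.ne_zero⟩) hpN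
    (hNe ▸ Int.gcd_dvd_left c N) hdet' htpos
  refine ⟨(t - β) / e, ?_, ?_⟩
  · rw [Complex.div_natCast_im, sub_im, intCast_im, sub_zero, div_le_div_iff₀ (by positivity)
      (by exact_mod_cast he0)]
    have h1 : (e : ℝ) ≤ N := by exact_mod_cast Nat.le_of_dvd hN0 heN
    have h2 : (1 / 2 : ℝ) ≤ t.im := hg
    have h3 : (t : ℂ).im = t.im := rfl
    rw [h3]
    have h4 : (0 : ℝ) < N := by exact_mod_cast hN0
    nlinarith
  · rw [← key]
    congr 2
    rw [hmob]
    have e1 : (e : ℂ) * a * ((t - β) / e) + ((-y : ℤ) : ℂ) = a * t + b := by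
      have hz : -(a * β) - y = b := by
        rw [hβ]; linear_combination y * hdet + b * hwy
      have hz' : -((a : ℂ) * β) - y = b := by exact_mod_cast congrArg (Int.cast : ℤ → ℂ) hz
      rw [← hz']
      field_simp
      push_cast
      ring
    have e2 : (e : ℂ) * c * ((t - β) / e) + e * w = c * t + d := by
      have hz : -(c * β) + e * w = d := by
        rw [hβ]; linear_combination (-e * w) * hdet + d * hwy
      have hz' : -((c : ℂ) * β) + e * w = d := by exact_mod_cast congrArg (Int.cast : ℤ → ℂ) hz
      rw [← hz']
      field_simp
      ring
    rw [e1, e2]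

lemma siegelSum_add_one [hpp : Fact p.Prime] (hp2 : p ≠ 2) (hN : Squarefree N)
    (hpN : ¬ p ∣ N) {D : ℕ} (hpD : ¬ p ∣ D) (hD : D * r * ∑ j ∈ N.divisors, j = 24)
    {τ : ℂ} (hτ : 0 < τ.im) : siegelSum N r p (τ + 1) ^ 12 = siegelSum N r p τ ^ 12 := by
  obtain ⟨h, hp⟩ := hpp.out.odd_of_ne_two hp2
  have h3 := three_dvd_of_coprime hp hpp.out hpD hD
  have := siegelSum_atkinLehner (r := r) hp h3 hN (Nat.one_mem_divisors.mpr hN.ne_zero) hpN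
    (dvd_zero _) (show ((1 : ℕ) : ℤ) * 1 * 1 - 1 * 0 = 1 by norm_num) hτ
  simpa using this

end

/-! ### Fourier expansions and the maximum principle -/

section FourierExpansion

variable {D : ℕ} {f : ℂ → ℂ} {a : ArithmeticFunction ℂ}

lemma HasFourierExpansion.summable_norm (hf : HasFourierExpansion D f a) {τ : ℂ} (hτ : 0 < τ.im) :
    Summable fun n : ℕ => ‖a n * cexp (2 * Real.pi * I * τ * ((n : ℂ) / (D : ℂ)))‖ :=
  (hf τ hτ).summable.norm

lemma norm_cexp_mul_div (τ : ℂ) (n D : ℕ) : ‖cexp (2 * Real.pi * I * τ * ((n : ℂ) / (D : ℂ)))‖ =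
    Real.exp (-(2 * Real.pi * τ.im * (n / D))) := by
  rw [Complex.norm_exp, show 2 * Real.pi * I * τ * ((n : ℂ) / (D : ℂ)) =
    ((2 * Real.pi * (n / D) : ℝ) : ℂ) * (I * τ) by push_cast; ring, Complex.re_ofReal_mul]
  congr 1
  simp
  ring

/-- The leading coefficient of a Fourier expansion as a limit. -/
lemma HasFourierExpansion.tendsto (hf : HasFourierExpansion D f a) (hD : 0 < D) (m : ℕ)
    (hm : ∀ n < m, a n = 0) :
    Tendsto (fun τ : ℂ => f τ * cexp (-(2 * Real.pi * I * τ * ((m : ℂ) / (D : ℂ)))))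
      (comap im atTop) (𝓝 (a m)) := by
  have hD' : (0 : ℝ) < D := by exact_mod_cast hD
  -- The terms at `τ = i`, rescaled, dominate all terms with `τ.im ≥ 1`.
  have hs := (hf.summable_norm (τ := I) (by simp)).mul_right (Real.exp (2 * Real.pi * (m / D)))
  have hev : ∀ᶠ τ : ℂ in comap im atTop, 1 ≤ τ.im := tendsto_comap.eventually_ge_atTop 1
  have key := tendsto_tsum_of_dominated_convergence (𝓕 := comap im atTop)
    (f := fun (τ : ℂ) (n : ℕ) => a n * cexp (2 * Real.pi * I * τ * ((n : ℂ) / (D : ℂ))) *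
      cexp (-(2 * Real.pi * I * τ * ((m : ℂ) / (D : ℂ)))))
    (g := fun n => if n = m then a m else 0) hs ?_ ?_
  · rw [tsum_ite_eq] at key
    refine key.congr' ?_
    filter_upwards [hev] with τ hτ
    rw [tsum_mul_right, (hf τ (by linarith)).tsum_eq]
  · intro n
    rcases lt_trichotomy n m with h | rfl | h
    · simpa [hm n h, h.ne] using tendsto_const_nhds
    · simp only [if_true]
      refine tendsto_const_nhds.congr fun τ => ?_
      rw [mul_assoc, ← Complex.exp_add, add_neg_cancel, Complex.exp_zero, mul_one]
    · rw [if_neg h.ne', tendsto_zero_iff_norm_tendsto_zero]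
      have h1 : Tendsto (fun τ : ℂ => ‖a n‖ * Real.exp (-(2 * Real.pi * ((n - m) / D) * τ.im)))
          (comap im atTop) (𝓝 (‖a n‖ * 0)) := by
        refine Tendsto.const_mul _ (Real.tendsto_exp_neg_atTop_nhds_zero.comp ?_)
        refine Tendsto.const_mul_atTop ?_ tendsto_comap
        have : (0 : ℝ) < n - m := by rw [sub_pos]; exact_mod_cast h
        positivity
      rw [mul_zero] at h1
      refine h1.congr fun τ => ?_
      rw [norm_mul, norm_mul, Complex.exp_neg, norm_inv, norm_cexp_mul_div, norm_cexp_mul_div,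
        mul_assoc ‖a n‖, ← Real.exp_neg, ← Real.exp_add]
      congr 2
      ring
  · filter_upwards [hev] with τ hτ n
    rcases lt_or_ge n m with h | h
    · simp [hm n h]
    · rw [norm_mul, norm_mul, norm_mul, Complex.exp_neg, norm_inv, norm_cexp_mul_div,
        norm_cexp_mul_div, norm_cexp_mul_div, mul_assoc ‖a n‖, mul_assoc ‖a n‖, ← Real.exp_neg,
        ← Real.exp_add, ← Real.exp_add, I_im]
      refine mul_le_mul_of_nonneg_left (Real.exp_le_exp.mpr ?_) (norm_nonneg _)
      have h1 : (0 : ℝ) ≤ n - m := by rw [sub_nonneg]; exact_mod_cast h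
      have h2 : 0 ≤ 2 * Real.pi * ((n - m) / D) * (τ.im - 1) :=
        mul_nonneg (by positivity) (by linarith)
      have h3 : 2 * Real.pi * ((n - m) / D) * (τ.im - 1) =
        (-(2 * Real.pi * 1 * (n / D)) + 2 * Real.pi * (m / D)) -
        (-(2 * Real.pi * τ.im * (n / D)) + - -(2 * Real.pi * τ.im * (m / D))) := by ring
      linarith

instance comap_im_atTop_neBot : (comap im atTop : Filter ℂ).NeBot :=
  comap_neBot_iff.mpr fun t ht => by
    obtain ⟨y, hy⟩ := Filter.nonempty_of_mem ht
    exact ⟨y * I, by simpa using hy⟩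

/-- The coefficients of a Fourier expansion are unique. -/
theorem HasFourierExpansion.unique {a' : ArithmeticFunction ℂ} (hD : 0 < D)
    (hf : HasFourierExpansion D f a) (hf' : HasFourierExpansion D f a') : a = a' := by
  have h0 : HasFourierExpansion D (fun _ => 0) (a - a') := fun τ hτ => by
    simpa [sub_eq_add_neg, add_mul] using (hf τ hτ).add (hf' τ hτ).neg
  have h1 : ∀ n, (a - a') n = 0 := by
    intro n
    induction n using Nat.strong_induction_on with
    | _ n ih =>
      refine tendsto_nhds_unique (h0.tendsto hD n ih) ?_
      simp
  exact sub_eq_zero.mp (ArithmeticFunction.ext h1)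

lemma HasFourierExpansion.const_mul (hf : HasFourierExpansion D f a) (c : ℂ) :
    HasFourierExpansion D (fun τ => c * f τ) (c • a) := fun τ hτ => by
  simpa [mul_assoc] using (hf τ hτ).mul_left c

end FourierExpansion

/-- A modular function that vanishes at infinity and takes every value at bounded height is
zero. -/
theorem eq_zero_of_tendsto_of_exists_im_ge {h : ℂ → ℂ}
    (hd : DifferentiableOn ℂ h UpperHalfPlane.upperHalfPlaneSet)
    (hper : ∀ τ : ℂ, 0 < τ.im → ‖h (τ + 1)‖ = ‖h τ‖) (h0 : Tendsto h (comap im atTop) (𝓝 0))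
    {δ : ℝ} (hδ : 0 < δ) (hrec : ∀ τ : ℂ, 0 < τ.im → ∃ τ' : ℂ, δ ≤ τ'.im ∧ ‖h τ'‖ = ‖h τ‖)
    {τ₀ : ℂ} (hτ₀ : 0 < τ₀.im) : h τ₀ = 0 := by
  by_contra hne
  have hε : 0 < ‖h τ₀‖ := norm_pos_iff.mpr hne
  have hev := (tendsto_zero_iff_norm_tendsto_zero.mp h0).eventually (gt_mem_nhds hε)
  rw [eventually_comap, eventually_atTop] at hev
  obtain ⟨Y, hY⟩ := hev
  -- Any value of modulus at least `‖h τ₀‖` has its modulus attained in this rectangle: `hrec` gives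
  -- the lower bound for the height, the limit at infinity the upper one, periodicity the width.
  -- Hence `‖h‖` has a global maximum, and constancy then contradicts the limit 0.
  let K : Set ℂ := Set.Icc 0 1 ×ℂ Set.Icc δ Y
  have hK : IsCompact K := isCompact_Icc.reProdIm isCompact_Icc
  have hKs : K ⊆ UpperHalfPlane.upperHalfPlaneSet := fun z hz => by
    have := (mem_reProdIm.mp hz).2.1
    exact lt_of_lt_of_le hδ this
  have hshift : ∀ (n : ℕ) (τ : ℂ), 0 < τ.im → ‖h (τ + n)‖ = ‖h τ‖ := by
    intro n τ hτ
    induction n with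
    | zero => simp
    | succ n ih => rw [Nat.cast_succ, ← add_assoc, hper _ (by simpa using hτ), ih]
  have hshift' : ∀ (n : ℤ) (τ : ℂ), 0 < τ.im → ‖h (τ + n)‖ = ‖h τ‖ := by
    intro n τ hτ
    obtain ⟨m, rfl | rfl⟩ := n.eq_nat_or_neg
    · simpa using hshift m τ hτ
    · have := hshift m (τ + (-(m : ℤ) : ℤ)) (by simpa using hτ)
      rw [← this]
      simp
  have hred : ∀ τ : ℂ, 0 < τ.im → ‖h τ₀‖ ≤ ‖h τ‖ → ∃ z ∈ K, ‖h z‖ = ‖h τ‖ := by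
    intro τ hτ hle
    obtain ⟨τ', h1, h2⟩ := hrec τ hτ
    refine ⟨τ' + (-⌊τ'.re⌋ : ℤ), ?_, ?_⟩
    · refine mem_reProdIm.mpr ⟨?_, ?_⟩
      · have := Int.floor_le τ'.re
        have := Int.lt_floor_add_one τ'.re
        rw [add_re, intCast_re]
        push_cast
        exact ⟨by linarith, by linarith⟩
      · rw [add_im, intCast_im, add_zero]
        refine ⟨h1, ?_⟩
        by_contra hlt
        have := hY τ'.im (not_le.mp hlt).le τ' rfl
        linarith
    · rw [hshift' _ _ (lt_of_lt_of_le hδ h1), h2]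
  obtain ⟨z₁, hz₁, hz₁'⟩ := hred τ₀ hτ₀ le_rfl
  obtain ⟨z, hz, hmax⟩ := hK.exists_isMaxOn ⟨z₁, hz₁⟩ (hd.continuousOn.mono hKs).norm
  have hz0 : ‖h τ₀‖ ≤ ‖h z‖ := hz₁' ▸ hmax hz₁
  have hmax' : IsMaxOn (norm ∘ h) UpperHalfPlane.upperHalfPlaneSet z := by
    intro τ hτ
    rcases lt_or_ge ‖h τ‖ ‖h τ₀‖ with hlt | hge
    · exact (hlt.trans_le hz0).le
    · obtain ⟨w, hw, hw'⟩ := hred τ hτ hge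
      change ‖h τ‖ ≤ ‖h z‖
      exact hw' ▸ hmax hw
  have hconst := Complex.eqOn_of_isPreconnected_of_isMaxOn_norm
    (Convex.isPreconnected (convex_halfSpace_im_gt 0)) UpperHalfPlane.isOpen_upperHalfPlaneSet
    hd (hKs hz) hmax'
  have hpos : 0 < (((max Y 1 : ℝ) : ℂ) * I).im := by
    simp
  have h5 := hY _ (le_max_left Y 1) (((max Y 1 : ℝ) : ℂ) * I) (by simp)
  have h6 : h (((max Y 1 : ℝ) : ℂ) * I) = h z := hconst hpos
  rw [h6] at h5
  linarith

/-- A holomorphic function on the upper half-plane whose `n`-th power is constant and which has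
a limit at infinity is constant. -/
lemma eq_of_pow_eq_of_tendsto {h : ℂ → ℂ} {c : ℂ} {n : ℕ} (hn : n ≠ 0)
    (hd : DifferentiableOn ℂ h UpperHalfPlane.upperHalfPlaneSet)
    (h0 : Tendsto h (comap im atTop) (𝓝 c)) (hpow : ∀ τ : ℂ, 0 < τ.im → h τ ^ n = c ^ n)
    {τ : ℂ} (hτ : 0 < τ.im) : h τ = c := by
  have hnorm : ∀ τ : ℂ, 0 < τ.im → ‖h τ‖ = ‖c‖ := fun τ hτ => by
    have := congrArg norm (hpow τ hτ)
    rwa [norm_pow, norm_pow, pow_left_inj₀ (norm_nonneg _) (norm_nonneg _) hn] at this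
  have hmax : IsMaxOn (norm ∘ h) UpperHalfPlane.upperHalfPlaneSet τ := fun z hz => by
    change ‖h z‖ ≤ ‖h τ‖
    rw [hnorm z hz, hnorm τ hτ]
  have hconst := Complex.eqOn_of_isPreconnected_of_isMaxOn_norm
    (Convex.isPreconnected (convex_halfSpace_im_gt 0)) UpperHalfPlane.isOpen_upperHalfPlaneSet
    hd hτ hmax
  refine tendsto_nhds_unique (tendsto_const_nhds.congr' ?_) h0
  filter_upwards [tendsto_comap.eventually_gt_atTop 0] with z hz
  exact (hconst hz).symm

/-! ### Integral `q`-expansions of eta-products -/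

section QExpansion

/-- `F(τ) = ∑ fₙ qⁿ` on the upper half-plane. -/
def HasQExpansion (f : PowerSeries ℤ) (F : ℂ → ℂ) : Prop :=
  ∀ τ : ℂ, 0 < τ.im →
    HasSum (fun n : ℕ => ((PowerSeries.coeff n f : ℤ) : ℂ) * cexp (2 * Real.pi * I * τ * n)) (F τ)

/-- The power series `f(X^j)`. -/
noncomputable def PowerSeries.dilate (j : ℕ) (f : PowerSeries ℤ) : PowerSeries ℤ :=
  PowerSeries.mk fun n => if j ∣ n then PowerSeries.coeff (n / j) f else 0

variable {f g : PowerSeries ℤ} {F G : ℂ → ℂ}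

lemma hasQExpansion_one : HasQExpansion 1 (fun _ => 1) := fun τ _ => by
  convert hasSum_ite_eq (0 : ℕ) (1 : ℂ) using 2 with n
  rw [PowerSeries.coeff_one]
  split_ifs with h <;> simp [h]

lemma HasQExpansion.mul (hf : HasQExpansion f F) (hg : HasQExpansion g G) :
    HasQExpansion (f * g) (fun τ => F τ * G τ) := fun τ hτ => by
  have h1 := hf τ hτ
  have h2 := hg τ hτ
  have hs := summable_norm_sum_mul_antidiagonal_of_summable_norm h1.summable.norm
    h2.summable.norm
  have ht := tsum_mul_tsum_eq_tsum_sum_antidiagonal_of_summable_norm h1.summable.norm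
    h2.summable.norm
  rw [h1.tsum_eq, h2.tsum_eq] at ht
  change HasSum _ (F τ * G τ)
  rw [ht]
  refine hs.of_norm.hasSum.congr_fun fun n => ?_
  rw [PowerSeries.coeff_mul, Int.cast_sum, Finset.sum_mul]
  refine Finset.sum_congr rfl fun x hx => ?_
  rw [← Finset.HasAntidiagonal.mem_antidiagonal.mp hx]
  push_cast
  rw [mul_add, Complex.exp_add]
  ring

lemma HasQExpansion.dilate (hf : HasQExpansion f F) {j : ℕ} (hj : 0 < j) :
    HasQExpansion (f.dilate j) (fun τ => F (j * τ)) := fun τ hτ => by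
  have h1 := hf (j * τ) (im_natCast_mul_pos hj hτ)
  have hinj : Function.Injective fun n : ℕ => j * n := fun a b h => Nat.eq_of_mul_eq_mul_left hj h
  refine (hinj.hasSum_iff (f := fun n : ℕ =>
    ((PowerSeries.coeff n (f.dilate j) : ℤ) : ℂ) * cexp (2 * Real.pi * I * τ * n)) ?_).mp ?_
  · intro n hn
    have : ¬ j ∣ n := fun ⟨k, hk⟩ => hn ⟨k, hk.symm⟩
    simp [PowerSeries.dilate, this]
  · convert h1 using 2 with n
    simp only [PowerSeries.dilate, PowerSeries.coeff_mk, Function.comp_apply, dvd_mul_right,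
      if_true, Nat.mul_div_cancel_left _ hj]
    push_cast
    ring_nf

/-- The even character modulo `12` with `χ(5) = χ(7) = -1`. -/
def chiTwelve (x : ZMod 12) : ℤ :=
  if x = 1 ∨ x = 11 then 1 else if x = 5 ∨ x = 7 then -1 else 0

lemma chiTwelve_mul (x y : ZMod 12) : chiTwelve (x * y) = chiTwelve x * chiTwelve y := by
  revert x y
  decide

/-- The map `m ↦ |6m + 1|` runs once through the numbers prime to 6 and turns `(-1)^m` into the
character. -/
lemma hasSum_eta_chiTwelve {τ : ℂ} (hτ : 0 < τ.im) :
    HasSum (fun l : ℕ => (chiTwelve l : ℂ) * cexp (2 * Real.pi * I * τ * ((l ^ 2 : ℕ) / 24)))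
      (ModularForm.eta τ) := by
  have hinj : Function.Injective fun m : ℤ => (6 * m + 1).natAbs := fun a b h => by
    simp only at h
    omega
  refine (hinj.hasSum_iff ?_).mp ?_
  · intro l hl
    have : (chiTwelve l : ℤ) = 0 := by
      by_contra hne
      apply hl
      have h1 : (l : ZMod 12) = ((l % 12 : ℕ) : ZMod 12) := by simp
      rw [h1] at hne
      have h2 : l % 12 < 12 := Nat.mod_lt _ (by norm_num)
      have h3 : l % 12 = 1 ∨ l % 12 = 5 ∨ l % 12 = 7 ∨ l % 12 = 11 := by
        generalize l % 12 = r at hne h2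
        interval_cases r <;> revert hne <;> decide
      by_cases h4 : l % 6 = 1
      · exact ⟨(l / 6 : ℕ), by simp only; omega⟩
      · exact ⟨-((l / 6 : ℕ) + 1), by simp only; omega⟩
    simp [this]
  · convert hasSum_eta hτ using 2 with m
    simp only [Function.comp_apply]
    congr 1
    · have h1 : (((6 * m + 1).natAbs : ℕ) : ZMod 12) = 6 * m + 1 ∨
          (((6 * m + 1).natAbs : ℕ) : ZMod 12) = -(6 * m + 1) := by
        rcases Int.natAbs_eq (6 * m + 1) with h | h
        · left
          have := congrArg (Int.cast : ℤ → ZMod 12) h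
          push_cast [-Int.natCast_natAbs] at this
          rw [this]
        · right
          have := congrArg (Int.cast : ℤ → ZMod 12) h
          push_cast [-Int.natCast_natAbs] at this
          rw [this, neg_neg]
      rcases Int.even_or_odd' m with ⟨k, rfl | rfl⟩
      · have h2 : (6 * ((2 * k : ℤ) : ZMod 12) + 1) = 1 := by
          push_cast
          rw [← mul_assoc, show (6 * 2 : ZMod 12) = 0 by decide]
          simp
        rw [h2] at h1
        have h3 : chiTwelve ((6 * (2 * k) + 1).natAbs : ℕ) = 1 := by
          rcases h1 with h | h <;> rw [h] <;> decide
        rw [h3, zpow_mul]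
        simp
      · have h2 : (6 * ((2 * k + 1 : ℤ) : ZMod 12) + 1) = 7 := by
          push_cast
          rw [mul_add, ← mul_assoc, show (6 * 2 : ZMod 12) = 0 by decide, zero_mul]
          decide
        rw [h2] at h1
        have h3 : chiTwelve ((6 * (2 * k + 1) + 1).natAbs : ℕ) = -1 := by
          rcases h1 with h | h <;> rw [h] <;> decide
        rw [h3, zpow_add₀ (by norm_num), zpow_mul]
        simp
    · congr 1
      have : (((6 * m + 1).natAbs ^ 2 : ℕ) : ℂ) = (((6 * m + 1) ^ 2 : ℤ) : ℂ) := by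
        rw [← Int.natAbs_sq (6 * m + 1), ← Nat.cast_pow, Int.cast_natCast]
      rw [this]
      ring

/-- The power series `∏ (1 - Xⁿ)`, written out by the pentagonal number theorem. -/
noncomputable def eulerSeries : PowerSeries ℤ :=
  PowerSeries.mk fun n => ∑ l ∈ Finset.range (24 * n + 2),
    if l ^ 2 = 24 * n + 1 then chiTwelve l else 0

/-- The terms are grouped by `n = (l² - 1)/24`. Where 24 does not divide `l² - 1`, the character is
zero, and `l ≤ l²` shows that the finite range in `eulerSeries` misses nothing. -/
lemma hasQExpansion_eulerSeries :
    HasQExpansion eulerSeries fun τ => cexp (-(2 * Real.pi * I * τ / 24)) * ModularForm.eta τ := by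
  intro τ hτ
  have h1 := (hasSum_eta_chiTwelve hτ).mul_left (cexp (-(2 * Real.pi * I * τ / 24)))
  set c := cexp (-(2 * Real.pi * I * τ / 24)) with hc
  let t : ℕ → ℂ := fun l =>
    c * ((chiTwelve l : ℂ) * cexp (2 * Real.pi * I * τ * ((l ^ 2 : ℕ) / 24)))
  let u : ℕ × ℕ → ℂ := fun x => if x.2 ^ 2 = 24 * x.1 + 1 then t x.2 else 0
  have hinj : Function.Injective fun l : ℕ => ((l ^ 2 - 1) / 24, l) := fun a b h =>
    (Prod.ext_iff.mp h).2
  have h2 : HasSum u (c * ModularForm.eta τ) := by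
    refine (hinj.hasSum_iff ?_).mp ?_
    · rintro ⟨n, l⟩ hn
      refine if_neg fun h => hn ⟨l, ?_⟩
      have h' : l ^ 2 = 24 * n + 1 := h
      simp [h']
    · refine h1.congr_fun fun l => ?_
      simp only [Function.comp_apply, u]
      split_ifs with h
      · rfl
      · have h0 : chiTwelve l = 0 := by
          have h3 : (l : ZMod 12) = ((l % 12 : ℕ) : ZMod 12) := by simp
          have h4 : l % 12 < 12 := Nat.mod_lt _ (by norm_num)
          have h5 : ¬ l ^ 2 % 24 = 1 := by omega
          have h6 : l % 12 ≠ 1 ∧ l % 12 ≠ 5 ∧ l % 12 ≠ 7 ∧ l % 12 ≠ 11 := by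
            have : l % 24 < 24 := Nat.mod_lt _ (by norm_num)
            rw [Nat.pow_mod] at h5
            have h7 : l % 12 = l % 24 % 12 := by omega
            rw [h7]
            generalize l % 24 = r at h5 this
            interval_cases r <;> revert h5 <;> decide
          rw [h3]
          generalize l % 12 = r at h4 h6
          interval_cases r <;> revert h6 <;> decide
        rw [h0]
        simp
  convert h2.prod_fiberwise (g := fun n => ∑ l ∈ Finset.range (24 * n + 2), u (n, l)) ?_
    using 2 with n
  · rw [eulerSeries, PowerSeries.coeff_mk, Int.cast_sum, Finset.sum_mul]
    refine Finset.sum_congr rfl fun l _ => ?_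
    simp only [u, t]
    split_ifs with h
    · rw [h, hc, mul_left_comm, ← Complex.exp_add]
      push_cast
      ring_nf
    · simp
  · intro n
    refine hasSum_sum_of_ne_finset_zero fun l hl => if_neg fun h => hl ?_
    simp only at h
    rw [Finset.mem_range]
    nlinarith

/-- The `q`-expansion of an eta-product without the leading power of `q`. -/
noncomputable def etaSeries (s : Multiset ℕ) : PowerSeries ℤ :=
  (s.map fun j => eulerSeries.dilate j).prod

lemma etaProduct_eq (s : Multiset ℕ) (τ : ℂ) :
    etaProduct s τ = (s.map fun j : ℕ => ModularForm.eta (j * τ)).prod := by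
  simp only [etaProduct, Multiset.pure_def, Multiset.bind_def, Multiset.bind_singleton,
    Multiset.map_map, Function.comp_def]

lemma etaProduct_cons (j : ℕ) (s : Multiset ℕ) (τ : ℂ) :
    etaProduct (j ::ₘ s) τ = ModularForm.eta (j * τ) * etaProduct s τ := by
  simp [etaProduct_eq]

lemma hasQExpansion_etaSeries {s : Multiset ℕ} (hs : ∀ j ∈ s, 0 < j) :
    HasQExpansion (etaSeries s)
      fun τ => cexp (-(2 * Real.pi * I * τ * s.sum / 24)) * etaProduct s τ := by
  induction s using Multiset.induction with
  | empty => simpa [etaSeries, etaProduct] using hasQExpansion_one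
  | cons j s ih =>
    have h1 := (hasQExpansion_eulerSeries.dilate (hs j (Multiset.mem_cons_self j s))).mul
      (ih fun i hi => hs i (Multiset.mem_cons_of_mem hi))
    convert h1 using 2 with τ
    · simp [etaSeries]
    · have : -(2 * Real.pi * I * τ * ((j ::ₘ s).sum : ℕ) / 24) =
        -(2 * Real.pi * I * (j * τ) / 24) + -(2 * Real.pi * I * τ * s.sum / 24) := by
        rw [Multiset.sum_cons]
        push_cast
        ring
      rw [this, Complex.exp_add]
      rw [etaProduct_cons]
      ring

/-- The Fourier coefficients of the eta-product of a partition of `24 / D`, in powers of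
`q^(1/D)`. -/
noncomputable def etaCoeff (D : ℕ) (s : Multiset ℕ) : ArithmeticFunction ℂ where
  toFun n := if n = 0 then 0 else
    if D ∣ n - 1 then ((PowerSeries.coeff ((n - 1) / D) (etaSeries s) : ℤ) : ℂ) else 0
  map_zero' := if_pos rfl

lemma etaCoeff_mul_add_one {D : ℕ} (hD : 0 < D) (s : Multiset ℕ) (k : ℕ) :
    etaCoeff D s (D * k + 1) = ((PowerSeries.coeff k (etaSeries s) : ℤ) : ℂ) := by
  simp [etaCoeff, Nat.mul_div_cancel_left _ hD]

lemma etaCoeff_eq_zero {D n : ℕ} (s : Multiset ℕ) (h : ∀ k, n ≠ D * k + 1) :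
    etaCoeff D s n = 0 := by
  rcases Nat.eq_zero_or_pos n with rfl | hn
  · simp
  · refine (if_neg hn.ne').trans (if_neg ?_)
    rintro ⟨k, hk⟩
    exact h k (by omega)

lemma hasFourierExpansion_etaProduct {D : ℕ} {s : Multiset ℕ} (hs : ∀ j ∈ s, 0 < j)
    (hD : D * s.sum = 24) : HasFourierExpansion D (etaProduct s) (etaCoeff D s) := by
  intro τ hτ
  have hD0 : 0 < D := Nat.pos_of_ne_zero fun h => by simp [h] at hD
  have hinj : Function.Injective fun k : ℕ => D * k + 1 := fun a b h =>
    Nat.eq_of_mul_eq_mul_left hD0 (by simpa using h)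
  refine (hinj.hasSum_iff ?_).mp ?_
  · intro n hn
    rw [etaCoeff_eq_zero s fun k hk => hn ⟨k, hk.symm⟩, zero_mul]
  · have h1 := (hasQExpansion_etaSeries hs τ hτ).mul_left
      (cexp (2 * Real.pi * I * τ * s.sum / 24))
    rw [← mul_assoc, ← Complex.exp_add, add_neg_cancel, Complex.exp_zero, one_mul] at h1
    refine h1.congr_fun fun k => ?_
    have h24 : (D : ℂ) * s.sum = 24 := by exact_mod_cast congrArg (Nat.cast : ℕ → ℂ) hD
    have hD' : (D : ℂ) ≠ 0 := by exact_mod_cast hD0.ne'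
    have hs' : (s.sum : ℂ) / 24 = 1 / D := by
      rw [← h24]
      have : (s.sum : ℂ) ≠ 0 := fun h => by simp [h] at h24
      field_simp
    rw [Function.comp_apply, etaCoeff_mul_add_one hD0, mul_left_comm, ← Complex.exp_add,
      mul_div_assoc, hs']
    congr 2
    push_cast
    field_simp
    ring

end QExpansion

/-! ### Hecke operators and the eigenform property -/

section Hecke

/-- The action of a Hecke operator on Fourier coefficients. -/
noncomputable def heckeCoeff (p : ℕ) (c₁ c₂ : ℂ) (a : ArithmeticFunction ℂ) :
    ArithmeticFunction ℂ where
  toFun n := c₁ * (if p ∣ n then a (n / p) else 0) + c₂ * (p * a (p * n))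
  map_zero' := by simp

lemma sum_cexp_mul_div {p : ℕ} (hp : 0 < p) (n : ℕ) :
    ∑ b ∈ Finset.range p, cexp (2 * Real.pi * I * (n * b / p)) = if p ∣ n then (p : ℂ) else 0 := by
  have hp' : (p : ℂ) ≠ 0 := by exact_mod_cast hp.ne'
  have hζ := Complex.isPrimitiveRoot_exp p hp.ne'
  set ζ := cexp (2 * Real.pi * I / p) with hζ'
  have h1 : ∀ b : ℕ, cexp (2 * Real.pi * I * (n * b / p)) = (ζ ^ n) ^ b := fun b => by
    rw [hζ', ← Complex.exp_nat_mul, ← Complex.exp_nat_mul]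
    ring_nf
  simp_rw [h1]
  split_ifs with h
  · rw [(hζ.pow_eq_one_iff_dvd n).mpr h]
    simp
  · have h2 : ζ ^ n - 1 ≠ 0 := sub_ne_zero.mpr fun h2 => h ((hζ.pow_eq_one_iff_dvd n).mp h2)
    have h3 := geom_sum_mul (ζ ^ n) p
    rw [← pow_mul, mul_comm n p, pow_mul, hζ.pow_eq_one, one_pow, sub_self] at h3
    exact (mul_eq_zero.mp h3).resolve_right h2

lemma HasFourierExpansion.hecke {D : ℕ} {f : ℂ → ℂ} {a : ArithmeticFunction ℂ}
    (hf : HasFourierExpansion D f a) (hD : 0 < D) {p : ℕ} (hp : 0 < p) (c₁ c₂ : ℂ) :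
    HasFourierExpansion D (fun τ => c₁ * f (p * τ) +
      c₂ * ∑ b ∈ Finset.range p, f ((τ + (D * b : ℕ)) / p)) (heckeCoeff p c₁ c₂ a) := by
  intro τ hτ
  have hp' : (p : ℂ) ≠ 0 := by exact_mod_cast hp.ne'
  have hD' : (D : ℂ) ≠ 0 := by exact_mod_cast hD.ne'
  have hinj : Function.Injective fun n : ℕ => p * n := fun a b h => Nat.eq_of_mul_eq_mul_left hp h
  have h1 : HasSum (fun n : ℕ => (if p ∣ n then a (n / p) else 0) *
      cexp (2 * Real.pi * I * τ * ((n : ℂ) / (D : ℂ)))) (f (p * τ)) := by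
    refine (hinj.hasSum_iff ?_).mp ?_
    · intro n hn
      have : ¬ p ∣ n := fun ⟨k, hk⟩ => hn ⟨k, hk.symm⟩
      simp [this]
    · refine (hf _ (im_natCast_mul_pos hp hτ)).congr_fun fun n => ?_
      rw [Function.comp_apply, if_pos (dvd_mul_right p n), Nat.mul_div_cancel_left n hp]
      push_cast
      ring_nf
  have h2 : HasSum (fun n : ℕ => p * a (p * n) *
      cexp (2 * Real.pi * I * τ * ((n : ℂ) / (D : ℂ))))
      (∑ b ∈ Finset.range p, f ((τ + (D * b : ℕ)) / p)) := by
    have him : ∀ b : ℕ, 0 < ((τ + (D * b : ℕ)) / (p : ℂ)).im := fun b => by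
      rw [Complex.div_natCast_im, add_im, natCast_im, add_zero]
      exact div_pos hτ (by exact_mod_cast hp)
    have h3 := hasSum_sum fun b (_ : b ∈ Finset.range p) => hf _ (him b)
    have h4 : HasSum (fun n : ℕ => a n * cexp (2 * Real.pi * I * τ * ((n : ℂ) / (D * p : ℂ))) *
        if p ∣ n then (p : ℂ) else 0)
        (∑ b ∈ Finset.range p, f ((τ + (D * b : ℕ)) / p)) := by
      refine h3.congr_fun fun n => ?_
      rw [← sum_cexp_mul_div hp, Finset.mul_sum]
      refine Finset.sum_congr rfl fun b _ => ?_
      rw [mul_assoc, ← Complex.exp_add]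
      congr 2
      push_cast
      field_simp
    refine ((hinj.hasSum_iff ?_).mpr h4).congr_fun fun n => ?_
    · intro n hn
      have : ¬ p ∣ n := fun ⟨k, hk⟩ => hn ⟨k, hk.symm⟩
      simp [this]
    · have : (((p * n : ℕ) : ℂ) / (D * p)) = n / D := by
        push_cast
        field_simp
      rw [Function.comp_apply, if_pos (dvd_mul_right p n), this]
      ring
  refine ((h1.mul_left c₁).add (h2.mul_left c₂)).congr_fun fun n => ?_
  change (c₁ * (if p ∣ n then a (n / p) else 0) + c₂ * (p * a (p * n))) * _ = _
  ring

lemma differentiableOn_etaDivisors (N r : ℕ) :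
    DifferentiableOn ℂ (etaDivisors N r) UpperHalfPlane.upperHalfPlaneSet := by
  unfold etaDivisors
  refine DifferentiableOn.fun_finsetProd fun j hj => DifferentiableOn.pow ?_ _
  intro τ hτ
  have h1 := ModularForm.differentiableAt_eta_of_mem_upperHalfPlaneSet
    (im_natCast_mul_pos (Nat.pos_of_mem_divisors hj) hτ)
  exact (h1.comp τ (differentiableAt_id.const_mul (j : ℂ))).differentiableWithinAt

variable {N r D : ℕ} {a : ArithmeticFunction ℂ}

/-- The quotient `H / G` is `siegelSum`. Its twelfth power minus the limit at infinity vanishes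
there, and its moduli all recur at height at least `1/(2N)`, so it is zero; then `H / G` itself is
constant. The recursion is the comparison of coefficients, and the value of `κ` plays no role later.
-/
theorem hecke_eigenform (hN : Squarefree N) (hrN : Even (r * N.divisors.card))
    (hD : D * r * ∑ j ∈ N.divisors, j = 24) (ha : HasFourierExpansion D (etaDivisors N r) a)
    (ha1 : a 1 = 1) {p : ℕ} (hp : p.Prime) (hp2 : p ≠ 2) (hpN : ¬ p ∣ N) (hpD : ¬ p ∣ D) :
    ∃ κ : ℂ, ∀ n, a (p * n) + κ * (if p ∣ n then a (n / p) else 0) = a p * a n := by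
  have : Fact p.Prime := ⟨hp⟩
  have hD0 : 0 < D := Nat.pos_of_ne_zero fun h => by simp [h] at hD
  obtain ⟨c₁, c₂, hc₂, hsum⟩ := exists_siegelSum_mul_etaDivisors hp2 hN.ne_zero hrN hpN hpD hD
  have hH := ha.hecke hD0 hp.pos c₁ c₂
  set G := etaDivisors N r with hG
  set H : ℂ → ℂ := fun τ => c₁ * G (p * τ) +
      c₂ * ∑ b ∈ Finset.range p, G ((τ + (D * b : ℕ)) / p) with hHdef
  set b := heckeCoeff p c₁ c₂ a with hb
  have hG0 : ∀ τ : ℂ, 0 < τ.im → G τ ≠ 0 := fun τ hτ => etaDivisors_ne_zero N r hτ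
  have hF : ∀ τ : ℂ, 0 < τ.im → H τ / G τ = siegelSum N r p τ := fun τ hτ => by
    rw [div_eq_iff (hG0 τ hτ), hsum τ hτ]
  have hGd : DifferentiableOn ℂ G UpperHalfPlane.upperHalfPlaneSet :=
    differentiableOn_etaDivisors N r
  have hHd : DifferentiableOn ℂ H UpperHalfPlane.upperHalfPlaneSet := by
    refine DifferentiableOn.add (DifferentiableOn.const_mul (hGd.comp ?_ ?_) _)
      (DifferentiableOn.const_mul (DifferentiableOn.fun_sum fun k _ => hGd.comp ?_ ?_) _)
    · fun_prop
    · exact fun τ hτ => im_natCast_mul_pos hp.pos hτ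
    · fun_prop
    · intro τ hτ
      change 0 < ((τ + (D * k : ℕ)) / (p : ℂ)).im
      rw [Complex.div_natCast_im, add_im, natCast_im, add_zero]
      exact div_pos hτ (by exact_mod_cast hp.pos)
  have hFd : DifferentiableOn ℂ (fun τ => H τ / G τ) UpperHalfPlane.upperHalfPlaneSet :=
    hHd.div hGd fun τ hτ => hG0 τ hτ
  -- Neither expansion has a term below `q^(1/D)`, and that of `G` has coefficient 1 there.
  have hlim : Tendsto (fun τ => H τ / G τ) (comap im atTop) (𝓝 (b 1)) := by
    have h1 := (hH.tendsto hD0 1 (by simp)).div (ha.tendsto hD0 1 (by simp)) (by simp [ha1])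
    rw [ha1, div_one] at h1
    refine h1.congr fun τ => ?_
    exact mul_div_mul_right _ _ (Complex.exp_ne_zero _)
  have hpow : ∀ τ : ℂ, 0 < τ.im → (H τ / G τ) ^ 12 = b 1 ^ 12 := by
    intro τ hτ
    have hδ : (0 : ℝ) < 1 / (2 * N) := by
      have : (0 : ℝ) < N := by exact_mod_cast hN.ne_zero.bot_lt
      positivity
    refine sub_eq_zero.mp (eq_zero_of_tendsto_of_exists_im_ge
      (h := fun τ => (H τ / G τ) ^ 12 - b 1 ^ 12) ?_ ?_ ?_ hδ ?_ hτ)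
    · exact (hFd.pow 12).sub_const _
    · intro τ hτ
      rw [hF _ (by simpa using hτ), hF τ hτ, siegelSum_add_one hp2 hN hpN hpD hD hτ]
    · have := (hlim.pow 12).sub_const (b 1 ^ 12)
      rwa [sub_self] at this
    · intro τ hτ
      obtain ⟨τ', h1, h2⟩ := exists_siegelSum_eq hp2 hN hpN hpD hD hτ
      refine ⟨τ', h1, ?_⟩
      rw [hF _ (hδ.trans_le h1), hF τ hτ, h2]
  have heq : ∀ τ : ℂ, 0 < τ.im → H τ = b 1 * G τ := fun τ hτ => by
    rw [← eq_of_pow_eq_of_tendsto (by norm_num : (12 : ℕ) ≠ 0) hFd hlim hpow hτ,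
      div_mul_cancel₀ _ (hG0 τ hτ)]
  have hcoeff : b = b 1 • a := by
    refine hH.unique hD0 (f := H) fun τ hτ => ?_
    rw [heq τ hτ]
    exact ha.const_mul (b 1) τ hτ
  have hp0 : (p : ℂ) ≠ 0 := by exact_mod_cast hp.ne_zero
  have hb1 : b 1 = c₂ * (p * a p) := by
    change c₁ * (if p ∣ 1 then a (1 / p) else 0) + c₂ * (p * a (p * 1)) = _
    rw [if_neg hp.not_dvd_one, mul_zero, zero_add, mul_one]
  refine ⟨c₁ / (c₂ * p), fun n => ?_⟩
  have h1 : c₁ * (if p ∣ n then a (n / p) else 0) + c₂ * (p * a (p * n)) = b 1 * a n := by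
    have := congrArg (fun f : ArithmeticFunction ℂ => f n) hcoeff
    exact this
  rw [hb1] at h1
  field_simp
  linear_combination h1

end Hecke

/-! ### Multiplicativity of the coefficients -/

section Multiplicative

variable {a : ArithmeticFunction ℂ}

lemma apply_prime_pow_mul (ha1 : a 1 = 1) {p : ℕ} (hp : p.Prime) {κ : ℂ}
    (h : ∀ n, a (p * n) + κ * (if p ∣ n then a (n / p) else 0) = a p * a n) (f : ℕ) {m : ℕ}
    (hm : ¬ p ∣ m) : a (p ^ f * m) = a (p ^ f) * a m := by
  induction f using Nat.twoStepInduction with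
  | zero => simp [ha1]
  | one => simpa [hm] using h m
  | more f ih1 ih2 =>
    have h1 := h (p ^ (f + 1) * m)
    have h2 := h (p ^ (f + 1))
    have e1 : p ^ (f + 1) * m / p = p ^ f * m := by
      rw [pow_succ', mul_assoc, Nat.mul_div_cancel_left _ hp.pos]
    have e2 : p ^ (f + 1) / p = p ^ f := by rw [pow_succ', Nat.mul_div_cancel_left _ hp.pos]
    rw [if_pos ((dvd_pow_self p (Nat.succ_ne_zero f)).mul_right m), e1, ← mul_assoc,
      ← pow_succ'] at h1
    rw [if_pos (dvd_pow_self p (Nat.succ_ne_zero f)), e2, ← pow_succ'] at h2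
    linear_combination h1 - a m * h2 + a p * ih2 - κ * ih1

/-- Of two coprime numbers at least one is prime to `q`, and this one is split off one prime power
at a time. So nothing needs to be known at the prime `q`. -/
lemma apply_mul_of_primes (ha1 : a 1 = 1) {q : ℕ} (hq1 : q ≠ 1)
    (h : ∀ p : ℕ, p.Prime → p ≠ q → ∀ f m : ℕ, ¬ p ∣ m → a (p ^ f * m) = a (p ^ f) * a m)
    (m n : ℕ) (hmn : m.Coprime n) : a (m * n) = a m * a n := by
  have key : ∀ m : ℕ, ¬ q ∣ m → ∀ n, m.Coprime n → a (m * n) = a m * a n := by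
    intro m
    induction m using Nat.recOnPosPrimePosCoprime with
    | zero => simp
    | one => simp [ha1]
    | prime_pow p k hp hk =>
      intro hq n hpn
      refine h p hp ?_ k n fun hd => ?_
      · rintro rfl
        exact hq (dvd_pow_self p hk.ne')
      · exact hp.not_dvd_one
          (hpn ▸ Nat.dvd_gcd (dvd_pow_self p hk.ne') hd)
    | coprime x y hx hy hxy ihx ihy =>
      intro hq n hn
      have h1 := Nat.Coprime.coprime_mul_right hn
      have h2 := Nat.Coprime.coprime_mul_left hn
      have hqx : ¬ q ∣ x := fun hd => hq (hd.mul_right y)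
      have hqy : ¬ q ∣ y := fun hd => hq (hd.mul_left x)
      rw [mul_assoc, ihx hqx _ (Nat.Coprime.mul_right hxy h1), ihy hqy _ h2, ihx hqx _ hxy,
        mul_assoc]
  by_cases hq : q ∣ m
  · by_cases hq' : q ∣ n
    · exact absurd (Nat.eq_one_of_dvd_coprimes hmn hq hq') hq1
    · rw [mul_comm, key n hq' m hmn.symm, mul_comm]
  · exact key m hq n hmn

variable {N r D : ℕ}

/-- For `p ∣ D` the coefficients at multiples of `p` vanish, the support being congruent to 1 modulo
`D`. For `p` prime to `N` and `D` the Hecke recursion applies. The only other prime is the exempt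
`q`. -/
theorem etaDivisors_multiplicative (hN : Squarefree N) (hrN : Even (r * N.divisors.card))
    (hD : D * r * ∑ j ∈ N.divisors, j = 24) (hD2 : Even D) {q : ℕ} (hq1 : q ≠ 1)
    (hq : ∀ p : ℕ, p.Prime → p ≠ q → p ∣ N → p ∣ D)
    (ha : HasFourierExpansion D (etaDivisors N r) a) (ha1 : a 1 = 1)
    (hsupp : ∀ n, (∀ k, n ≠ D * k + 1) → a n = 0)
    (m n : ℕ) (hmn : m.Coprime n) : a (m * n) = a m * a n := by
  refine apply_mul_of_primes ha1 hq1 (fun p hp hpq f m hm => ?_) m n hmn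
  by_cases hpD : p ∣ D
  · rcases Nat.eq_zero_or_pos f with rfl | hf
    · simp [ha1]
    · have h1 : ∀ m, p ∣ m → a m = 0 := fun m hm => hsupp m fun k hk =>
        hp.not_dvd_one ((Nat.dvd_add_right (hpD.mul_right k)).mp (hk ▸ hm))
      rw [h1 _ (dvd_pow_self p hf.ne'), h1 _ ((dvd_pow_self p hf.ne').mul_right m), zero_mul]
  · have hpN : ¬ p ∣ N := fun h => hpD (hq p hp hpq h)
    have hp2 : p ≠ 2 := fun h => hpD (h ▸ hD2.two_dvd)
    obtain ⟨κ, hκ⟩ := hecke_eigenform hN hrN hD ha ha1 hp hp2 hpN hpD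
    exact apply_prime_pow_mul ha1 hp hκ f hm

end Multiplicative

/-! ### Multiplicative eta-products: squarefree levels and series over squares -/

section Multiplicative

lemma coeff_zero_etaSeries (s : Multiset ℕ) : PowerSeries.coeff 0 (etaSeries s) = 1 := by
  rw [PowerSeries.coeff_zero_eq_constantCoeff_apply, etaSeries, map_multiset_prod,
    Multiset.map_map]
  refine Multiset.prod_eq_one fun x hx => ?_
  obtain ⟨j, -, rfl⟩ := Multiset.mem_map.mp hx
  rw [Function.comp_apply, ← PowerSeries.coeff_zero_eq_constantCoeff_apply]
  simp only [PowerSeries.dilate, PowerSeries.coeff_mk, dvd_zero, if_true, Nat.zero_div,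
    eulerSeries]
  decide

lemma etaProduct_nsmul_divisors (N r d : ℕ) (τ : ℂ) :
    etaProduct (r • N.divisors.val.map (d * ·)) τ = etaDivisors N r (d * τ) := by
  rw [etaProduct_eq, Multiset.map_nsmul, Multiset.prod_nsmul, etaDivisors, Finset.prod_pow,
    Multiset.map_map, Finset.prod]
  congr 2
  refine Multiset.map_congr rfl fun j _ => ?_
  simp only [Function.comp_apply]
  push_cast
  ring_nf

/-- Replacing `τ` by `dτ` turns `q^(1/(2d))` into `q^(1/2)` and keeps the coefficients, so the case
`d = 1` with `D = 2 * d` suffices. -/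
theorem isMultiplicativeEtaProduct_nsmul_divisors {N r d q : ℕ} (hN : Squarefree N)
    (hrN : Even (r * N.divisors.card)) (hd : 2 * d * r * ∑ j ∈ N.divisors, j = 24) (hq1 : q ≠ 1)
    (hq : ∀ p : ℕ, p.Prime → p ≠ q → p ∣ N → p ∣ 2 * d) :
    IsMultiplicativeEtaProduct 2 (r • N.divisors.val.map (d * ·)) := by
  have hD0 : 0 < 2 * d := Nat.pos_of_ne_zero fun h => by simp [h] at hd
  have hd0 : 0 < d := by omega
  set s : Multiset ℕ := r • N.divisors.val.map (1 * ·) with hs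
  have hpos : ∀ j ∈ s, 0 < j := fun j hj => by
    obtain ⟨i, hi, rfl⟩ := Multiset.mem_map.mp (Multiset.mem_of_mem_nsmul hj)
    simpa using Nat.pos_of_mem_divisors hi
  have hsum : 2 * d * s.sum = 24 := by
    rw [hs, Multiset.sum_nsmul, ← hd, Finset.sum]
    simp [mul_assoc]
  have ha : HasFourierExpansion (2 * d) (etaDivisors N r) (etaCoeff (2 * d) s) := fun τ hτ => by
    have h1 := hasFourierExpansion_etaProduct hpos hsum τ hτ
    rwa [hs, etaProduct_nsmul_divisors, Nat.cast_one, one_mul, ← hs] at h1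
  refine ⟨etaCoeff (2 * d) s, fun τ hτ => ?_, etaDivisors_multiplicative hN hrN hd
    (even_two_mul d) hq1 hq ha ?_ fun n hn => etaCoeff_eq_zero s hn⟩
  · rw [etaProduct_nsmul_divisors]
    refine (ha _ (im_natCast_mul_pos hd0 hτ)).congr_fun fun n => ?_
    have : (d : ℂ) ≠ 0 := by exact_mod_cast hd0.ne'
    congr 2
    push_cast
    field_simp
  · have := etaCoeff_mul_add_one hD0 s 0
    rw [coeff_zero_etaSeries] at this
    simpa using this

/-- The arithmetic function supported on the squares with value `ψ(l)` at `l²`. -/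
noncomputable def squareSupported (ψ : ℕ → ℂ) (h0 : ψ 0 = 0) : ArithmeticFunction ℂ where
  toFun n := if IsSquare n then ψ n.sqrt else 0
  map_zero' := by simp [h0]

lemma squareSupported_sq (ψ : ℕ → ℂ) (h0 : ψ 0 = 0) (l : ℕ) :
    squareSupported ψ h0 (l ^ 2) = ψ l := by
  change (if IsSquare (l ^ 2) then ψ (l ^ 2).sqrt else 0) = ψ l
  rw [if_pos (IsSquare.sq l), Nat.sqrt_eq']

/-- A product of coprime numbers is a square only if both factors are. -/
lemma squareSupported_mul {ψ : ℕ → ℂ} (h0 : ψ 0 = 0) (hψ : ∀ k l, ψ (k * l) = ψ k * ψ l)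
    (m n : ℕ) (hmn : m.Coprime n) : squareSupported ψ h0 (m * n) =
      squareSupported ψ h0 m * squareSupported ψ h0 n := by
  by_cases h : IsSquare m ∧ IsSquare n
  · obtain ⟨⟨k, rfl⟩, ⟨l, rfl⟩⟩ := h
    rw [← sq, ← sq, ← mul_pow, squareSupported_sq, squareSupported_sq, squareSupported_sq, hψ]
  · have h1 : ¬ IsSquare (m * n) := fun ⟨c, hc⟩ => by
      refine h ⟨?_, ?_⟩
      · obtain ⟨d, hd⟩ := exists_associated_pow_of_mul_eq_pow (Nat.isUnit_iff.mpr hmn)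
          (hc.trans (sq c).symm)
        rw [associated_iff_eq] at hd
        exact ⟨d, by rw [← hd, sq]⟩
      · obtain ⟨d, hd⟩ := exists_associated_pow_of_mul_eq_pow (Nat.isUnit_iff.mpr hmn.symm)
          ((mul_comm n m).trans (hc.trans (sq c).symm))
        rw [associated_iff_eq] at hd
        exact ⟨d, by rw [← hd, sq]⟩
    have e1 : squareSupported ψ h0 (m * n) = 0 := if_neg h1
    rw [e1]
    by_cases hm : IsSquare m
    · have e2 : squareSupported ψ h0 n = 0 := if_neg fun hn => h ⟨hm, hn⟩
      rw [e2, mul_zero]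
    · have e2 : squareSupported ψ h0 m = 0 := if_neg hm
      rw [e2, zero_mul]

lemma isMultiplicativeEtaProduct_of_hasSum {s : Multiset ℕ} {ψ : ℕ → ℂ} (h0 : ψ 0 = 0)
    (hψ : ∀ k l, ψ (k * l) = ψ k * ψ l) (h : ∀ τ : ℂ, 0 < τ.im →
      HasSum (fun l : ℕ => ψ l * cexp (2 * Real.pi * I * τ * ((l ^ 2 : ℕ) / 2)))
        (etaProduct s τ)) :
    IsMultiplicativeEtaProduct 2 s := by
  refine ⟨squareSupported ψ h0, fun τ hτ => ?_, squareSupported_mul h0 hψ⟩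
  have hinj : Function.Injective fun l : ℕ => l ^ 2 := Nat.pow_left_injective two_ne_zero
  refine (hinj.hasSum_iff ?_).mp ((h τ hτ).congr_fun fun l => ?_)
  · intro n hn
    have : squareSupported ψ h0 n = 0 := if_neg fun ⟨k, hk⟩ => hn ⟨k, by simp [hk, sq]⟩
    rw [this, zero_mul]
  · rw [Function.comp_apply, squareSupported_sq]
    norm_cast

/-- Here `N = r = 1`, so the evenness required by the Hecke argument fails; Euler's series with its
character takes its place. -/
theorem isMultiplicativeEtaProduct_twelve : IsMultiplicativeEtaProduct 2 (shape [(12, 1)]) := by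
  refine isMultiplicativeEtaProduct_of_hasSum (ψ := fun l => (chiTwelve l : ℂ)) (by
    rw [Nat.cast_zero, show chiTwelve 0 = 0 by decide, Int.cast_zero]) (fun k l => ?_) fun τ hτ => ?_
  · rw [Nat.cast_mul, chiTwelve_mul, Int.cast_mul]
  · have h1 := hasSum_eta_chiTwelve (im_natCast_mul_pos (j := 12) (by norm_num) hτ)
    have h2 : etaProduct (shape [(12, 1)]) τ = ModularForm.eta ((12 : ℕ) * τ) := by
      simp [etaProduct_eq, shape]
    rw [h2]
    refine h1.congr_fun fun l => ?_
    congr 2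
    push_cast
    ring

/-- Evenness fails again, with `r = 3`. Pairing `n` with `-(n + 1)` in Jacobi's series gives the
coefficient `(-1)^n (2n + 1)`, which is `χ₄(l) l` for `l = 2n + 1`. -/
theorem isMultiplicativeEtaProduct_four : IsMultiplicativeEtaProduct 2 (shape [(4, 3)]) := by
  have hinj : Function.Injective fun n : ℕ => 2 * n + 1 := fun a b h => by simpa using h
  refine isMultiplicativeEtaProduct_of_hasSum (ψ := fun l => ((ZMod.χ₄ l : ℤ) : ℂ) * l)
    (by simp) (fun k l => ?_) fun τ hτ => ?_
  · push_cast
    rw [map_mul]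
    push_cast
    ring
  · have h1 := (hasSum_eta_cube (im_natCast_mul_pos (j := 4) (by norm_num) hτ)).nat_add_neg_add_one
    have h2 : etaProduct (shape [(4, 3)]) τ = ModularForm.eta ((4 : ℕ) * τ) ^ 3 := by
      simp [etaProduct_eq, shape, pow_succ, mul_assoc]
    rw [h2]
    refine (hinj.hasSum_iff ?_).mp (h1.congr_fun fun n => ?_)
    · intro l hl
      have h3 : ¬ l % 2 = 1 := fun h => hl ⟨l / 2, by simp only; omega⟩
      have h4 : ZMod.χ₄ l = 0 := by
        rw [ZMod.χ₄_nat_eq_if_mod_four, if_pos (by omega)]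
      simp [h4]
    · have h3 : ZMod.χ₄ ((2 * n + 1 : ℕ) : ZMod 4) = (-1) ^ n := by
        rw [ZMod.χ₄_eq_neg_one_pow (by omega)]
        congr 1
        omega
      have h4 : ((-1 : ℂ)) ^ (-((n : ℤ) + 1)) = -(-1) ^ n := by
        rw [zpow_neg, zpow_add₀ (by norm_num), zpow_natCast]
        rcases Nat.even_or_odd n with h | h <;> simp [h.neg_one_pow]
      have h5 : (2 * (-((n : ℤ) + 1)) + 1) ^ 2 = (2 * (n : ℤ) + 1) ^ 2 := by ring
      rw [Function.comp_apply, h3, h4, h5, zpow_natCast]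
      push_cast
      ring_nf

end Multiplicative

/-! ### Refuting the other partitions by their first coefficients -/

section Coefficients

/-- The coefficients of `eulerSeries` below `X^43`. -/
def eulerList : List ℤ :=
  [1, -1, -1, 0, 0, 1, 0, 1, 0, 0, 0, 0, -1, 0, 0, -1, 0, 0, 0, 0, 0, 0, 1, 0, 0, 0, 1, 0, 0, 0,
    0, 0, 0, 0, 0, -1, 0, 0, 0, 0, -1, 0, 0]

lemma coeff_eulerSeries {k : ℕ} (hk : k < 43) :
    PowerSeries.coeff k eulerSeries = eulerList.getD k 0 := by
  rw [eulerSeries, PowerSeries.coeff_mk]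
  revert k
  decide +kernel

/-- Multiplication by `eulerSeries.dilate j` for power series truncated at `X^n`. -/
def mulEulerList (n j : ℕ) (L : List ℤ) : List ℤ :=
  (List.range n).map fun i => ∑ k ∈ Finset.range n,
    if j * k ≤ i then eulerList.getD k 0 * L.getD (i - j * k) 0 else 0

/-- The coefficients of `etaSeries l` below `X^n`. -/
def etaList (n : ℕ) (l : List ℕ) : List ℤ :=
  l.foldr (mulEulerList n) [1]

lemma coeff_dilate_mul (f g : PowerSeries ℤ) {j n i : ℕ} (hj : 0 < j) (hi : i < n) :
    PowerSeries.coeff i (g.dilate j * f) = ∑ k ∈ Finset.range n,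
      if j * k ≤ i then PowerSeries.coeff k g * PowerSeries.coeff (i - j * k) f else 0 := by
  rw [PowerSeries.coeff_mul, Finset.Nat.sum_antidiagonal_eq_sum_range_succ_mk, ← Finset.sum_filter]
  symm
  refine Finset.sum_of_injOn (fun k => j * k) ?_ ?_ ?_ ?_
  · intro k _ k' _ h
    exact Nat.eq_of_mul_eq_mul_left hj h
  · intro k hk
    have := (Finset.mem_filter.mp hk).2
    simp only [Finset.coe_range, Set.mem_Iio]
    omega
  · intro k hk hk'
    have hd : ¬ j ∣ k := by
      rintro ⟨c, rfl⟩
      have hc : c ≤ j * c := Nat.le_mul_of_pos_left c hj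
      have := Finset.mem_range.mp hk
      refine hk' ⟨c, ?_, rfl⟩
      simp only [Finset.coe_filter, Finset.mem_range, Set.mem_ofPred_eq]
      omega
    simp [PowerSeries.dilate, hd]
  · intro k hk
    simp [PowerSeries.dilate, Nat.mul_div_cancel_left _ hj]

lemma coeff_etaSeries {n : ℕ} (hn : n ≤ 43) (l : List ℕ) (hl : ∀ j ∈ l, 0 < j)
    {i : ℕ} (hi : i < n) : PowerSeries.coeff i (etaSeries l) = (etaList n l).getD i 0 := by
  induction l generalizing i with
  | nil =>
    rw [Multiset.coe_nil, etaSeries, Multiset.map_zero, Multiset.prod_zero,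
      PowerSeries.coeff_one]
    rcases i with _ | i <;> simp [etaList]
  | cons j l ih =>
    have h1 : etaSeries (j :: l : List ℕ) = eulerSeries.dilate j * etaSeries l := by
      rw [← Multiset.cons_coe, etaSeries, Multiset.map_cons, Multiset.prod_cons]
      rfl
    rw [h1, coeff_dilate_mul _ _ (hl j List.mem_cons_self) hi]
    simp only [etaList, List.foldr_cons, mulEulerList]
    rw [List.getD_eq_getElem _ _ (by simpa using hi), List.getElem_map, List.getElem_range]
    refine Finset.sum_congr rfl fun k hk => ?_
    have hk' := Finset.mem_range.mp hk
    rw [coeff_eulerSeries (hk'.trans_le hn),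
      ih (fun x hx => hl x (List.mem_cons_of_mem j hx)) (by omega)]
    rfl

/-- The partitions of `n` into parts of size at most `k`. -/
def partitionLists : ℕ → ℕ → List (List ℕ)
  | 0, n => if n = 0 then [[]] else []
  | k + 1, n => (List.range (n + 1)).flatMap fun a =>
      if a * (k + 1) ≤ n then
        (partitionLists k (n - a * (k + 1))).map (List.replicate a (k + 1) ++ ·)
      else []

lemma exists_mem_partitionLists (k n : ℕ) (s : Multiset ℕ) (hpos : ∀ j ∈ s, 0 < j)
    (hle : ∀ j ∈ s, j ≤ k) (hs : s.sum = n) : ∃ l ∈ partitionLists k n, (l : Multiset ℕ) = s := by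
  induction k generalizing n s with
  | zero =>
    have : s = 0 := Multiset.eq_zero_of_forall_notMem fun j hj =>
      absurd (hpos j hj) (by simpa using hle j hj)
    subst this
    simp [partitionLists, ← hs]
  | succ k ih =>
    have h1 := Multiset.filter_add_not (· = k + 1) s
    rw [Multiset.filter_eq'] at h1
    set a := s.count (k + 1)
    set t := s.filter fun j => ¬ j = k + 1 with ht
    have h2 : a * (k + 1) + t.sum = n := by
      rw [← hs, ← h1, Multiset.sum_add, Multiset.sum_replicate, smul_eq_mul]
    obtain ⟨l, hl, hlt⟩ := ih (n - a * (k + 1)) t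
      (fun j hj => hpos j (Multiset.mem_of_mem_filter hj))
      (fun j hj => by
        have := hle j (Multiset.mem_of_mem_filter hj)
        have := (Multiset.mem_filter.mp hj).2
        omega) (by omega)
    have h3 : a ≤ a * (k + 1) := Nat.le_mul_of_pos_right a k.succ_pos
    refine ⟨List.replicate a (k + 1) ++ l, ?_, ?_⟩
    · rw [partitionLists, List.mem_flatMap]
      refine ⟨a, List.mem_range.mpr (by omega), ?_⟩
      rw [if_pos (by omega)]
      exact List.mem_map_of_mem hl
    · rw [← Multiset.coe_add, hlt, Multiset.coe_replicate, h1]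

/-- The fifteen cycle shapes of weight `12` with multiplicative eta-product. -/
def multiplicativeShapes : List (Multiset ℕ) :=
  [shape [(1, 12)], shape [(2, 6)], shape [(3, 4)], shape [(4, 3)], shape [(6, 2)],
    shape [(12, 1)], shape [(1, 4), (2, 4)], shape [(1, 3), (3, 3)], shape [(1, 2), (5, 2)],
    shape [(1, 1), (11, 1)], shape [(2, 2), (4, 2)], shape [(2, 1), (10, 1)],
    shape [(3, 1), (9, 1)], shape [(4, 1), (8, 1)],
    shape [(1, 1), (2, 1), (3, 1), (6, 1)]]

/-- Position `k` holds the coefficient of `q^((2k+1)/2)`. The first four relations are those for 15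
= 3·5, 21 = 3·7, 33 = 3·11 and 35 = 5·7; a partition that passes them without being listed fails for
55 = 5·11 or 85 = 5·17. The longer expansion is needed only for those survivors. -/
lemma partitionLists_multiplicative : ∀ l ∈ partitionLists 12 12,
    (∀ j ∈ l, 0 < j) ∧ l.sum = 12 ∧
    (((fun c : List ℤ => c.getD 7 0 = c.getD 1 0 * c.getD 2 0 ∧
        c.getD 10 0 = c.getD 1 0 * c.getD 3 0 ∧ c.getD 16 0 = c.getD 1 0 * c.getD 5 0 ∧
        c.getD 17 0 = c.getD 2 0 * c.getD 3 0) (etaList 18 l)) →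
      (l : Multiset ℕ) ∈ multiplicativeShapes ∨
      ¬ (fun c : List ℤ => c.getD 27 0 = c.getD 2 0 * c.getD 5 0 ∧
        c.getD 42 0 = c.getD 2 0 * c.getD 8 0) (etaList 43 l)) := by
  decide +kernel

end Coefficients

/-! ### The fifteen shapes, the list of thirty, and balance -/

section Shapes

/-- The partitions of `12` with multiplicative eta-product. -/
theorem isMultiplicativeEtaProduct_of_mem {s : Multiset ℕ} (hs : s ∈ multiplicativeShapes) :
    IsMultiplicativeEtaProduct 2 s := by
  -- The shape is `r` copies of `d` times the divisors of `N`, and `q` is the prime exempt from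
  -- dividing `2 * d`.
  have key : ∀ (N r d q : ℕ), Squarefree N → (Even (r * N.divisors.card)) →
      (2 * d * r * ∑ j ∈ N.divisors, j = 24) → q ≠ 1 →
      (∀ p ∈ Finset.range (N + 1), p ≠ q → p ∣ N → Nat.Prime p → p ∣ 2 * d) →
      (r • N.divisors.val.map (d * ·) = s) → IsMultiplicativeEtaProduct 2 s := by
    rintro N r d q hN hr hd hq1 hq rfl
    exact isMultiplicativeEtaProduct_nsmul_divisors hN hr hd hq1 fun p hp hpq hpN =>
      hq p (Finset.mem_range.mpr (Nat.lt_succ_of_le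
        (Nat.le_of_dvd hN.ne_zero.bot_lt hpN))) hpq hpN hp
  simp only [multiplicativeShapes, List.mem_cons, List.not_mem_nil, or_false] at hs
  rcases hs with h | h | h | h | h | h | h | h | h | h | h | h | h | h | h
  · exact key 1 12 1 2 squarefree_one (by decide) (by decide) (by decide) (by decide) (h ▸ by decide)
  · exact key 1 6 2 2 squarefree_one (by decide) (by decide) (by decide) (by decide) (h ▸ by decide)
  · exact key 1 4 3 2 squarefree_one (by decide) (by decide) (by decide) (by decide) (h ▸ by decide)
  · exact h ▸ isMultiplicativeEtaProduct_four
  · exact key 1 2 6 2 squarefree_one (by decide) (by decide) (by decide) (by decide) (h ▸ by decide)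
  · exact h ▸ isMultiplicativeEtaProduct_twelve
  · exact key 2 4 1 2 Nat.prime_two.prime.squarefree (by decide) (by decide) (by decide) (by decide)
      (h ▸ by decide)
  · exact key 3 3 1 3 Nat.prime_three.prime.squarefree (by decide) (by decide) (by decide) (by decide)
      (h ▸ by decide)
  · exact key 5 2 1 5 Nat.prime_five.prime.squarefree (by decide) (by decide) (by decide) (by decide)
      (h ▸ by decide)
  · exact key 11 1 1 11 (Nat.squarefree_iff_prime_squarefree.mpr fun p hp hd => by
      have h1 := Nat.le_of_dvd (by norm_num) hd
      have h2 := hp.two_le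
      have h3 : p ≤ 3 := by nlinarith
      revert hd
      interval_cases p <;> decide) (by decide) (by decide) (by decide)
      (by decide) (h ▸ by decide)
  · exact key 2 2 2 2 Nat.prime_two.prime.squarefree (by decide) (by decide) (by decide) (by decide)
      (h ▸ by decide)
  · exact key 5 1 2 5 Nat.prime_five.prime.squarefree (by decide) (by decide) (by decide) (by decide)
      (h ▸ by decide)
  · exact key 3 1 3 3 Nat.prime_three.prime.squarefree (by decide) (by decide) (by decide) (by decide)
      (h ▸ by decide)
  · exact key 2 1 4 2 Nat.prime_two.prime.squarefree (by decide) (by decide) (by decide) (by decide)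
      (h ▸ by decide)
  · have h6 : Squarefree 6 := by
      rw [Nat.squarefree_iff_prime_squarefree]
      intro p hp hd
      have h1 : p * p ≤ 6 := Nat.le_of_dvd (by norm_num) hd
      have h2 := hp.two_le
      have h3 : p = 2 := by nlinarith
      subst h3
      revert hd
      decide
    exact key 6 1 1 3 h6 (by decide) (by decide) (by decide) (by decide) (h ▸ by decide)

theorem mem_of_isMultiplicativeEtaProduct {s : Multiset ℕ} (hpos : ∀ j ∈ s, 0 < j)
    (hs : s.sum = 12) (h : IsMultiplicativeEtaProduct 2 s) : s ∈ multiplicativeShapes := by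
  obtain ⟨l, hl, rfl⟩ := exists_mem_partitionLists 12 12 s hpos
    (fun j hj => hs ▸ Multiset.single_le_sum (fun _ _ => Nat.zero_le _) j hj) hs
  obtain ⟨hl1, hl2, hl3⟩ := partitionLists_multiplicative l hl
  obtain ⟨a, ha, hmul⟩ := h
  have hsum : 2 * (l : Multiset ℕ).sum = 24 := by rw [hs]
  have haeq := ha.unique two_pos (hasFourierExpansion_etaProduct hl1 hsum)
  have key : ∀ n ≤ 43, ∀ i j k, k < n → (2 * i + 1) * (2 * j + 1) = 2 * k + 1 →
      (2 * i + 1).Coprime (2 * j + 1) → i < n → j < n →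
      (etaList n l).getD k 0 = (etaList n l).getD i 0 * (etaList n l).getD j 0 := by
    intro n hn i j k hk hijk hij hi hj
    have h1 := hmul _ _ hij
    rw [hijk, haeq, etaCoeff_mul_add_one two_pos, etaCoeff_mul_add_one two_pos,
      etaCoeff_mul_add_one two_pos, coeff_etaSeries hn l hl1 hk, coeff_etaSeries hn l hl1 hi,
      coeff_etaSeries hn l hl1 hj] at h1
    exact_mod_cast h1
  exact (hl3 ⟨key 18 (by norm_num) 1 2 7 (by norm_num) (by norm_num) (by norm_num)
      (by norm_num) (by norm_num),
    key 18 (by norm_num) 1 3 10 (by norm_num) (by norm_num) (by norm_num) (by norm_num)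
      (by norm_num),
    key 18 (by norm_num) 1 5 16 (by norm_num) (by norm_num) (by norm_num) (by norm_num)
      (by norm_num),
    key 18 (by norm_num) 2 3 17 (by norm_num) (by norm_num) (by norm_num) (by norm_num)
      (by norm_num)⟩).resolve_right fun h =>
    h ⟨key 43 le_rfl 2 5 27 (by norm_num) (by norm_num) (by norm_num) (by norm_num)
      (by norm_num),
    key 43 le_rfl 2 8 42 (by norm_num) (by norm_num) (by norm_num) (by norm_num) (by norm_num)⟩

lemma map_two_mul_mem_dkmShapes : ∀ s ∈ multiplicativeShapes, s.map (2 * ·) ∈ dkmShapes := by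
  decide +kernel

lemma map_two_mul_mem_dkmShapes_iff (s : Multiset ℕ) :
    s.map (2 * ·) ∈ dkmShapes ↔ s ∈ multiplicativeShapes := by
  have h1 : ∀ t ∈ dkmShapes, t ∈ multiplicativeShapes.map (Multiset.map (2 * ·)) ∨
      ¬ ∀ j ∈ t, 2 ∣ j := by
    decide +kernel
  refine ⟨fun h => ?_, map_two_mul_mem_dkmShapes s⟩
  rcases h1 _ h with h' | hodd
  · obtain ⟨s', hs', he⟩ := List.mem_map.mp h'
    rwa [Multiset.map_injective (fun a b h => Nat.eq_of_mul_eq_mul_left two_pos h) he] at hs'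
  · refine absurd (fun j hj => ?_) hodd
    obtain ⟨i, -, rfl⟩ := Multiset.mem_map.mp hj
    exact dvd_mul_right 2 i

lemma card_dkmShapes : dkmShapes.card = 30 := by
  decide +kernel

lemma card_filter_dkmShapes : (dkmShapes.filter fun s => ∀ j ∈ s, Even j).card = 15 := by
  decide +kernel

lemma hasFourierExpansion_map_two_mul {s : Multiset ℕ} {a : ArithmeticFunction ℂ} :
    HasFourierExpansion 2 (etaProduct s) a ↔
      HasFourierExpansion 1 (etaProduct (s.map (2 * ·))) a := by
  have h1 : ∀ τ, etaProduct (s.map (2 * ·)) τ = etaProduct s (2 * τ) := fun τ => by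
    rw [etaProduct_eq, etaProduct_eq, Multiset.map_map]
    refine congrArg _ (Multiset.map_congr rfl fun j _ => ?_)
    simp only [Function.comp_apply]
    push_cast
    ring_nf
  constructor
  · intro h τ hτ
    rw [h1]
    refine (h (2 * τ) (by simpa using hτ)).congr_fun fun n => ?_
    push_cast
    ring_nf
  · intro h τ hτ
    have h2 := h (τ / 2) (by simpa using hτ)
    rw [h1, mul_div_cancel₀ τ two_ne_zero] at h2
    refine h2.congr_fun fun n => ?_
    push_cast
    ring_nf

theorem existsUnique_hasFourierExpansion (ρ : Nat.Partition 12) :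
    ∃! a : ArithmeticFunction ℂ, HasFourierExpansion 2 (etaProduct ρ.parts) a := by
  have h := hasFourierExpansion_etaProduct (D := 2) (fun j hj => ρ.parts_pos hj)
    (by rw [ρ.parts_sum])
  exact ⟨_, h, fun a ha => ha.unique two_pos h⟩

theorem isMultiplicativeEtaProduct_iff {s : Multiset ℕ} (hpos : ∀ j ∈ s, 0 < j)
    (hs : s.sum = 12) : IsMultiplicativeEtaProduct 2 s ↔ s ∈ multiplicativeShapes :=
  ⟨mem_of_isMultiplicativeEtaProduct hpos hs, isMultiplicativeEtaProduct_of_mem⟩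

lemma isBalanced_of_map_div {s : Multiset ℕ} {M : ℕ} (hM : 0 < M)
    (hpos : ∀ j ∈ s, 0 < j ∧ j ∣ M) (hs : s.map (fun j => M / j) = s) : IsBalanced s := by
  refine ⟨M, hM, ?_⟩
  simp only [Multiset.pure_def, Multiset.bind_def, Multiset.bind_singleton, Multiset.map_map,
    Function.comp_def]
  conv_rhs => rw [← hs, Multiset.map_map]
  refine Multiset.map_congr rfl fun j hj => ?_
  have := (hpos j hj).1
  rw [Function.comp_apply, Nat.cast_div (hpos j hj).2 (by positivity)]

lemma IsBalanced.exists_sum_eq {s : Multiset ℕ} (h : IsBalanced s) :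
    ∃ M : ℕ, (s.map fun j : ℕ => (M : ℚ) / j).sum = s.sum := by
  obtain ⟨M, -, hM⟩ := h
  refine ⟨M, ?_⟩
  simp only [Multiset.pure_def, Multiset.bind_def, Multiset.bind_singleton, Multiset.map_map,
    Function.comp_def] at hM
  rw [hM, Nat.cast_multiset_sum]

lemma isBalanced_cycleShape_iff (l : M12Label) :
    IsBalanced l.cycleShape ↔ l ≠ .c4B ∧ l ≠ .c8B := by
  have key : ∀ M : ℕ, 0 < M → (∀ j ∈ l.cycleShape, 0 < j ∧ j ∣ M) →
      l.cycleShape.map (fun j => M / j) = l.cycleShape → l ≠ .c4B ∧ l ≠ .c8B →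
      (IsBalanced l.cycleShape ↔ l ≠ .c4B ∧ l ≠ .c8B) := fun M hM h1 h2 h3 =>
    iff_of_true (isBalanced_of_map_div hM h1 h2) h3
  -- In the balanced cases `M` is the shortest cycle length times the longest.
  cases l with
  | c1A => exact key 1 (by decide) (by decide) (by decide) (by simp)
  | c2A => exact key 4 (by decide) (by decide) (by decide) (by simp)
  | c2B => exact key 2 (by decide) (by decide) (by decide) (by simp)
  | c3A => exact key 3 (by decide) (by decide) (by decide) (by simp)
  | c3B => exact key 9 (by decide) (by decide) (by decide) (by simp)
  | c4A => exact key 8 (by decide) (by decide) (by decide) (by simp)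
  | c5A => exact key 5 (by decide) (by decide) (by decide) (by simp)
  | c6A => exact key 36 (by decide) (by decide) (by decide) (by simp)
  | c6B => exact key 6 (by decide) (by decide) (by decide) (by simp)
  | c8A => exact key 32 (by decide) (by decide) (by decide) (by simp)
  | c10A => exact key 20 (by decide) (by decide) (by decide) (by simp)
  | c11A | c11B => exact key 11 (by decide) (by decide) (by decide) (by simp)
  | c4B =>
    refine iff_of_false (fun h => ?_) (by simp)
    obtain ⟨M, hM⟩ := h.exists_sum_eq
    -- Equality of the sums reads `M (4 + 2/4) = 12`.
    have h1 : (9 * M : ℚ) = 24 := by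
      simp [M12Label.cycleShape, shape] at hM
      linarith
    have h2 : 9 * M = 24 := by exact_mod_cast h1
    omega
  | c8B =>
    refine iff_of_false (fun h => ?_) (by simp)
    obtain ⟨M, hM⟩ := h.exists_sum_eq
    -- Equality of the sums reads `M (2 + 1/2 + 1/8) = 12`.
    have h1 : (21 * M : ℚ) = 96 := by
      simp [M12Label.cycleShape, shape] at hM
      linarith
    have h2 : 21 * M = 96 := by exact_mod_cast h1
    omega

end Shapes

/-! ### The class equation with bounds for centralizers -/

section ClassEquation

variable {G : Type*} [Group G] [Fintype G]

-- Every fibre of `h ↦ h t h⁻¹` is carried into the centralizer of `t` by a left translation.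
open scoped Classical in
lemma card_le_mul_card_image_conj (t : G) {c : ℕ}
    (hc : (Finset.univ.filter fun h : G => h * t = t * h).card ≤ c) :
    Fintype.card G ≤ c * (Finset.univ.image fun h : G => h * t * h⁻¹).card := by
  refine Finset.card_le_mul_card_image _ _ fun a ha => le_trans ?_ hc
  obtain ⟨k, -, rfl⟩ := Finset.mem_image.mp ha
  refine Finset.card_le_card_of_injOn (fun h => k⁻¹ * h) (fun h hh => ?_)
    fun x _ y _ hxy => mul_left_cancel hxy
  simp only [Finset.coe_filter, Finset.mem_univ, true_and, Set.mem_ofPred_eq] at hh ⊢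
  have h1 : h * t = k * t * k⁻¹ * h := by rw [← hh]; group
  calc k⁻¹ * h * t = k⁻¹ * (h * t) := by group
    _ = k⁻¹ * (k * t * k⁻¹ * h) := by rw [h1]
    _ = t * (k⁻¹ * h) := by group

open scoped Classical in
/-- If the centralizers of pairwise non-conjugate elements have orders at most `cᵢ` with
`∑ 1 / cᵢ = 1`, then these elements represent all conjugacy classes. -/
theorem surjective_conjClasses_mk {ι : Type*} [Fintype ι] (r : ι → G) (c : ι → ℕ)
    (hc : ∀ i, (Finset.univ.filter fun h : G => h * r i = r i * h).card ≤ c i)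
    (hsum : ∑ i, (1 / c i : ℚ) = 1) (hr : Function.Injective fun i => ConjClasses.mk (r i)) :
    Function.Surjective fun i => ConjClasses.mk (r i) := by
  let K : ι → Finset G := fun i => Finset.univ.image fun h : G => h * r i * h⁻¹
  have hdisj : ((Finset.univ : Finset ι) : Set ι).PairwiseDisjoint K := by
    intro i _ j _ hij
    refine Finset.disjoint_left.mpr fun x hxi hxj => hij (hr ?_)
    obtain ⟨a, -, ha⟩ := Finset.mem_image.mp hxi
    obtain ⟨b, -, hb⟩ := Finset.mem_image.mp hxj
    exact ConjClasses.mk_eq_mk_iff_isConj.mpr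
      ((isConj_iff.mpr ⟨a, ha⟩).trans (isConj_iff.mpr ⟨b, hb⟩).symm)
  have h1 : ∀ i, (Fintype.card G : ℚ) * (1 / c i) ≤ (K i).card := fun i => by
    have h2 := card_le_mul_card_image_conj (r i) (hc i)
    have hpos : 0 < c i := lt_of_lt_of_le (Finset.card_pos.mpr ⟨1, by simp⟩) (hc i)
    have hpos' : (0 : ℚ) < c i := by exact_mod_cast hpos
    rw [mul_one_div, div_le_iff₀ hpos', mul_comm]
    exact_mod_cast h2
  have h2 : Fintype.card G ≤ (Finset.univ.biUnion K).card := by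
    rw [Finset.card_biUnion fun i hi j hj hij => hdisj hi hj hij]
    have := Finset.sum_le_sum fun i (_ : i ∈ Finset.univ) => h1 i
    rw [← Finset.mul_sum, hsum, mul_one] at this
    exact_mod_cast this
  have h3 := Finset.eq_univ_of_card _ (le_antisymm (Finset.card_le_univ _) h2)
  intro C
  obtain ⟨x, rfl⟩ := ConjClasses.exists_rep C
  obtain ⟨i, -, hi⟩ := Finset.mem_biUnion.mp (h3 ▸ Finset.mem_univ x)
  obtain ⟨a, -, ha⟩ := Finset.mem_image.mp hi
  exact ⟨i, ConjClasses.mk_eq_mk_iff_isConj.mpr (isConj_iff.mpr ⟨a, ha⟩)⟩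

end ClassEquation

/-! ### The Steiner system preserved by `M₁₂` -/

section Hexads

set_option linter.style.longLine false in
/-- The binary digits of this number mark the sums `∑ i ∈ s, 2 ^ i` over the hexads `s` of the
Steiner system `S(5, 6, 12)`. -/
def hexadTable : ℕ :=
  0x10000000000000000000000020000000000041000000000000000010000000000001000080001000000000040000004200200000000000000000000100000000000020400000000040100000000100200000000800000000200040000010000400000200000001000002008000008000040000000000000000001000000000000000002400000001000000400010000080020000000000004000000200002100004000000000002001008000000400000000080000000010000000008000400201000000000020000004020000000400008000000001000000200400000000800008000000400008000000000200000000000000000000000000000040000000001000020000001000010000000020040000008000000001000020000000402000000400000000008040020001000000000800000000100000000020000001008004000000000002000084000040000002000000000000400100000800020000008000000024000000000000000008000000000000000000200001000001004000008000000040000020000800000200040000000010000000040080000000080200000000020400000000000080000000000000000000040042000000200000000008000100008000000000000800000000000000008200000000000400000000000000000000000800000000000000000000000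

/-- The set of the members of a list, as a binary number. -/
def pointMask (l : List (Fin 12)) : ℕ :=
  l.foldr (fun i m => 1 <<< (i : ℕ) ||| m) 0

/-- The members of the list form a hexad of the Steiner system `S(5, 6, 12)`. -/
def IsHexad (l : List (Fin 12)) : Prop :=
  hexadTable.testBit (pointMask l) = true

instance : DecidablePred IsHexad := fun _ => inferInstanceAs (Decidable (_ = true))

lemma testBit_pointMask (l : List (Fin 12)) (j : ℕ) :
    (pointMask l).testBit j = true ↔ ∃ i ∈ l, (i : ℕ) = j := by
  induction l with
  | nil => simp [pointMask]
  | cons a l ih =>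
    have h : pointMask (a :: l) = 1 <<< (a : ℕ) ||| pointMask l := rfl
    rw [h, Nat.testBit_lor, Bool.or_eq_true, ih, Nat.one_shiftLeft, Nat.testBit_two_pow,
      decide_eq_true_iff, List.exists_mem_cons_iff]

/-- Bitwise "or" ignores order and repetitions, so being a hexad depends only on the set of points.
-/
lemma pointMask_congr {l l' : List (Fin 12)} (h : ∀ i, i ∈ l ↔ i ∈ l') :
    pointMask l = pointMask l' :=
  Nat.eq_of_testBit_eq fun j => Bool.eq_iff_iff.mpr (by simp only [testBit_pointMask, h])

/-- The standard generators of `M₁₂`. -/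
def mathieuGenerator : Fin 3 → Equiv.Perm (Fin 12) :=
  ![c[0, 1, 2, 3, 4, 5, 6, 7, 8, 9, 10],
    c[2, 6, 10, 7] * c[3, 9, 4, 5],
    c[0, 11] * c[1, 10] * c[2, 5] * c[3, 7] * c[4, 8] * c[6, 9]]

/-- The tables of values of the standard generators of `M₁₂`. -/
def mathieuTable : Fin 3 → List (Fin 12) :=
  ![[1, 2, 3, 4, 5, 6, 7, 8, 9, 10, 0, 11], [0, 1, 6, 9, 5, 3, 10, 2, 8, 4, 7, 11],
    [11, 10, 5, 7, 8, 2, 9, 3, 4, 6, 1, 0]]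

lemma mathieuGenerator_apply (k : Fin 3) (i : Fin 12) :
    mathieuGenerator k i = (mathieuTable k).getD i 0 := by
  revert k i
  decide +kernel

lemma mathieuGenerator_mem (k : Fin 3) : mathieuGenerator k ∈ Mathieu12 := by
  refine Subgroup.subset_closure ?_
  fin_cases k
  · exact Or.inl rfl
  · exact Or.inr (Or.inl rfl)
  · exact Or.inr (Or.inr rfl)

lemma isHexad_map_generator (k : Fin 3) {l : List (Fin 12)} (hl : IsHexad l) :
    IsHexad (l.map (mathieuGenerator k)) := by
  -- All subsets of the twelve points are tested as increasing lists; an arbitrary list is then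
  -- replaced by the set of its members.
  have key : ∀ k : Fin 3, ∀ n ∈ List.range 13, ∀ l ∈ List.sublistsLen n (List.finRange 12),
      IsHexad l → IsHexad (l.map fun i : Fin 12 => (mathieuTable k).getD i 0) := by
    decide +kernel
  let l' := (List.finRange 12).filter (· ∈ l)
  have hl' : ∀ i, i ∈ l ↔ i ∈ l' := by simp [l']
  have h1 : IsHexad l' := by
    rwa [IsHexad, ← pointMask_congr hl']
  have hsub : l'.Sublist (List.finRange 12) := List.filter_sublist
  have h2 := key k l'.length (List.mem_range.mpr (Nat.lt_succ_of_le
    (hsub.length_le.trans_eq List.length_finRange))) l' (List.mem_sublistsLen.mpr ⟨hsub, rfl⟩) h1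
  rw [← funext fun i : Fin 12 => mathieuGenerator_apply k i] at h2
  rw [IsHexad] at h2 ⊢
  rwa [pointMask_congr (l' := l'.map (mathieuGenerator k)) fun i => by
    simp only [List.mem_map, hl']]

lemma isHexad_map {g : Equiv.Perm (Fin 12)} (hg : g ∈ Mathieu12) :
    ∀ l : List (Fin 12), IsHexad l → IsHexad (l.map g) := by
  have hmul : ∀ x y : Equiv.Perm (Fin 12), (∀ l, IsHexad l → IsHexad (l.map x)) →
      (∀ l, IsHexad l → IsHexad (l.map y)) → ∀ l, IsHexad l → IsHexad (l.map (x * y)) := by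
    intro x y hx hy l hl
    have := hx _ (hy l hl)
    rwa [List.map_map] at this
  have hone : ∀ l : List (Fin 12), IsHexad l →
      IsHexad (l.map (1 : Equiv.Perm (Fin 12))) := fun l hl => by
    rwa [Equiv.Perm.coe_one, List.map_id]
  induction hg using Subgroup.closure_induction with
  | mem x hx =>
    intro l hl
    rcases hx with rfl | rfl | rfl
    · exact isHexad_map_generator 0 hl
    · exact isHexad_map_generator 1 hl
    · exact isHexad_map_generator 2 hl
  | one => exact hone
  | mul x y _ _ hx hy => exact hmul x y hx hy
  | inv x _ hx =>
    -- Preservation is known for `x` only; since `x` has finite order, its inverse is one of these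
    -- powers.
    have hpow : ∀ n : ℕ, ∀ l, IsHexad l → IsHexad (l.map (x ^ n)) := by
      intro n
      induction n with
      | zero => rw [pow_zero]; exact hone
      | succ n ih => rw [pow_succ]; exact hmul _ _ ih hx
    have h1 : x⁻¹ = x ^ (orderOf x - 1) := by
      rw [inv_eq_iff_mul_eq_one, ← pow_succ', Nat.sub_add_cancel (orderOf_pos x),
        pow_orderOf_eq_one]
    rw [h1]
    exact hpow _

/-- `M₁₂` acts sharply `5`-transitively: an element fixing five points is trivial. -/
theorem eq_one_of_fixes_five {g : Equiv.Perm (Fin 12)} (hg : g ∈ Mathieu12)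
    (h : ∀ i ∈ ([0, 1, 2, 3, 4] : List (Fin 12)), g i = i) : g = 1 := by
  have h1 : ∀ q : Fin 12, IsHexad [0, 1, 2, 3, 4, q] → q = 6 := by decide +kernel
  -- If the points of this hexad are fixed and `p` moves to `q ≠ p`, some partner `r` gives a
  -- contradiction wherever it goes: for each image `s`, four fixed points together with `p, r` form
  -- a hexad but with `q, s` do not.
  have h2 : ∀ p ∉ ([0, 1, 2, 3, 4, 6] : List (Fin 12)), ∀ q ≠ p, ∃ r, ∀ s,
      ∃ B ∈ List.sublistsLen 4 ([0, 1, 2, 3, 4, 6] : List (Fin 12)),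
        IsHexad (B ++ [p, r]) ∧ ¬ IsHexad (B ++ [q, s]) := by
    decide +kernel
  simp only [List.forall_mem_cons, List.not_mem_nil, false_imp_iff, implies_true, and_true] at h
  obtain ⟨e0, e1, e2, e3, e4⟩ := h
  have e6 : g 6 = 6 := h1 _ (by
    simpa only [List.map_cons, List.map_nil, e0, e1, e2, e3, e4] using
      isHexad_map hg [0, 1, 2, 3, 4, 6] (by decide +kernel))
  have hfix : ∀ i ∈ ([0, 1, 2, 3, 4, 6] : List (Fin 12)), g i = i := by
    simp [e0, e1, e2, e3, e4, e6]
  ext1 p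
  rw [Equiv.Perm.one_apply]
  by_contra hne
  obtain ⟨r, hr⟩ := h2 p (fun hp => hne (hfix p hp)) _ hne
  obtain ⟨B, hB, hp, hq⟩ := hr (g r)
  have hB' : B.map g = B := by
    conv_rhs => rw [← List.map_id B]
    exact List.map_congr_left fun i hi => hfix i ((List.mem_sublistsLen.mp hB).1.subset hi)
  have := isHexad_map hg _ hp
  rw [List.map_append, hB'] at this
  exact hq this

end Hexads

/-! ### Bounding centralizers by a search for images of base points -/

section Centralizer

/-- The candidates for the images of base points under a permutation in `M₁₂` that commutes with
`f` and fixes the points in `B`. Each base point comes with a list of hexads, whose points are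
given as `f^[k]` of the `j`-th last base point. -/
def commutingImages (f : Fin 12 → Fin 12) (m : ℕ) (B : List (Fin 12)) :
    List (Fin 12 × List (List (ℕ × ℕ))) → List (List (Fin 12))
  | [] => [B]
  | (x, W) :: L => (commutingImages f m B L).flatMap fun ys =>
      (((List.finRange 12).filter fun y =>
        ((x :: (L.map Prod.fst ++ B)).zip (y :: ys)).all fun p =>
          (List.range m).all fun k => decide (f^[k] x = p.1) == decide (f^[k] y = p.2)).filter
        fun y => W.all fun w =>
          !decide (IsHexad (w.map fun c => f^[c.2] ((x :: (L.map Prod.fst ++ B)).getD c.1 x))) ||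
            decide (IsHexad (w.map fun c => f^[c.2] ((y :: ys).getD c.1 y)))).map (· :: ys)

/-- Commuting with `f` preserves coincidences among iterates, and membership in `M₁₂` preserves
hexads. These are the two filters of the search, so actual image lists pass both. -/
lemma map_mem_commutingImages {f : Fin 12 → Fin 12} (m : ℕ) {B : List (Fin 12)}
    {g : Equiv.Perm (Fin 12)} (hg : g ∈ Mathieu12) (hgf : Function.Commute g f)
    (hB : ∀ b ∈ B, g b = b) (L : List (Fin 12 × List (List (ℕ × ℕ)))) :
    (L.map Prod.fst ++ B).map g ∈ commutingImages f m B L := by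
  induction L with
  | nil =>
    rw [commutingImages, List.mem_singleton, List.map_nil, List.nil_append]
    conv_rhs => rw [← List.map_id B]
    exact List.map_congr_left hB
  | cons a L ih =>
    obtain ⟨x, W⟩ := a
    have hiter : ∀ k y, f^[k] (g y) = g (f^[k] y) := fun k y => ((hgf.iterate_right k) y).symm
    rw [commutingImages, List.mem_flatMap]
    refine ⟨_, ih, List.mem_map.mpr ⟨g x, ?_, rfl⟩⟩
    rw [List.mem_filter, List.mem_filter]
    refine ⟨⟨List.mem_finRange _, ?_⟩, ?_⟩
    · rw [← List.map_cons, List.all_eq_true]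
      intro p hp
      rw [← List.map_id (x :: (L.map Prod.fst ++ B)), List.map_map, List.zip_map'] at hp
      obtain ⟨z, -, rfl⟩ := List.mem_map.mp hp
      rw [List.all_eq_true]
      intro k _
      simp [hiter]
    · rw [List.all_eq_true]
      intro w _
      rw [Bool.or_eq_true, Bool.not_eq_true', decide_eq_false_iff_not, decide_eq_true_iff,
        ← imp_iff_not_or]
      intro hw
      have := isHexad_map hg _ hw
      rw [List.map_map] at this
      convert this using 2
      ext1 c
      rw [Function.comp_apply, ← hiter, ← List.map_cons, List.getD_map]

/-- Elements of `M₁₂` commuting with `f` are determined by the images of base points. -/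
lemma eq_of_commute {f : Fin 12 → Fin 12} {m : ℕ} {xs : List (Fin 12)}
    (hbase : ∀ i ∈ ([0, 1, 2, 3, 4] : List (Fin 12)), ∃ x ∈ xs, ∃ k ∈ List.range m, f^[k] x = i)
    {g h : Equiv.Perm (Fin 12)} (hg : g ∈ Mathieu12) (hh : h ∈ Mathieu12)
    (hgf : Function.Commute g f) (hhf : Function.Commute h f) (heq : xs.map g = xs.map h) :
    g = h := by
  rw [← inv_mul_eq_one]
  refine eq_one_of_fixes_five (Mathieu12.mul_mem (Mathieu12.inv_mem hg) hh) fun i hi => ?_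
  obtain ⟨x, hx, k, -, rfl⟩ := hbase i hi
  rw [Equiv.Perm.mul_apply, Equiv.Perm.inv_eq_iff_eq, (hgf.iterate_right k) x,
    (hhf.iterate_right k) x, List.map_inj_left.mp heq x hx]

variable [Fintype Mathieu12]

open scoped Classical in
lemma card_commute_fix_le {t : Mathieu12} {f : Fin 12 → Fin 12} (m : ℕ) (B : List (Fin 12))
    (L : List (Fin 12 × List (List (ℕ × ℕ)))) (hf : ∀ i, (t : Equiv.Perm (Fin 12)) i = f i)
    (hbase : ∀ i ∈ ([0, 1, 2, 3, 4] : List (Fin 12)),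
      ∃ x ∈ L.map Prod.fst ++ B, ∃ k ∈ List.range m, f^[k] x = i) :
    (Finset.univ.filter fun h : Mathieu12 =>
      h * t = t * h ∧ ∀ b ∈ B, (h : Equiv.Perm (Fin 12)) b = b).card ≤
      (commutingImages f m B L).length := by
  have hcomm : ∀ h : Mathieu12, h * t = t * h →
      Function.Commute (h : Equiv.Perm (Fin 12)) f := fun h hh x => by
    have := congrArg (fun u : Mathieu12 => (u : Equiv.Perm (Fin 12)) x) hh
    simpa [hf] using this
  refine le_trans ?_ (List.toFinset_card_le _)
  refine Finset.card_le_card_of_injOn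
    (fun h : Mathieu12 => (L.map Prod.fst ++ B).map (h : Equiv.Perm (Fin 12))) (fun h hh => ?_)
    fun g hg h hh heq => ?_
  · have hh' := (Finset.mem_filter.mp hh).2
    exact List.mem_toFinset.mpr (map_mem_commutingImages m h.2 (hcomm h hh'.1) hh'.2 L)
  · exact Subtype.ext (eq_of_commute hbase g.2 h.2 (hcomm g (Finset.mem_filter.mp hg).2.1)
      (hcomm h (Finset.mem_filter.mp hh).2.1) heq)

-- Orbit and stabilizer: the centralizer moves `b` to at most twelve points.
open scoped Classical in
lemma card_commute_le_mul (t : Mathieu12) (b : Fin 12) {n : ℕ}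
    (hn : (Finset.univ.filter fun h : Mathieu12 =>
      h * t = t * h ∧ ∀ b' ∈ [b], (h : Equiv.Perm (Fin 12)) b' = b').card ≤ n) :
    (Finset.univ.filter fun h : Mathieu12 => h * t = t * h).card ≤ n * 12 := by
  set S := Finset.univ.filter fun h : Mathieu12 => h * t = t * h
  have h1 := Finset.card_le_mul_card_image (s := S)
    (f := fun h : Mathieu12 => (h : Equiv.Perm (Fin 12)) b) n fun a ha => by
      obtain ⟨k, hk, rfl⟩ := Finset.mem_image.mp ha
      have hk' : k * t = t * k := (Finset.mem_filter.mp hk).2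
      refine le_trans (Finset.card_le_card_of_injOn (fun h => k⁻¹ * h) (fun h hh => ?_)
        fun x _ y _ hxy => mul_left_cancel hxy) hn
      obtain ⟨hh1, hh2⟩ := Finset.mem_filter.mp hh
      have hh3 : h * t = t * h := (Finset.mem_filter.mp hh1).2
      refine Finset.mem_filter.mpr ⟨Finset.mem_univ _, ?_, fun b' hb' => ?_⟩
      · have hk'' : Commute k t := hk'
        exact (hk''.inv_left.mul_left (show Commute h t from hh3))
      · rw [List.mem_singleton.mp hb', Subgroup.coe_mul, Equiv.Perm.mul_apply, hh2]
        simp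
  refine h1.trans (Nat.mul_le_mul_left n ?_)
  exact (Finset.card_le_univ _).trans_eq (Fintype.card_fin 12)

/-- The images of five base points determine the element, and there are 12·11·10·9·8 injective
choices. -/
lemma card_mathieu12_le : Fintype.card Mathieu12 ≤ 95040 := by
  have h1 : Fintype.card (Fin 5 ↪ Fin 12) = 95040 := by
    rw [Fintype.card_embedding_eq, Fintype.card_fin, Fintype.card_fin]
    rfl
  rw [← h1]
  let b : Fin 5 ↪ Fin 12 := Fin.castLEEmb (by norm_num)
  refine Fintype.card_le_of_injective
    (fun g : Mathieu12 => b.trans (g : Equiv.Perm (Fin 12)).toEmbedding) fun g h hgh => ?_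
  refine Subtype.ext (eq_of_commute (f := id) (m := 1) (xs := [0, 1, 2, 3, 4]) (by decide)
    g.2 h.2 (fun _ => rfl) (fun _ => rfl) ?_)
  have h2 : ∀ i : Fin 5, (g : Equiv.Perm (Fin 12)) (b i) = (h : Equiv.Perm (Fin 12)) (b i) :=
    fun i => DFunLike.congr_fun hgh i
  rw [List.map_inj_left]
  intro i hi
  have h3 : ∀ i ∈ ([0, 1, 2, 3, 4] : List (Fin 12)), ∃ j : Fin 5, (b j : ℕ) = i := by
    intro i hi
    refine ⟨⟨i, ?_⟩, rfl⟩
    revert i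
    decide
  obtain ⟨j, hj⟩ := h3 i hi
  rw [← Fin.ext hj, h2]

end Centralizer

/-! ### Explicit representatives and their cycle shapes -/

section Representatives

/-- The nontrivial cycles of a representative of each conjugacy class of `M₁₂`. -/
def M12Label.cycles : M12Label → List (List (Fin 12))
  | c1A => []
  | c2A => [[0, 11], [1, 10], [2, 5], [3, 7], [4, 8], [6, 9]]
  | c2B => [[0, 3], [1, 6], [2, 4], [7, 9]]
  | c3A => [[0, 1, 6], [2, 3, 4], [5, 10, 9]]
  | c3B => [[0, 4, 8], [1, 6, 3], [2, 7, 5], [9, 11, 10]]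
  | c4A => [[0, 6, 2, 3], [1, 9, 4, 10], [5, 7], [8, 11]]
  | c4B => [[0, 2, 4, 9], [1, 7, 10, 3]]
  | c5A => [[0, 3, 2, 4, 1], [5, 8, 11, 9, 7]]
  | c6A => [[0, 2, 4, 1, 3, 10], [5, 8, 9, 6, 11, 7]]
  | c6B => [[0, 3, 4, 1, 6, 2], [5, 8], [7, 10, 9]]
  | c8A => [[0, 1, 4, 2, 3, 9, 5, 11], [6, 8, 10, 7]]
  | c8B => [[0, 9, 4, 2, 3, 1, 5, 11], [7, 8]]
  | c10A => [[0, 3, 4, 8, 6, 2, 1, 9, 5, 11], [7, 10]]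
  | c11A => [[0, 1, 2, 3, 4, 5, 6, 7, 8, 9, 10]]
  | c11B => [[0, 10, 9, 8, 7, 6, 5, 4, 3, 2, 1]]

/-- The representatives as words in the standard generators of `M₁₂`. -/
def M12Label.word : M12Label → List (Fin 3)
  | c1A => []
  | c2A => [2]
  | c2B => [1, 0, 1, 0, 0, 0, 1, 0, 0]
  | c3A => [0, 2, 1, 1, 2, 1]
  | c3B => [2, 0, 2, 0, 0, 0]
  | c4A => [0, 1, 2, 0, 1, 2, 0]
  | c4B => [1, 0, 1, 0, 0, 1]
  | c5A => [1, 0, 0, 0, 1, 2, 0, 0, 0]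
  | c6A => [0, 1, 0, 0, 2, 0, 1]
  | c6B => [0, 0, 0, 2, 1, 2, 1]
  | c8A => [1, 2, 1, 1, 0, 1, 0]
  | c8B => [2, 1, 0, 1, 0]
  | c10A => [1, 2, 0, 1, 0]
  | c11A => [0]
  | c11B => [0, 0, 0, 0, 0, 0, 0, 0, 0, 0]

/-- A representative of the conjugacy class of `M₁₂` with a given label. -/
def M12Label.rep (l : M12Label) : Mathieu12 :=
  (l.word.map fun k => (⟨mathieuGenerator k, mathieuGenerator_mem k⟩ : Mathieu12)).prod

/-- The table of values of the representative. -/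
def M12Label.table (l : M12Label) (i : Fin 12) : Fin 12 :=
  l.word.foldr (fun k j => (mathieuTable k).getD j 0) i

lemma M12Label.rep_apply (l : M12Label) (i : Fin 12) :
    (l.rep : Equiv.Perm (Fin 12)) i = l.table i := by
  rw [rep, table]
  induction l.word with
  | nil => rfl
  | cons k w ih =>
    rw [List.map_cons, List.prod_cons, Subgroup.coe_mul, Equiv.Perm.mul_apply, ih,
      List.foldr_cons]
    exact mathieuGenerator_apply k _

/-- The word puts the representative into `M₁₂`; the disjoint cycles display its cycle type. -/
lemma M12Label.rep_eq (l : M12Label) :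
    (l.rep : Equiv.Perm (Fin 12)) = (l.cycles.map List.formPerm).prod := by
  ext1 i
  rw [rep_apply]
  revert i
  cases l <;> decide +kernel

lemma cycleType_prod_formPerm {L : List (List (Fin 12))} (h2 : ∀ c ∈ L, 2 ≤ c.length)
    (hL : L.flatten.Nodup) :
    (L.map List.formPerm).prod.cycleType = (L.map List.length : List ℕ) := by
  rw [List.nodup_flatten] at hL
  rw [Equiv.Perm.cycleType_eq (L.map List.formPerm) rfl]
  · rw [List.map_map, Multiset.coe_eq_coe]
    refine List.Perm.of_eq (List.map_congr_left fun c hc => ?_)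
    rw [Function.comp_apply, Function.comp_apply,
      List.support_formPerm_of_nodup c (hL.1 c hc) fun x hx => by
        have := h2 c hc
        simp [hx] at this,
      List.toFinset_card_of_nodup (hL.1 c hc)]
  · intro σ hσ
    obtain ⟨c, hc, rfl⟩ := List.mem_map.mp hσ
    exact List.isCycle_formPerm (hL.1 c hc) (h2 c hc)
  · rw [List.pairwise_map]
    refine hL.2.imp_of_mem fun {c d} hc hd hcd => ?_
    exact (List.formPerm_disjoint_iff (hL.1 c hc) (hL.1 d hd) (h2 c hc) (h2 d hd)).mpr hcd

lemma M12Label.parts_rep (l : M12Label) :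
    (l.rep : Equiv.Perm (Fin 12)).partition.parts = l.cycleShape := by
  have h1 : (l.rep : Equiv.Perm (Fin 12)).cycleType = (l.cycles.map List.length : List ℕ) := by
    rw [rep_eq]
    refine cycleType_prod_formPerm ?_ ?_ <;> cases l <;> decide
  rw [Equiv.Perm.parts_partition, ← Equiv.Perm.sum_cycleType, h1]
  cases l <;> decide

end Representatives

/-! ### Completeness of the list of classes -/

section Classes

/-- The orders of the centralizers in `M₁₂`. -/
def M12Label.centralizerOrder : M12Label → ℕ
  | c1A => 95040
  | c2A => 240
  | c2B => 192
  | c3A => 54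
  | c3B => 36
  | c4A => 32
  | c4B => 32
  | c5A => 10
  | c6A => 12
  | c6B => 6
  | c8A => 8
  | c8B => 8
  | c10A => 10
  | c11A => 11
  | c11B => 11

/-- The list of all labels. -/
def M12Label.all : List M12Label :=
  [c1A, c2A, c2B, c3A, c3B, c4A, c4B, c5A, c6A, c6B, c8A, c8B, c10A, c11A, c11B]

lemma M12Label.mem_all (l : M12Label) : l ∈ M12Label.all := by
  cases l <;> simp [M12Label.all]

instance : Fintype M12Label where
  elems := ⟨M12Label.all, by simp [M12Label.all]⟩
  complete := M12Label.mem_all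

/-- This identity makes the list complete: bounds that were not sharp would give a sum below 1. -/
lemma sum_one_div_centralizerOrder : ∑ l : M12Label, (1 / l.centralizerOrder : ℚ) = 1 := by
  change (M12Label.all.map fun l => (1 / l.centralizerOrder : ℚ)).sum = 1
  norm_num [M12Label.all, M12Label.centralizerOrder]

lemma M12Label.exists_commutingImages (l : M12Label) (hl : l ≠ .c1A) :
    ∃ (m : ℕ) (B : List (Fin 12)) (L : List (Fin 12 × List (List (ℕ × ℕ)))),
      (∀ i ∈ ([0, 1, 2, 3, 4] : List (Fin 12)),
        ∃ x ∈ L.map Prod.fst ++ B, ∃ k ∈ List.range m, l.table^[k] x = i) ∧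
      (B = [] ∧ (commutingImages l.table m B L).length = l.centralizerOrder ∨
        B = [0] ∧ (commutingImages l.table m B L).length * 12 = l.centralizerOrder) := by
  cases l with
  | c1A => exact absurd rfl hl
  | c2A =>
    exact ⟨2, [0], [(4, [[(2, 0), (1, 0), (2, 1), (1, 1), (0, 1), (3, 1)], [(3, 0), (1, 0), (0, 0), (2, 1), (0, 1), (3, 1)]]),
      (3, [[(2, 0), (1, 0), (1, 1), (0, 1), (2, 1), (3, 1)], [(3, 0), (1, 0), (0, 0), (0, 1), (2, 1), (3, 1)]]),
      (2, []), (1, [])], by decide +kernel,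
      Or.inr ⟨rfl, by decide +kernel⟩⟩
  | c2B =>
    -- No hexads are needed: the free choices number 8·6·4 = 192.
    exact ⟨2, [], [(2, []), (1, []), (0, [])], by decide +kernel, Or.inl ⟨rfl, by decide +kernel⟩⟩
  | c3A =>
    exact ⟨3, [], [(2, []), (0, [])], by decide +kernel, Or.inl ⟨rfl, by decide +kernel⟩⟩
  | c3B =>
    exact ⟨3, [0], [(2, [[(2, 0), (1, 0), (2, 1), (0, 2), (1, 1), (0, 1)], [(1, 0), (0, 0), (1, 2), (2, 1), (0, 2), (0, 1)]]),
      (1, [])], by decide +kernel,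
      Or.inr ⟨rfl, by decide +kernel⟩⟩
  | c4A =>
    exact ⟨4, [], [(1, []), (0, [])], by decide +kernel, Or.inl ⟨rfl, by decide +kernel⟩⟩
  | c4B =>
    exact ⟨4, [], [(1, []), (0, [])], by decide +kernel, Or.inl ⟨rfl, by decide +kernel⟩⟩
  | c5A =>
    exact ⟨5, [], [(0, [])], by decide +kernel, Or.inl ⟨rfl, by decide +kernel⟩⟩
  | c6A =>
    exact ⟨6, [], [(0, [])], by decide +kernel, Or.inl ⟨rfl, by decide +kernel⟩⟩
  | c6B =>
    exact ⟨6, [], [(0, [])], by decide +kernel, Or.inl ⟨rfl, by decide +kernel⟩⟩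
  | c8A =>
    exact ⟨8, [], [(0, [])], by decide +kernel, Or.inl ⟨rfl, by decide +kernel⟩⟩
  | c8B =>
    exact ⟨8, [], [(0, [])], by decide +kernel, Or.inl ⟨rfl, by decide +kernel⟩⟩
  | c10A =>
    exact ⟨10, [], [(0, [])], by decide +kernel, Or.inl ⟨rfl, by decide +kernel⟩⟩
  | c11A =>
    exact ⟨11, [], [(0, [])], by decide +kernel, Or.inl ⟨rfl, by decide +kernel⟩⟩
  | c11B =>
    exact ⟨11, [], [(0, [])], by decide +kernel, Or.inl ⟨rfl, by decide +kernel⟩⟩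

open scoped Classical in
lemma M12Label.card_commute_rep_le [Fintype Mathieu12] (l : M12Label) :
    (Finset.univ.filter fun h : Mathieu12 => h * l.rep = l.rep * h).card ≤
      l.centralizerOrder := by
  by_cases hl : l = .c1A
  · subst hl
    exact (Finset.card_le_univ _).trans card_mathieu12_le
  · obtain ⟨m, B, L, h1, h2⟩ := l.exists_commutingImages hl
    have h3 := card_commute_fix_le m B L l.rep_apply h1
    rcases h2 with ⟨rfl, h2⟩ | ⟨rfl, h2⟩
    · rw [← h2]
      simpa using h3
    · exact (card_commute_le_mul l.rep 0 h3).trans h2.le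

/-- A conjugating element of `M₁₂` would map the hexad of the iterates 0, 1, 2, 3, 4, 6 of the point
0 to the same pattern for the inverse eleven-cycle, and that pattern is no hexad from any starting
point. -/
lemma not_isConj_rep_c11A_c11B : ¬ IsConj M12Label.c11A.rep M12Label.c11B.rep := by
  intro h
  obtain ⟨g, hg⟩ := isConj_iff.mp h
  have h1 : ∀ i, (g : Equiv.Perm (Fin 12)) (M12Label.c11A.table i) =
      M12Label.c11B.table ((g : Equiv.Perm (Fin 12)) i) := fun i => by
    rw [← M12Label.rep_apply, ← M12Label.rep_apply, ← hg]
    simp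
  have h2 : ∀ k i, (g : Equiv.Perm (Fin 12)) (M12Label.c11A.table^[k] i) =
      M12Label.c11B.table^[k] ((g : Equiv.Perm (Fin 12)) i) := fun k i =>
    (Function.Semiconj.iterate_right (f := (g : Equiv.Perm (Fin 12))) h1 k) i
  have h3 : IsHexad ([0, 1, 2, 3, 4, 6].map fun k => M12Label.c11A.table^[k] 0) := by
    decide +kernel
  have h4 : ∀ y, ¬ IsHexad ([0, 1, 2, 3, 4, 6].map fun k => M12Label.c11B.table^[k] y) := by
    decide +kernel
  have h5 := isHexad_map g.2 _ h3
  rw [List.map_map] at h5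
  refine h4 ((g : Equiv.Perm (Fin 12)) 0) ?_
  convert h5 using 2
  ext1 k
  rw [Function.comp_apply, h2]

lemma classCycleShape_mk_rep (l : M12Label) :
    classCycleShape (ConjClasses.mk l.rep) = l.cycleShape :=
  l.parts_rep

lemma injective_mk_rep : Function.Injective fun l : M12Label => ConjClasses.mk l.rep := by
  intro l l' h
  have h1 : l.cycleShape = l'.cycleShape := by
    rw [← classCycleShape_mk_rep, ← classCycleShape_mk_rep]
    exact congrArg classCycleShape h
  have h2 : ∀ l l' : M12Label, l.cycleShape = l'.cycleShape → l = l' ∨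
      (l = .c11A ∧ l' = .c11B) ∨ (l = .c11B ∧ l' = .c11A) := by
    intro l l' h
    cases l <;> cases l' <;> first
      | exact Or.inl rfl
      | exact Or.inr (Or.inl ⟨rfl, rfl⟩)
      | exact Or.inr (Or.inr ⟨rfl, rfl⟩)
      | exact absurd h (by decide)
  rcases h2 l l' h1 with h | ⟨rfl, rfl⟩ | ⟨rfl, rfl⟩
  · exact h
  · exact absurd (ConjClasses.mk_eq_mk_iff_isConj.mp h) not_isConj_rep_c11A_c11B
  · exact absurd (ConjClasses.mk_eq_mk_iff_isConj.mp h).symm not_isConj_rep_c11A_c11B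

/-- The labelling of the conjugacy classes of `M₁₂`. -/
noncomputable def conjClassesEquiv : M12Label ≃ ConjClasses Mathieu12 :=
  Equiv.ofBijective (fun l => ConjClasses.mk l.rep) ⟨injective_mk_rep, by
    have : Fintype Mathieu12 := Fintype.ofFinite _
    refine surjective_conjClasses_mk _ _ (fun l => ?_)
      sum_one_div_centralizerOrder injective_mk_rep
    convert l.card_commute_rep_le⟩

lemma classCycleShape_conjClassesEquiv (l : M12Label) :
    classCycleShape (conjClassesEquiv l) = l.cycleShape :=
  classCycleShape_mk_rep l

end Classes

/-! ### Comparing multiplicative shapes with cycle shapes -/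

section Main

lemma cycleShape_mem_multiplicativeShapes_iff (l : M12Label) :
    l.cycleShape ∈ multiplicativeShapes ↔ l ≠ .c4B ∧ l ≠ .c8B := by
  cases l <;> first
    | exact iff_of_true (by decide) (by simp)
    | exact iff_of_false (by decide) (by simp)

lemma mem_multiplicativeShapes_and_ne_cycleShape_iff (s : Multiset ℕ) :
    (s ∈ multiplicativeShapes ∧ ∀ l : M12Label, l.cycleShape ≠ s) ↔
      s = shape [(4, 3)] ∨ s = shape [(3, 1), (9, 1)] ∨ s = shape [(12, 1)] := by
  constructor
  · rintro ⟨h1, h2⟩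
    have key : ∀ s ∈ multiplicativeShapes, s ∈ M12Label.all.map M12Label.cycleShape ∨
        s = shape [(4, 3)] ∨ s = shape [(3, 1), (9, 1)] ∨ s = shape [(12, 1)] := by
      decide
    refine (key s h1).resolve_left fun h => ?_
    obtain ⟨l, -, hl⟩ := List.mem_map.mp h
    exact h2 l hl
  · rintro (rfl | rfl | rfl)
    all_goals exact ⟨by decide, fun l => by cases l <;> decide⟩

end Main

end Preliminaries

theorem mainTheorem2 :
    -- the Fourier coefficients `a_n` of the eta-product of a partition of 12 are well defined,
    -- and after `q → q²` they are those of the eta-product of the doubled shape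
    (∀ ρ : Nat.Partition 12,
      (∃! a : ArithmeticFunction ℂ, HasFourierExpansion 2 (etaProduct ρ.parts) a) ∧
      (∀ a : ArithmeticFunction ℂ, HasFourierExpansion 2 (etaProduct ρ.parts) a ↔
        HasFourierExpansion 1 (etaProduct (ρ.parts.map (2 * ·))) a)) ∧
    -- a partition of 12 gives a multiplicative eta-product iff its double is in the list of 30,
    -- which contains 15 shapes with only even cycles
    (∀ ρ : Nat.Partition 12,
      IsMultiplicativeEtaProduct 2 ρ.parts ↔ ρ.parts.map (2 * ·) ∈ dkmShapes) ∧
    dkmShapes.card = 30 ∧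
    (dkmShapes.filter fun s => ∀ j ∈ s, Even j).card = 15 ∧
    -- the conjugacy classes of `M₁₂` with their cycle shapes; all but 4B and 8B are balanced
    -- and give multiplicative eta-products, whose doubles are in the list; 4B and 8B do not
    (∃ e : M12Label ≃ ConjClasses Mathieu12,
      (∀ l, classCycleShape (e l) = l.cycleShape) ∧
      (∀ C, IsBalanced (classCycleShape C) ↔ C ≠ e .c4B ∧ C ≠ e .c8B) ∧
      (∀ C, IsBalanced (classCycleShape C) → IsMultiplicativeEtaProduct 2 (classCycleShape C)) ∧
      (∀ C, IsBalanced (classCycleShape C) → (classCycleShape C).map (2 * ·) ∈ dkmShapes) ∧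
      ¬ IsMultiplicativeEtaProduct 2 (classCycleShape (e .c4B)) ∧
      ¬ IsMultiplicativeEtaProduct 2 (classCycleShape (e .c8B))) ∧
    -- the remaining multiplicative eta-products of partitions of 12 are `4³`, `3 9` and `12`
    (∀ ρ : Nat.Partition 12,
      (IsMultiplicativeEtaProduct 2 ρ.parts ∧
          ¬ ∃ C : ConjClasses Mathieu12, classCycleShape C = ρ.parts) ↔
        ρ.parts = shape [(4, 3)] ∨ ρ.parts = shape [(3, 1), (9, 1)] ∨
          ρ.parts = shape [(12, 1)]) := by
  have hiff : ∀ ρ : Nat.Partition 12,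
      IsMultiplicativeEtaProduct 2 ρ.parts ↔ ρ.parts ∈ multiplicativeShapes := fun ρ =>
    isMultiplicativeEtaProduct_iff (fun _ hj => ρ.parts_pos hj) ρ.parts_sum
  have hshape : ∀ C, ∃ l, C = conjClassesEquiv l ∧ classCycleShape C = l.cycleShape := fun C =>
    ⟨conjClassesEquiv.symm C, by simp, by
      conv_lhs => rw [← conjClassesEquiv.apply_symm_apply C]
      exact classCycleShape_conjClassesEquiv _⟩
  have hbal : ∀ C, IsBalanced (classCycleShape C) → classCycleShape C ∈ multiplicativeShapes := by
    intro C h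
    obtain ⟨l, -, hl⟩ := hshape C
    rw [hl] at h ⊢
    exact (cycleShape_mem_multiplicativeShapes_iff l).mpr ((isBalanced_cycleShape_iff l).mp h)
  have hnot : ∀ l : M12Label, ¬ (l ≠ .c4B ∧ l ≠ .c8B) →
      ¬ IsMultiplicativeEtaProduct 2 (classCycleShape (conjClassesEquiv l)) := by
    intro l hl h
    rw [classCycleShape_conjClassesEquiv] at h
    refine hl ((cycleShape_mem_multiplicativeShapes_iff l).mp
      (mem_of_isMultiplicativeEtaProduct ?_ ?_ h))
    · rw [← l.parts_rep]
      exact fun j hj => Nat.Partition.parts_pos _ hj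
    · rw [← l.parts_rep]
      exact Nat.Partition.parts_sum _
  refine ⟨fun ρ => ⟨existsUnique_hasFourierExpansion ρ, fun a =>
    hasFourierExpansion_map_two_mul⟩, fun ρ => (hiff ρ).trans
    (map_two_mul_mem_dkmShapes_iff _).symm, card_dkmShapes, ?_, ⟨conjClassesEquiv,
    classCycleShape_conjClassesEquiv, fun C => ?_, fun C h => ?_, fun C h => ?_, ?_, ?_⟩,
    fun ρ => ?_⟩
  · convert card_filter_dkmShapes
  · obtain ⟨l, rfl, hl⟩ := hshape C
    rw [hl, isBalanced_cycleShape_iff, conjClassesEquiv.injective.ne_iff,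
      conjClassesEquiv.injective.ne_iff]
  · exact isMultiplicativeEtaProduct_of_mem (hbal C h)
  · exact map_two_mul_mem_dkmShapes _ (hbal C h)
  · exact hnot _ (by simp)
  · exact hnot _ (by simp)
  · rw [← mem_multiplicativeShapes_and_ne_cycleShape_iff, hiff]
    refine and_congr_right fun _ => ?_
    rw [not_exists]
    refine ⟨fun h l hl => h (conjClassesEquiv l) (by rw [classCycleShape_conjClassesEquiv, hl]),
      fun h C hC => ?_⟩
    obtain ⟨l, -, hl⟩ := hshape C
    exact h l (hl.symm.trans hC)
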